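/- Fix a number $k\ge 1$ of agents. An instance of Budgeted Conflict Free Egalitarian Allocation (BCFEA) consists of a finite graph $G=(V,E)$ on the set $V$ of items (the conflict graph), a utility $p(v)\in\mathbb{Z}_{\ge 0}$ and a cost $c(v)\in\mathbb{Z}_{\ge 0}$ for every item $v$, the same for all agents, and thresholds $P,B\in\mathbb{Z}_{\ge 0}$. A solution is a partition of $V$ into $k$ bundles $S_1,\dots,S_k$ (possibly empty) such that, for every $i$, the set $S_i$ is independent in $G$, $\sum_{v\in S_i}c(v)\le B$ and $\sum_{v\in S_i}p(v)\ge P$; a yes-instance is one that has a solution. Instances are encoded as binary words in which the utilities $p(v)$ and the costs $c(v)$ are written in unary (the graph is given by its adjacency matrix, and the thresholds $P,B$ may be written in binary). Solving an instance means deciding whether it is a yes-instance and, if it is, outputting a solution. Running time is counted on a random access machine with unit-cost addition and (truncated) subtraction; it is polynomial if it is bounded by a polynomial in the length of the encoding. Then: (a) for every constant $w$ there is a polynomial-time algorithm that solves all instances of BCFEA with $k$ agents whose conflict graph has treewidth at most $w$; (b) there is a polynomial-time algorithm that solves all instances of BCFEA with $k$ agents whose conflict graph is chordal (every cycle of length at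 least four has a chord); (c) if the conflict graph $G$ of a yes-instance with $k$ agents is chordal, then every clique of $G$ has at most $k$ vertices, and the treewidth of $G$ is at most $k-1$ (the treewidth of the graph without vertices being taken as $0$). -/

import Mathlib

namespace BCFEA

universe u

/-! ## Chordal graphs and treewidth -/

/-- A graph is chordal if every cycle of length at least four has a chord: an edge of the graph
that joins two vertices of the cycle and is not an edge of the cycle. -/
def IsChordal {V : Type u} (G : SimpleGraph V) : Prop :=
  ∀ (v : V) (c : G.Walk v v), c.IsCycle → 4 ≤ c.length →
    ∃ x ∈ c.support, ∃ y ∈ c.support, G.Adj x y ∧ s(x, y) ∉ c.edges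

/-- A (finite) tree decomposition of a graph. -/
structure TreeDecomposition {V : Type u} (G : SimpleGraph V) where
  /-- The nodes of the tree. -/
  Node : Type
  finite_node : Finite Node
  /-- The tree. -/
  tree : SimpleGraph Node
  isTree : tree.IsTree
  /-- The bag of each node. -/
  bag : Node → Finset V
  exists_mem_bag : ∀ v : V, ∃ t : Node, v ∈ bag t
  exists_edge_bag : ∀ u v : V, G.Adj u v → ∃ t : Node, u ∈ bag t ∧ v ∈ bag t
  /-- The nodes whose bags contain a given vertex induce a subtree. -/
  connected : ∀ v : V, (tree.induce {t : Node | v ∈ bag t}).Connected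

/-- The treewidth of a finite graph: the least `w` such that some tree decomposition has all its
bags of size at most `w + 1`. (For the graph without vertices this is `0`.) -/
noncomputable def treewidth {V : Type u} (G : SimpleGraph V) : ℕ :=
  sInf {w : ℕ | ∃ D : TreeDecomposition G, ∀ t : D.Node, (D.bag t).card ≤ w + 1}

/-! ## Budgeted conflict free egalitarian allocation -/

/-- An instance with identical additive utilities and costs, over the items `V`. The number `k` of
agents is a constant, hence a separate parameter. -/
structure Instance (V : Type u) where
  /-- The conflict graph. -/
  graph : SimpleGraph V
  /-- The utility of each single item. -/
  utility : V → ℕ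
  /-- The cost of each single item. -/
  cost : V → ℕ
  /-- The lower bound on the utility of a bundle. -/
  P : ℕ
  /-- The upper bound on the cost of a bundle. -/
  B : ℕ

/-- `a` gives item `v` to agent `a v`, so it describes the partition of the items into the bundles
`{v | a v = i}`. It is a solution if every bundle is independent in the conflict graph, costs at
most `B` and has utility at least `P`. -/
def Instance.IsSolution {V : Type u} [Fintype V] (I : Instance V) {k : ℕ} (a : V → Fin k) : Prop :=
  ∀ i : Fin k,
    I.graph.IsIndepSet {v | a v = i} ∧
    ∑ v with a v = i, I.cost v ≤ I.B ∧
    I.P ≤ ∑ v with a v = i, I.utility v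

/-- The instance is a yes-instance for `k` agents. -/
def Instance.IsYes {V : Type u} [Fintype V] (I : Instance V) (k : ℕ) : Prop :=
  ∃ a : V → Fin k, I.IsSolution a

/-! ## Encoding of instances as binary words -/

/-- Unary code: `m` ones, followed by a zero. -/
def unary (m : ℕ) : List Bool :=
  List.replicate m true ++ [false]

/-- Self-delimiting binary code: the number of binary digits in unary, then the digits, least
significant digit first. -/
def binary (m : ℕ) : List Bool :=
  unary m.bits.length ++ m.bits

open Classical in
/-- The word that encodes an instance with items `0, …, n - 1`: the number `n` in unary, the
adjacency matrix of the conflict graph row by row, all utilities and then all costs in unary, and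
the two thresholds in binary. -/
noncomputable def Instance.encode {n : ℕ} (I : Instance (Fin n)) : List Bool :=
  unary n
    ++ (List.finRange n).flatMap (fun u =>
        (List.finRange n).map (fun v => decide (I.graph.Adj u v)))
    ++ (List.finRange n).flatMap (fun v => unary (I.utility v))
    ++ (List.finRange n).flatMap (fun v => unary (I.cost v))
    ++ binary I.P ++ binary I.B

/-! ## Random access machines

Programs work on registers and on arrays of natural numbers. Only finitely many registers and arrays
are named by a program, and array cells are accessed through computed indices. Arithmetic is
restricted to addition and truncated subtraction; with unit costs, such machines are polynomially
equivalent to Turing machines. -/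

/-- The memory: `reg x` is the content of register `x`, and `arr a i` is that of cell `i` of
array `a`. -/
structure State where
  reg : ℕ → ℕ
  arr : ℕ → ℕ → ℕ

/-- Arithmetic expressions. -/
inductive Expr where
  | const (m : ℕ)
  | reg (x : ℕ)
  | cell (a : ℕ) (e : Expr)
  | add (e₁ e₂ : Expr)
  | sub (e₁ e₂ : Expr)

/-- The value of an expression; subtraction is truncated at zero. -/
def Expr.eval (s : State) : Expr → ℕ
  | .const m => m
  | .reg x => s.reg x
  | .cell a e => s.arr a (e.eval s)
  | .add e₁ e₂ => e₁.eval s + e₂.eval s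
  | .sub e₁ e₂ => e₁.eval s - e₂.eval s

/-- The number of steps that the evaluation of an expression takes: one for each constant, memory
access and arithmetic operation in it. -/
def Expr.steps : Expr → ℕ
  | .const _ => 1
  | .reg _ => 1
  | .cell _ e => e.steps + 1
  | .add e₁ e₂ => e₁.steps + e₂.steps + 1
  | .sub e₁ e₂ => e₁.steps + e₂.steps + 1

/-- Structured programs. In `branch` and `loop`, the value zero of the tested expression stands for
`false`, and every other value for `true`. -/
inductive Program where
  | skip
  | assign (x : ℕ) (e : Expr)
  | store (a : ℕ) (index e : Expr)
  | seq (p q : Program)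
  | branch (e : Expr) (p q : Program)
  | loop (e : Expr) (p : Program)

/-- The state after register `x` has been overwritten by `m`. -/
def State.setReg (s : State) (x m : ℕ) : State where
  reg := Function.update s.reg x m
  arr := s.arr

/-- The state after cell `i` of array `a` has been overwritten by `m`. -/
def State.setCell (s : State) (a i m : ℕ) : State where
  reg := s.reg
  arr := Function.update s.arr a (Function.update (s.arr a) i m)

/-- `Runs p s t s'`: started in state `s`, program `p` halts after exactly `t` steps in
state `s'`. -/
inductive Runs : Program → State → ℕ → State → Prop
  | skip (s : State) : Runs .skip s 1 s
  | assign (x : ℕ) (e : Expr) (s : State) :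
      Runs (.assign x e) s (e.steps + 1) (s.setReg x (e.eval s))
  | store (a : ℕ) (index e : Expr) (s : State) :
      Runs (.store a index e) s (index.steps + e.steps + 1)
        (s.setCell a (index.eval s) (e.eval s))
  | seq {p q : Program} {s s' s'' : State} {t t' : ℕ} :
      Runs p s t s' → Runs q s' t' s'' → Runs (.seq p q) s (t + t') s''
  | branch_true {e : Expr} {p q : Program} {s s' : State} {t : ℕ} :
      e.eval s ≠ 0 → Runs p s t s' → Runs (.branch e p q) s (e.steps + 1 + t) s'
  | branch_false {e : Expr} {p q : Program} {s s' : State} {t : ℕ} :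
      e.eval s = 0 → Runs q s t s' → Runs (.branch e p q) s (e.steps + 1 + t) s'
  | loop_true {e : Expr} {p : Program} {s s' s'' : State} {t t' : ℕ} :
      e.eval s ≠ 0 → Runs p s t s' → Runs (.loop e p) s' t' s'' →
        Runs (.loop e p) s (e.steps + 1 + t + t') s''
  | loop_false {e : Expr} {p : Program} {s : State} :
      e.eval s = 0 → Runs (.loop e p) s (e.steps + 1) s

/-- The initial state on an input word: register `0` holds its length, array `0` its letters, as
numbers `0` and `1`, and the rest of the memory is zero. -/
def initial (x : List Bool) : State where
  reg r := if r = 0 then x.length else 0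
  arr a i := if a = 0 then (x.getD i false).toNat else 0

/-- The state `s` holds a correct answer to the instance for `k` agents: either register `0` is `1`
and the first cells of array `1` hold a solution (cell `v` holds the agent, a number below `k`,
that receives item `v`), or register `0` is `0` and there is no solution. -/
def Instance.IsAnswer {n : ℕ} (I : Instance (Fin n)) (k : ℕ) (s : State) : Prop :=
  (s.reg 0 = 1 ∧ ∃ a : Fin n → Fin k, I.IsSolution a ∧ ∀ v : Fin n, s.arr 1 v = a v) ∨
  (s.reg 0 = 0 ∧ ¬ I.IsYes k)

/-- For the fixed number `k` of agents, the allocation problem, with utilities and costs in unary,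
is solvable in polynomial time on the instances whose conflict graph lies in the graph class `C`: one
program correctly answers all these instances within a number of steps that is polynomial in the
length of the encoding. -/
def PolyTimeSolvable (k : ℕ) (C : ∀ n : ℕ, SimpleGraph (Fin n) → Prop) : Prop :=
  ∃ (p : Program) (f : Polynomial ℕ), ∀ (n : ℕ) (I : Instance (Fin n)), C n I.graph →
    ∃ (t : ℕ) (s : State), Runs p (initial I.encode) t s ∧ t ≤ f.eval I.encode.length ∧
      I.IsAnswer k s

end BCFEA

namespace BCFEA

/-! The algorithm is a dynamic program that never computes a tree decomposition: a bag is any tuple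
of `W = w + 1` numbers, and all such tuples are tried. A zone is a component of the graph outside a
bag `X`, named by one of its vertices `r`. For a bag `Y` that contains all neighbours of the zone,
the vertices `j` are scanned in increasing order. A vertex of `Y` in the zone contributes its own
weights, and the least vertex of a component outside `Y` calls for a finished fact about that
component. Costs and utilities are unary, so all bundle sums stay below a bound `M` linear in the
input length. For fixed `k` and `w` there are thus polynomially many facts, and the program computes
the least set of facts closed under the rules.

Soundness (`Net.Sem.of_rule`) holds for every graph, by gluing colourings along separating bags.
Treewidth enters only in completeness (`Net.exists_derivation`). The bags of a tree decomposition
offer a next bag for every component (`exists_bagFamily`), because the nodes whose bags meet a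
connected set form a subtree, and its gate towards the present node (`exists_gate`) carries all the
neighbours that matter.

On the machine, all loops run to the same bound `M`, so nested loops take polynomial time
(`Cmd.runs_compile`). A single routine computes least fixed points over tuples
(`Cmd.saturate_spec`), and it serves for connectivity, separation, the facts and acceptance. A
solution is found by fixing the agents of the items one after the other and rerunning the decision
(`tryCmd_spec`). Since the decision is sound, a solution that is output is always correct.

For chordal graphs, the items of a clique lie in different bundles, so cliques of a yes-instance
have at most `k` vertices. A chordal graph has a tree decomposition into cliques, built by splitting
along clique separators (`IsChordal.exists_separation`, `IsChordal.nonempty_cliqueTree`), hence a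
chordal yes-instance has treewidth at most `k - 1`. The program for treewidth `k - 1` therefore also
solves all chordal instances: where the treewidth is larger, the answer "no" is right. -/

/-! ## A total sublanguage with bounded loops -/

/-- Commands whose loops run through `0, …, m - 1`, where `m` is the content of register `1`. -/
inductive Cmd where
  | skip
  | assign (x : ℕ) (e : Expr)
  | store (a : ℕ) (index e : Expr)
  | seq (p q : Cmd)
  | branch (e : Expr) (p q : Cmd)
  | iter (x : ℕ) (p : Cmd)

/-- The state after `m` rounds of the loop over `x` with body `f`. -/
def State.rounds (f : State → State) (x : ℕ) (s : State) : ℕ → State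
  | 0 => s
  | m + 1 => f ((State.rounds f x s m).setReg x m)

/-- The final state of a command. -/
def Cmd.exec : Cmd → State → State
  | .skip, s => s
  | .assign x e, s => s.setReg x (e.eval s)
  | .store a i e, s => s.setCell a (i.eval s) (e.eval s)
  | .seq p q, s => q.exec (p.exec s)
  | .branch e p q, s => if e.eval s ≠ 0 then p.exec s else q.exec s
  | .iter x p, s => (State.rounds p.exec x s (s.reg 1)).setReg x (s.reg 1)

/-- The command may write to register `r`. -/
def Cmd.Writes : Cmd → ℕ → Prop
  | .skip, _ => False
  | .assign x _, r => r = x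
  | .store _ _ _, _ => False
  | .seq p q, r => p.Writes r ∨ q.Writes r
  | .branch _ p q, r => p.Writes r ∨ q.Writes r
  | .iter x p, r => r = x ∨ p.Writes r

/-- The command may write to array `b`. -/
def Cmd.Stores : Cmd → ℕ → Prop
  | .skip, _ => False
  | .assign _ _, _ => False
  | .store a _ _, b => b = a
  | .seq p q, b => p.Stores b ∨ q.Stores b
  | .branch _ p q, b => p.Stores b ∨ q.Stores b
  | .iter _ p, b => p.Stores b

/-- Neither the loop bound nor the counter of a running loop is overwritten. -/
def Cmd.WF : Cmd → Prop
  | .skip => True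
  | .assign x _ => x ≠ 1
  | .store _ _ _ => True
  | .seq p q => p.WF ∧ q.WF
  | .branch _ p q => p.WF ∧ q.WF
  | .iter x p => x ≠ 1 ∧ ¬ p.Writes x ∧ p.WF

/-- Translation into the language of the machine. -/
def Cmd.compile : Cmd → Program
  | .skip => .skip
  | .assign x e => .assign x e
  | .store a i e => .store a i e
  | .seq p q => .seq p.compile q.compile
  | .branch e p q => .branch e p.compile q.compile
  | .iter x p => .seq (.assign x (.const 0))
      (.loop (.sub (.reg 1) (.reg x)) (.seq p.compile (.assign x (.add (.reg x) (.const 1)))))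

open Polynomial in
/-- A bound on the running time, in terms of the loop bound. -/
noncomputable def Cmd.cost : Cmd → Polynomial ℕ
  | .skip => C 1
  | .assign _ e => C (e.steps + 1)
  | .store _ i e => C (i.steps + e.steps + 1)
  | .seq p q => p.cost + q.cost
  | .branch e p q => C (e.steps + 1) + p.cost + q.cost
  | .iter _ p => C 6 + X * (p.cost + C 8)

/-! ### Effect of commands on the memory, and their running time -/

@[simp] theorem State.setReg_reg (s : State) (x m y : ℕ) :
    (s.setReg x m).reg y = if y = x then m else s.reg y := by
  simp [State.setReg, Function.update_apply]

@[simp] theorem State.setReg_arr (s : State) (x m : ℕ) : (s.setReg x m).arr = s.arr := rfl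

@[simp] theorem State.setCell_reg (s : State) (a i m : ℕ) : (s.setCell a i m).reg = s.reg := rfl

theorem State.setCell_arr (s : State) (a i m b j : ℕ) :
    (s.setCell a i m).arr b j = if b = a ∧ j = i then m else s.arr b j := by
  simp only [State.setCell, Function.update_apply]
  split_ifs <;> simp_all

theorem State.setCell_arr_of_ne (s : State) (a i m : ℕ) {b : ℕ} (h : b ≠ a) :
    (s.setCell a i m).arr b = s.arr b := by
  simp [State.setCell, h]

theorem Cmd.exec_reg {p : Cmd} {r : ℕ} (h : ¬ p.Writes r) (s : State) :
    (p.exec s).reg r = s.reg r := by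
  induction p generalizing s with
  | skip => rfl
  | assign x e => simp_all [Cmd.exec, Cmd.Writes]
  | store a i e => rfl
  | seq p q ihp ihq =>
    simp only [Cmd.Writes, not_or] at h
    rw [Cmd.exec, ihq h.2, ihp h.1]
  | branch e p q ihp ihq =>
    simp only [Cmd.Writes, not_or] at h
    rw [Cmd.exec]
    split_ifs
    · exact ihp h.1 s
    · exact ihq h.2 s
  | iter x p ih =>
    simp only [Cmd.Writes, not_or] at h
    simp only [Cmd.exec, State.setReg_reg, h.1, if_false]
    induction s.reg 1 with
    | zero => rfl
    | succ m ihm => simp [State.rounds, ih h.2, h.1, ihm]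

theorem Cmd.exec_arr {p : Cmd} {a : ℕ} (h : ¬ p.Stores a) (s : State) :
    (p.exec s).arr a = s.arr a := by
  induction p generalizing s with
  | skip => rfl
  | assign x e => rfl
  | store b i e => exact State.setCell_arr_of_ne _ _ _ _ h
  | seq p q ihp ihq =>
    simp only [Cmd.Stores, not_or] at h
    rw [Cmd.exec, ihq h.2, ihp h.1]
  | branch e p q ihp ihq =>
    simp only [Cmd.Stores, not_or] at h
    rw [Cmd.exec]
    split_ifs
    · exact ihp h.1 s
    · exact ihq h.2 s
  | iter x p ih =>
    simp only [Cmd.exec, State.setReg_arr]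
    induction s.reg 1 with
    | zero => rfl
    | succ m ihm => simp [State.rounds, ih h, ihm]

/-- The loop bound is constant during a run, so one polynomial in its initial value bounds the time
of nested loops. -/
theorem Cmd.WF.not_writes_one {p : Cmd} (h : p.WF) : ¬ p.Writes 1 := by
  induction p with
  | skip => simp [Cmd.Writes]
  | assign x e => exact fun h' => h h'.symm
  | store a i e => simp [Cmd.Writes]
  | seq p q ihp ihq => exact fun h' => h'.elim (ihp h.1) (ihq h.2)
  | branch e p q ihp ihq => exact fun h' => h'.elim (ihp h.1) (ihq h.2)
  | iter x p ih => exact fun h' => h'.elim (fun h' => h.1 h'.symm) (ih h.2.2)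

theorem State.rounds_reg {f : State → State} {x r : ℕ} (hr : r ≠ x)
    (hf : ∀ s, (f s).reg r = s.reg r) (s : State) (m : ℕ) :
    (State.rounds f x s m).reg r = s.reg r := by
  induction m with
  | zero => rfl
  | succ m ih => simp [State.rounds, hf, hr, ih]

/-- The compiled program reaches the final state of the command within the time bound. -/
theorem Cmd.runs_compile {p : Cmd} (h : p.WF) (s : State) :
    ∃ t, Runs p.compile s t (p.exec s) ∧ t ≤ p.cost.eval (s.reg 1) := by
  induction p generalizing s with
  | skip => exact ⟨1, .skip s, by simp [Cmd.cost]⟩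
  | assign x e => exact ⟨_, .assign x e s, by simp [Cmd.cost]⟩
  | store a i e => exact ⟨_, .store a i e s, by simp [Cmd.cost]⟩
  | seq p q ihp ihq =>
    obtain ⟨t, ht, ht'⟩ := ihp h.1 s
    obtain ⟨u, hu, hu'⟩ := ihq h.2 (p.exec s)
    rw [Cmd.exec_reg h.1.not_writes_one] at hu'
    exact ⟨_, .seq ht hu, by simp only [Cmd.cost, Polynomial.eval_add]; omega⟩
  | branch e p q ihp ihq =>
    simp only [Cmd.exec, Cmd.cost, Polynomial.eval_add, Polynomial.eval_C]
    split_ifs with he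
    · obtain ⟨t, ht, ht'⟩ := ihp h.1 s
      exact ⟨_, .branch_true he ht, by omega⟩
    · obtain ⟨t, ht, ht'⟩ := ihq h.2 s
      exact ⟨_, .branch_false (not_not.1 he) ht, by omega⟩
  | iter x p ih =>
    obtain ⟨hx, hpx, hp⟩ := h
    -- Induction on the number `d` of remaining rounds, since a run of a loop is built from its last
    -- test backwards. The 4 is the cost of that test.
    have key : ∀ d m, m + d = s.reg 1 → ∃ t,
        Runs (.loop (.sub (.reg 1) (.reg x)) (.seq p.compile
          (.assign x (.add (.reg x) (.const 1)))))
          ((State.rounds p.exec x s m).setReg x m) t (Cmd.exec (.iter x p) s) ∧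
          t ≤ 4 + d * (p.cost.eval (s.reg 1) + 8) := by
      intro d
      induction d with
      | zero =>
        intro m hm
        have h1 := State.rounds_reg (f := p.exec) (x := x) (r := 1) (Ne.symm hx)
          (Cmd.exec_reg hp.not_writes_one) s m
        refine ⟨4, ?_, by omega⟩
        rw [Cmd.exec, ← hm]
        exact .loop_false (by simp [Expr.eval, Ne.symm hx, h1, ← hm])
      | succ d ihd =>
        intro m hm
        have h1 := State.rounds_reg (f := p.exec) (x := x) (r := 1) (Ne.symm hx)
          (Cmd.exec_reg hp.not_writes_one) s m
        obtain ⟨t, ht, ht'⟩ := ih hp ((State.rounds p.exec x s m).setReg x m)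
        obtain ⟨u, hu, hu'⟩ := ihd (m + 1) (by omega)
        have hs : (State.rounds p.exec x s (m + 1)).setReg x (m + 1) =
            (p.exec ((State.rounds p.exec x s m).setReg x m)).setReg x
              ((Expr.add (.reg x) (.const 1)).eval
                (p.exec ((State.rounds p.exec x s m).setReg x m))) := by
          simp [State.rounds, Expr.eval, Cmd.exec_reg hpx]
        rw [hs] at hu
        refine ⟨_, .loop_true ?_ (.seq ht (.assign _ _ _)) hu, ?_⟩
        · simp [Expr.eval, Ne.symm hx, h1]; omega
        · simp only [State.setReg_reg, Ne.symm hx, if_false, h1] at ht'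
          simp only [Expr.steps]
          rw [add_mul]
          omega
    obtain ⟨t, ht, ht'⟩ := key (s.reg 1) 0 (by simp)
    refine ⟨_, .seq (.assign _ _ _) ht, ?_⟩
    simp only [Expr.steps, Cmd.cost, Polynomial.eval_add, Polynomial.eval_C, Polynomial.eval_mul,
      Polynomial.eval_X]
    omega

/-- The induction rule for loops. -/
theorem Cmd.iter_induction {x : ℕ} {p : Cmd} {s : State} (I : ℕ → State → Prop)
    (h0 : I 0 s) (hx : ∀ i m t, I i t → I i (t.setReg x m))
    (hp : ∀ i t, i < s.reg 1 → I i t → t.reg x = i → I (i + 1) (p.exec t)) :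
    I (s.reg 1) ((Cmd.iter x p).exec s) := by
  refine hx _ _ _ ?_
  have : ∀ m ≤ s.reg 1, I m (State.rounds p.exec x s m) := by
    intro m
    induction m with
    | zero => exact fun _ => h0
    | succ m ih => exact fun hm => hp m _ hm (hx _ _ _ (ih (by omega))) (by simp)
  exact this _ le_rfl

/-- The loop over the values of `x` below the value of `e`. -/
def Cmd.forBelow (x : ℕ) (e : Expr) (p : Cmd) : Cmd :=
  .iter x (.branch (.sub e (.reg x)) p .skip)

/-- The loop always makes `reg 1` rounds, and those from `N` on are idle. The invariant is therefore
carried with index `min i N`. -/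
theorem Cmd.forBelow_induction {x : ℕ} {e : Expr} {p : Cmd} {s : State} (N : ℕ)
    (I : ℕ → State → Prop) (hN : N ≤ s.reg 1) (h0 : I 0 s)
    (hx : ∀ i m t, I i t → I i (t.setReg x m)) (he : ∀ i t, I i t → e.eval t = N)
    (hp : ∀ i t, i < N → I i t → t.reg x = i → I (i + 1) (p.exec t)) :
    I N ((Cmd.forBelow x e p).exec s) := by
  have := Cmd.iter_induction (x := x) (p := .branch (.sub e (.reg x)) p .skip) (s := s)
    (fun i t => I (min i N) t) (by simpa using h0) (fun i m t h => hx _ _ _ h) (by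
      intro i t _ hI hi
      simp only [Cmd.exec, Expr.eval, he _ _ hI, hi]
      split_ifs with hlt
      · rw [min_eq_left (by omega)] at hI ⊢
        exact hp i t (by omega) hI hi
      · rw [min_eq_right (by omega)] at hI ⊢
        exact hI)
  rwa [min_eq_right hN] at this

/-! ## Truth values of expressions -/

/-- The expression has a nonzero value. -/
def Expr.Holds (s : State) (e : Expr) : Prop := e.eval s ≠ 0

/-- Truncated subtraction is the only means of testing: `1 - e` is nonzero exactly if `e` vanishes,
and `a = b` exactly if both differences vanish. -/
def Expr.neg (e : Expr) : Expr := .sub (.const 1) e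
def Expr.conj (a b : Expr) : Expr := .neg (.add (.neg a) (.neg b))
def Expr.disj (a b : Expr) : Expr := .add a b
def Expr.lt (a b : Expr) : Expr := .sub b a
def Expr.eq (a b : Expr) : Expr := .neg (.add (.sub a b) (.sub b a))
def Expr.all (es : List Expr) : Expr := es.foldr .conj (.const 1)
def Expr.any (es : List Expr) : Expr := es.foldr .disj (.const 0)

@[simp] theorem Expr.holds_neg {s : State} {e : Expr} : e.neg.Holds s ↔ ¬ e.Holds s := by
  simp only [Expr.Holds, Expr.neg, Expr.eval]; omega

@[simp] theorem Expr.holds_conj {s : State} {a b : Expr} :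
    (a.conj b).Holds s ↔ a.Holds s ∧ b.Holds s := by
  simp only [Expr.Holds, Expr.conj, Expr.neg, Expr.eval]; omega

@[simp] theorem Expr.holds_disj {s : State} {a b : Expr} :
    (a.disj b).Holds s ↔ a.Holds s ∨ b.Holds s := by
  simp only [Expr.Holds, Expr.disj, Expr.eval]; omega

@[simp] theorem Expr.holds_lt {s : State} {a b : Expr} :
    (a.lt b).Holds s ↔ a.eval s < b.eval s := by
  simp only [Expr.Holds, Expr.lt, Expr.eval]; omega

@[simp] theorem Expr.holds_eq {s : State} {a b : Expr} :
    (a.eq b).Holds s ↔ a.eval s = b.eval s := by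
  simp only [Expr.Holds, Expr.eq, Expr.neg, Expr.eval]; omega

@[simp] theorem Expr.holds_all {s : State} {es : List Expr} :
    (Expr.all es).Holds s ↔ ∀ e ∈ es, e.Holds s := by
  induction es with
  | nil => simp [Expr.all, Expr.Holds, Expr.eval]
  | cons e es ih =>
    simp only [Expr.all, List.foldr_cons, Expr.holds_conj, List.forall_mem_cons] at ih ⊢
    rw [ih]

@[simp] theorem Expr.holds_any {s : State} {es : List Expr} :
    (Expr.any es).Holds s ↔ ∃ e ∈ es, e.Holds s := by
  induction es with
  | nil => simp [Expr.any, Expr.Holds, Expr.eval]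
  | cons e es ih =>
    simp only [Expr.any, List.foldr_cons, Expr.holds_disj, List.exists_mem_cons_iff] at ih ⊢
    rw [ih]

/-! ## Tables indexed by tuples -/

/-- The index of a tuple: its entries are the digits in base `M`, where array `11 + j` tabulates
the multiples of `M ^ j`. -/
def Expr.codeFrom : ℕ → List Expr → Expr
  | _, [] => .const 0
  | j, e :: es => .add (.cell (11 + j) e) (Expr.codeFrom (j + 1) es)

def Expr.code (es : List Expr) : Expr := Expr.codeFrom 0 es

/-- The multiples of the first `D` powers of the loop bound are tabulated. -/
def State.Powers (s : State) (D : ℕ) : Prop :=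
  ∀ j < D, ∀ i < s.reg 1, s.arr (11 + j) i = i * s.reg 1 ^ j

theorem Expr.eval_codeFrom {s : State} {D : ℕ} (hs : s.Powers D) (es : List Expr) (j : ℕ)
    (hj : j + es.length ≤ D) (he : ∀ e ∈ es, e.eval s < s.reg 1) :
    (Expr.codeFrom j es).eval s =
      s.reg 1 ^ j * Nat.ofDigits (s.reg 1) (es.map (Expr.eval s)) := by
  induction es generalizing j with
  | nil => simp [Expr.codeFrom, Expr.eval]
  | cons e es ih =>
    simp only [List.length_cons] at hj
    rw [List.forall_mem_cons] at he
    rw [Expr.codeFrom, Expr.eval, Expr.eval, List.map_cons, Nat.ofDigits_cons,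
      ih (j + 1) (by omega) he.2, hs j (by omega) _ he.1]
    ring

theorem Expr.eval_code {s : State} {D : ℕ} (hs : s.Powers D) {es : List Expr}
    (hj : es.length ≤ D) (he : ∀ e ∈ es, e.eval s < s.reg 1) :
    (Expr.code es).eval s = Nat.ofDigits (s.reg 1) (es.map (Expr.eval s)) := by
  simp [Expr.code, Expr.eval_codeFrom hs es 0 (by omega) he]

/-- Table `T` contains the tuple `l` of length `D`. -/
def State.Tab (s : State) (T D : ℕ) (l : List ℕ) : Prop :=
  l.length = D ∧ (∀ x ∈ l, x < s.reg 1) ∧ s.arr T (Nat.ofDigits (s.reg 1) l) ≠ 0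

theorem Expr.holds_cell_code {s : State} {T D : ℕ} (hs : s.Powers D) {es : List Expr}
    (hD : es.length = D) (he : ∀ e ∈ es, e.eval s < s.reg 1) :
    (Expr.cell T (Expr.code es)).Holds s ↔ s.Tab T D (es.map (Expr.eval s)) := by
  simp only [Expr.Holds, Expr.eval, State.Tab, Expr.eval_code hs hD.le he]
  simpa [hD] using fun _ => he

/-- The states agree on the registers below `20` and on all arrays but `T`. -/
def State.Frame (T : ℕ) (s s' : State) : Prop :=
  (∀ r < 20, s'.reg r = s.reg r) ∧ ∀ b, b ≠ T → s'.arr b = s.arr b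

theorem State.Frame.refl (T : ℕ) (s : State) : s.Frame T s := ⟨fun _ _ => rfl, fun _ _ => rfl⟩

theorem State.Frame.trans {T : ℕ} {s s' s'' : State} (h : s.Frame T s') (h' : s'.Frame T s'') :
    s.Frame T s'' :=
  ⟨fun r hr => (h'.1 r hr).trans (h.1 r hr), fun b hb => (h'.2 b hb).trans (h.2 b hb)⟩

theorem State.Frame.setReg {T : ℕ} {s s' : State} (h : s.Frame T s') {r m : ℕ} (hr : 20 ≤ r) :
    s.Frame T (s'.setReg r m) :=
  ⟨fun r' hr' => by simp [show r' ≠ r by omega, h.1 r' hr'], h.2⟩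

theorem State.Frame.powers {T D : ℕ} {s s' : State} (h : s.Frame T s') (hT : T < 11)
    (hs : s.Powers D) : s'.Powers D := by
  intro j hj i hi
  rw [h.1 1 (by omega)] at hi ⊢
  rw [h.2 _ (by omega), hs j hj i hi]

theorem State.Frame.tab {T T' D : ℕ} {s s' : State} (h : s.Frame T s') (hT : T' ≠ T) :
    s'.Tab T' D = s.Tab T' D := by
  funext l
  simp [State.Tab, h.1 1 (by omega), h.2 _ hT]

/-- Registers from `20` on serve as variables of the nested loops. Those below include the loop
bound and the data of the instance, which every stage has to preserve. -/
theorem Cmd.frame {p : Cmd} {T : ℕ} (hr : ∀ r < 20, ¬ p.Writes r) (ha : ∀ a, p.Stores a → a = T)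
    (s : State) : s.Frame T (p.exec s) :=
  ⟨fun r h => Cmd.exec_reg (hr r h) s, fun b hb => Cmd.exec_arr (fun h => hb (ha b h)) s⟩

/-! ## Nested loops -/

/-- Loops over the registers `base, …, base + d - 1`. -/
def Cmd.forVars (base : ℕ) : ℕ → Cmd → Cmd
  | 0, p => p
  | d + 1, p => .iter (base + d) (Cmd.forVars base d p)

theorem Cmd.forVars_writes {base d : ℕ} {p : Cmd} {r : ℕ} :
    (Cmd.forVars base d p).Writes r ↔ (base ≤ r ∧ r < base + d) ∨ p.Writes r := by
  induction d with
  | zero => simp [Cmd.forVars]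
  | succ d ih =>
    simp only [Cmd.forVars, Cmd.Writes, ih]
    constructor
    · rintro (h | h | h)
      · exact .inl (by omega)
      · exact .inl (by omega)
      · exact .inr h
    · rintro (h | h)
      · by_cases h' : r = base + d
        · exact .inl h'
        · exact .inr (.inl (by omega))
      · exact .inr (.inr h)

theorem Cmd.forVars_stores {base d : ℕ} {p : Cmd} {a : ℕ} :
    (Cmd.forVars base d p).Stores a ↔ p.Stores a := by
  induction d with
  | zero => rfl
  | succ d ih => simp [Cmd.forVars, Cmd.Stores, ih]

theorem Cmd.forVars_wf {base d : ℕ} {p : Cmd} (hb : 1 < base) (hp : p.WF)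
    (hw : ∀ r, base ≤ r → r < base + d → ¬ p.Writes r) : (Cmd.forVars base d p).WF := by
  induction d with
  | zero => exact hp
  | succ d ih =>
    refine ⟨by omega, ?_, ih fun r h h' => hw r h (by omega)⟩
    rw [Cmd.forVars_writes]
    rintro (h | h)
    · omega
    · exact hw _ (by omega) (by omega) h

theorem Cmd.forVars_induction {base d M : ℕ} {p : Cmd} (I : State → Prop)
    (hM : ∀ t, I t → t.reg 1 = M)
    (hI : ∀ t r m, base ≤ r → r < base + d → I t → I (t.setReg r m))
    (hw : ∀ r, base ≤ r → r < base + d → ¬ p.Writes r)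
    (hp : ∀ t, I t → (∀ j < d, t.reg (base + j) < M) → I (p.exec t)) {s : State} (hs : I s) :
    I ((Cmd.forVars base d p).exec s) := by
  induction d generalizing I s with
  | zero => exact hp s hs (by simp)
  | succ d ih =>
    refine Cmd.iter_induction (fun _ => I) hs (fun i m t ht => hI _ _ _ (by omega) (by omega) ht) ?_
    intro i t hi ht hti
    rw [hM _ hs] at hi
    -- The inner loops do not touch the outer counter, so its bound can join their invariant.
    refine (ih (fun t => I t ∧ t.reg (base + d) < M) (fun t ht => hM t ht.1) ?_
      (fun r h h' => hw r h (by omega)) ?_ ⟨ht, by omega⟩).1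
    · intro t r m hr hr' ht
      exact ⟨hI _ _ _ hr (by omega) ht.1, by simpa [show base + d ≠ r by omega] using ht.2⟩
    · intro t ht hj
      refine ⟨hp t ht.1 fun j hj' => ?_, ?_⟩
      · rcases Nat.lt_succ_iff_lt_or_eq.1 hj' with h | rfl
        · exact hj j h
        · exact ht.2
      · rw [Cmd.exec_reg (hw _ (by omega) (by omega))]
        exact ht.2

/-- Every valuation of the loop variables is met by the body of the loops. -/
theorem Cmd.forVars_reach {base d : ℕ} {p : Cmd} (R : State → State → Prop)
    (hb : 1 < base) (hpw : ¬ p.Writes 1) (hw : ∀ r, base ≤ r → r < base + d → ¬ p.Writes r)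
    (refl : ∀ t, R t t) (trans : ∀ t t' t'', R t t' → R t' t'' → R t t'')
    (hR : ∀ t r m, base ≤ r → r < base + d → R t (t.setReg r m)) (hp : ∀ t, R t (p.exec t))
    (s : State) :
    R s ((Cmd.forVars base d p).exec s) ∧
    ∀ ρ : ℕ → ℕ, (∀ j < d, ρ j < s.reg 1) → ∃ t, R s t ∧ (∀ j < d, t.reg (base + j) = ρ j) ∧
      (∀ r, ¬ p.Writes r → (r < base ∨ base + d ≤ r) → t.reg r = s.reg r) ∧
      R (p.exec t) ((Cmd.forVars base d p).exec s) := by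
  induction d generalizing s with
  | zero => exact ⟨hp s, fun ρ _ => ⟨s, refl s, by simp, by simp, refl _⟩⟩
  | succ d ih =>
    specialize ih (fun r h h' => hw r h (by omega)) (fun t r m h h' => hR t r m h (by omega))
    set f := (Cmd.forVars base d p).exec with hf
    have hreg : ∀ r, ¬ p.Writes r → (r < base ∨ base + d ≤ r) → ∀ t, (f t).reg r = t.reg r := by
      intro r h h' t
      refine Cmd.exec_reg (fun h'' => ?_) t
      rw [Cmd.forVars_writes] at h''
      exact h''.elim (by omega) h
    have hstep : ∀ i, R (State.rounds f (base + d) s i) (State.rounds f (base + d) s (i + 1)) :=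
      fun i => trans _ _ _ (hR _ _ _ (by omega) (by omega)) (ih _).1
    have hle : ∀ i e, R (State.rounds f (base + d) s i) (State.rounds f (base + d) s (i + e)) := by
      intro i e
      induction e with
      | zero => exact refl _
      | succ e ihe => exact trans _ _ _ ihe (hstep _)
    have hend : R (State.rounds f (base + d) s (s.reg 1))
        ((Cmd.forVars base (d + 1) p).exec s) := hR _ _ _ (by omega) (by omega)
    refine ⟨trans _ _ _ ?_ hend, fun ρ hρ => ?_⟩
    · simpa [State.rounds] using hle 0 (s.reg 1)
    have hρd := hρ d (by omega)
    have hr : ∀ i r, ¬ p.Writes r → (r < base ∨ base + (d + 1) ≤ r) →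
        (State.rounds f (base + d) s i).reg r = s.reg r := by
      intro i r h h'
      exact State.rounds_reg (by omega) (hreg r h (by omega)) s i
    -- The valuation is met in round `ρ d` of the outermost loop. The relation `R` is then carried
    -- through the remaining rounds.
    obtain ⟨t, h1, h2, h3, h4⟩ := (ih ((State.rounds f (base + d) s (ρ d)).setReg (base + d) (ρ d))).2
      ρ (fun j hj => by
        rw [State.setReg_reg, if_neg (by omega), hr _ 1 hpw (by omega)]
        exact hρ j (by omega))
    refine ⟨t, ?_, ?_, ?_, ?_⟩
    · refine trans _ _ _ (trans _ _ _ ?_ (hR _ _ _ (by omega) (by omega))) h1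
      simpa [State.rounds] using hle 0 (ρ d)
    · intro j hj
      rcases Nat.lt_succ_iff_lt_or_eq.1 hj with h | rfl
      · exact h2 j h
      · rw [h3 _ (hw _ (by omega) (by omega)) (by omega)]
        simp
    · intro r h h'
      rw [h3 r h (by omega), State.setReg_reg, if_neg (by omega), hr _ r h h']
    · refine trans _ _ _ h4 (trans _ _ _ ?_ hend)
      have := hle (ρ d + 1) (s.reg 1 - (ρ d + 1))
      rwa [show ρ d + 1 + (s.reg 1 - (ρ d + 1)) = s.reg 1 by omega] at this

/-- The counting argument for fixed-point iteration. Once `Q` (the table is closed) holds it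
persists, and every execution of the body before that raises `c` (the size of the table). So `M ^ d`
executions reach `Q` or raise `c` by `M ^ d`. -/
theorem Cmd.forVars_progress {base d M : ℕ} {p : Cmd} (I Q : State → Prop) (c : State → ℕ)
    (hM : ∀ t, I t → t.reg 1 = M)
    (hI : ∀ t r m, base ≤ r → r < base + d → I t → I (t.setReg r m))
    (hQ : ∀ t r m, base ≤ r → r < base + d → Q t → Q (t.setReg r m))
    (hc : ∀ t r m, base ≤ r → r < base + d → c (t.setReg r m) = c t)
    (hpI : ∀ t, I t → I (p.exec t)) (hpQ : ∀ t, I t → Q t → Q (p.exec t))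
    (hpc : ∀ t, I t → Q (p.exec t) ∨ c t + 1 ≤ c (p.exec t)) {s : State} (hs : I s) :
    I ((Cmd.forVars base d p).exec s) ∧ (Q s → Q ((Cmd.forVars base d p).exec s)) ∧
      (Q ((Cmd.forVars base d p).exec s) ∨ c s + M ^ d ≤ c ((Cmd.forVars base d p).exec s)) := by
  induction d generalizing s with
  | zero => exact ⟨hpI s hs, hpQ s hs, by rw [pow_zero]; exact hpc s hs⟩
  | succ d ih =>
    specialize @ih (fun t r m h h' => hI t r m h (by omega)) (fun t r m h h' => hQ t r m h (by omega))
      (fun t r m h h' => hc t r m h (by omega))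
    have hsM := hM s hs
    have := Cmd.iter_induction (x := base + d) (p := Cmd.forVars base d p) (s := s)
      (fun i t => I t ∧ (Q s → Q t) ∧ (Q t ∨ c s + i * M ^ d ≤ c t))
      ⟨hs, id, .inr (by simp)⟩
      (by
        rintro i m t ⟨h1, h2, h3⟩
        refine ⟨hI _ _ _ (by omega) (by omega) h1,
          fun h => hQ _ _ _ (by omega) (by omega) (h2 h), ?_⟩
        rw [hc _ _ _ (by omega) (by omega)]
        exact h3.imp (hQ _ _ _ (by omega) (by omega)) id)
      (by
        rintro i t _ ⟨h1, h2, h3⟩ -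
        obtain ⟨h1', h2', h3'⟩ := ih h1
        refine ⟨h1', fun h => h2' (h2 h), ?_⟩
        rcases h3 with h3 | h3
        · exact .inl (h2' h3)
        · refine h3'.imp id fun h => ?_
          rw [add_mul]
          omega)
    obtain ⟨h1, h2, h3⟩ := this
    refine ⟨h1, h2, h3.imp id fun h => ?_⟩
    rw [hsM] at h
    rw [pow_succ']
    exact h

/-! ## Saturation -/

/-- The first `d` variables. -/
def vars (d : ℕ) : List Expr := (List.range d).map fun j => .reg (20 + j)

theorem map_eval_vars (s : State) (d : ℕ) :
    (vars d).map (Expr.eval s) = (List.range d).map fun j => s.reg (20 + j) := by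
  simp [vars, Expr.eval]

/-- One round of saturation: tuples of the first `D` of `m` variables are added to table `T` if the
condition holds. -/
def Cmd.saturateRound (T D m : ℕ) (cond : Expr) : Cmd :=
  .forVars 20 m (.branch cond (.store T (Expr.code (vars D)) (.const 1)) .skip)

/-- Computes the least table closed under the rule given by the condition. -/
def Cmd.saturate (T D m : ℕ) (cond : Expr) : Cmd :=
  -- The table is cleared because the stage is rerun for every tentative choice of an agent.
  .seq (.forVars 20 m (.store T (Expr.code (vars D)) (.const 0)))
    -- These `D` counters are never read. They repeat the round `M ^ D` times, once for each
    -- possible tuple, which is enough for the table to become stable.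
    (.forVars (20 + m) D (.saturateRound T D m cond))

theorem Cmd.saturateRound_writes {T D m : ℕ} {cond : Expr} {r : ℕ} :
    (Cmd.saturateRound T D m cond).Writes r ↔ 20 ≤ r ∧ r < 20 + m := by
  simp [Cmd.saturateRound, Cmd.forVars_writes, Cmd.Writes]

theorem Cmd.saturate_writes {T D m : ℕ} {cond : Expr} {r : ℕ}
    (h : (Cmd.saturate T D m cond).Writes r) : 20 ≤ r := by
  simp only [Cmd.saturate, Cmd.Writes, Cmd.forVars_writes, Cmd.saturateRound_writes, or_false] at h
  omega

theorem Cmd.saturate_wf {T D m : ℕ} {cond : Expr} : (Cmd.saturate T D m cond).WF := by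
  refine ⟨Cmd.forVars_wf (by omega) trivial (by simp [Cmd.Writes]),
    Cmd.forVars_wf (by omega) (Cmd.forVars_wf (by omega) ⟨trivial, trivial⟩ (by simp [Cmd.Writes]))
      ?_⟩
  intro r h h'
  rw [Cmd.saturateRound_writes]
  omega

theorem Cmd.saturate_stores {T D m : ℕ} {cond : Expr} {a : ℕ}
    (h : (Cmd.saturate T D m cond).Stores a) : a = T := by
  simpa [Cmd.saturate, Cmd.saturateRound, Cmd.Stores, Cmd.forVars_stores] using h

theorem Cmd.saturate_frame {T D m : ℕ} {cond : Expr} (s : State) :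
    s.Frame T ((Cmd.saturate T D m cond).exec s) :=
  Cmd.frame (fun _ hr h => by have := Cmd.saturate_writes h; omega)
    (fun _ => Cmd.saturate_stores) s

theorem State.tab_setReg {s : State} {T D r m : ℕ} (hr : 20 ≤ r) :
    (s.setReg r m).Tab T D = s.Tab T D := by
  funext l
  simp [State.Tab, show 1 ≠ r by omega]

section

variable {T D m : ℕ} {s : State}

theorem vars_valid (hDm : D ≤ m) (hρ : ∀ j < m, s.reg (20 + j) < s.reg 1) :
    ∀ e ∈ vars D, e.eval s < s.reg 1 := by
  simp only [vars, List.mem_map, List.mem_range, forall_exists_index, and_imp]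
  rintro _ j hj rfl
  exact hρ j (by omega)

theorem eval_code_vars (hs : s.Powers D) (hDm : D ≤ m) (hρ : ∀ j < m, s.reg (20 + j) < s.reg 1) :
    (Expr.code (vars D)).eval s =
      Nat.ofDigits (s.reg 1) ((List.range D).map fun j => s.reg (20 + j)) := by
  rw [Expr.eval_code hs (by simp [vars]) (vars_valid hDm hρ), map_eval_vars]

/-- Tuples of equal length with digits below the base have different codes, so writing one cell
affects one tuple only. -/
theorem tab_setCell (hM : 1 < s.reg 1) {l₀ : List ℕ} (hl₀ : l₀.length = D)
    (hl₀' : ∀ x ∈ l₀, x < s.reg 1) {c : ℕ} {l : List ℕ} :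
    (s.setCell T (Nat.ofDigits (s.reg 1) l₀) c).Tab T D l ↔
      if l = l₀ then c ≠ 0 else s.Tab T D l := by
  simp only [State.Tab, State.setCell_reg, State.setCell_arr]
  by_cases h : l = l₀
  · subst h
    simpa [hl₀] using fun _ => hl₀'
  · rw [if_neg h]
    refine and_congr_right fun h1 => and_congr_right fun h2 => ?_
    rw [if_neg]
    rintro ⟨-, h3⟩
    exact h (Nat.ofDigits_inj_of_len_eq hM (by omega) h2 hl₀' h3)

end

/-- Saturation computes the least table that is closed under the rule: it is closed, and it is
contained in every set of tuples that is closed. -/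
theorem Cmd.saturate_spec {T D m : ℕ} {cond : Expr} {s₀ : State} (hM : 1 < s₀.reg 1) (hT : T < 11)
    (hDm : D ≤ m) (hs₀ : s₀.Powers D) (φ : (List ℕ → Prop) → (ℕ → ℕ) → Prop)
    (hφ : ∀ s ρ, s₀.Frame T s → (∀ j < m, s.reg (20 + j) = ρ j) → (∀ j < m, ρ j < s₀.reg 1) →
      (cond.Holds s ↔ φ (s.Tab T D) ρ)) :
    (∀ ρ : ℕ → ℕ, (∀ j < m, ρ j < s₀.reg 1) →
      φ (((Cmd.saturate T D m cond).exec s₀).Tab T D) ρ →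
      ((Cmd.saturate T D m cond).exec s₀).Tab T D ((List.range D).map ρ)) ∧
    ∀ S : List ℕ → Prop, (∀ A (ρ : ℕ → ℕ), (∀ l, A l → S l) → (∀ j < m, ρ j < s₀.reg 1) → φ A ρ →
        S ((List.range D).map ρ)) →
      ∀ l, ((Cmd.saturate T D m cond).exec s₀).Tab T D l → S l := by
  set M := s₀.reg 1 with hMdef
  set body : Cmd := .branch cond (.store T (Expr.code (vars D)) (.const 1)) .skip with hbody
  have hbw : ∀ r, ¬ body.Writes r := by simp [hbody, Cmd.Writes]
  -- the effect of the body
  have hstep : ∀ t ρ, s₀.Frame T t → (∀ j < m, t.reg (20 + j) = ρ j) → (∀ j < m, ρ j < M) →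
      ∀ l, (body.exec t).Tab T D l ↔
        t.Tab T D l ∨ φ (t.Tab T D) ρ ∧ l = (List.range D).map ρ := by
    intro t ρ ht htρ hρ l
    have htM : t.reg 1 = M := ht.1 1 (by omega)
    have hlist : ((List.range D).map fun j => t.reg (20 + j)) = (List.range D).map ρ :=
      List.map_congr_left fun j hj => htρ j (by have := List.mem_range.1 hj; omega)
    have hcond := hφ t ρ ht htρ hρ
    simp only [hbody, Cmd.exec]
    split_ifs with h
    · rw [eval_code_vars (ht.powers hT hs₀) hDm (fun j hj => by rw [htρ j hj, htM]; exact hρ j hj),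
        hlist, tab_setCell (by omega) (by simp)]
      · simp only [hcond.1 h, true_and]
        split_ifs with hl
        · simp [hl, Expr.eval]
        · simp [hl]
      · simp only [List.mem_map, List.mem_range, forall_exists_index, and_imp]
        rintro _ j hj rfl
        rw [htM]
        exact hρ j (by omega)
    · have : ¬ φ (t.Tab T D) ρ := fun h' => h (hcond.2 h')
      simp [this]
  -- the table grows
  let R : State → State → Prop := fun t t' => t.Frame T t' ∧ ∀ i, t.arr T i ≠ 0 → t'.arr T i ≠ 0
  have hRtab : ∀ t t', R t t' → ∀ l, t.Tab T D l → t'.Tab T D l := by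
    rintro t t' ⟨h1, h2⟩ l ⟨h3, h4, h5⟩
    have := h1.1 1 (by omega)
    exact ⟨h3, by rwa [this], by rw [this]; exact h2 _ h5⟩
  have hreach := fun s => Cmd.forVars_reach (base := 20) (d := m) (p := body) R (by omega) (hbw 1)
    (fun r _ _ => hbw r) (fun t => ⟨.refl _ _, fun _ => id⟩)
    (fun t t' t'' h h' => ⟨h.1.trans h'.1, fun i hi => h'.2 i (h.2 i hi)⟩)
    (fun t r m h _ => ⟨(State.Frame.refl _ _).setReg h, fun _ => id⟩)
    (fun t => by
      refine ⟨Cmd.frame (fun r _ => hbw r) (by simp [hbody, Cmd.Stores]) t, fun i hi => ?_⟩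
      simp only [hbody, Cmd.exec]
      split_ifs
      · rw [State.setCell_arr]
        split_ifs <;> simp [Expr.eval, hi]
      · exact hi) s
  have hround : ∀ s, s₀.Frame T s → s₀.Frame T ((Cmd.saturateRound T D m cond).exec s) :=
    fun s hs => hs.trans (hreach s).1.1
  -- `Q` says that the table is closed under the rule, and `c` below counts the nonzero cells among
  -- the `M ^ D` codes.
  let Q : State → Prop := fun t => ∀ ρ : ℕ → ℕ, (∀ j < m, ρ j < M) → φ (t.Tab T D) ρ →
    t.Tab T D ((List.range D).map ρ)
  let c : State → ℕ := fun t => ((Finset.range (M ^ D)).filter fun i => t.arr T i ≠ 0).card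
  have hlt : ∀ l : List ℕ, l.length = D → (∀ x ∈ l, x < M) → Nat.ofDigits M l < M ^ D := by
    intro l hl hl'
    rw [← hl]
    exact Nat.ofDigits_lt_base_pow_length hM hl'
  -- a closed table does not change any more
  have hQround : ∀ t, s₀.Frame T t → Q t → Q ((Cmd.saturateRound T D m cond).exec t) := by
    intro t ht hQ
    have := Cmd.forVars_induction (base := 20) (d := m) (M := M) (p := body)
      (fun t' => s₀.Frame T t' ∧ t'.Tab T D = t.Tab T D)
      (fun t' h => h.1.1 1 (by omega))
      (fun t' r _ h _ h' => ⟨h'.1.setReg h, by rw [State.tab_setReg h, h'.2]⟩)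
      (fun r _ _ => hbw r)
      (by
        intro t' ht' hj
        refine ⟨ht'.1.trans (Cmd.frame (fun r _ => hbw r) (by simp [hbody, Cmd.Stores]) t'), ?_⟩
        funext l
        rw [hstep t' _ ht'.1 (fun j _ => rfl) hj, ht'.2]
        refine propext ⟨?_, .inl⟩
        rintro (h | ⟨h, rfl⟩)
        · exact h
        · exact hQ _ hj h)
      (s := t) ⟨ht, rfl⟩
    simp only [Q]
    rw [show (Cmd.saturateRound T D m cond).exec t = (Cmd.forVars 20 m body).exec t from rfl, this.2]
    exact hQ
  -- a round closes the table or adds a tuple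
  have hprog : ∀ t, s₀.Frame T t → Q ((Cmd.saturateRound T D m cond).exec t) ∨
      c t + 1 ≤ c ((Cmd.saturateRound T D m cond).exec t) := by
    intro t ht
    set t' := (Cmd.saturateRound T D m cond).exec t with ht'
    have hR : R t t' := (hreach t).1
    -- If the round added nothing, the table was the same throughout. Every valuation was then met
    -- with the final table, and the rule was applied to it; no monotonicity of `φ` is needed.
    by_cases h : ∀ i < M ^ D, t'.arr T i ≠ 0 → t.arr T i ≠ 0
    · left
      intro ρ hρ hφρ
      obtain ⟨u, h1, h2, -, h4⟩ := (hreach t).2 ρ (by rw [ht.1 1 (by omega)]; exact hρ)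
      have hu := ht.trans h1.1
      have htM' : t'.reg 1 = M := (ht.trans hR.1).1 1 (by omega)
      have htt : ∀ l, t'.Tab T D l → t.Tab T D l := by
        rintro l ⟨hl1, hl2, hl3⟩
        have htM : t.reg 1 = M := ht.1 1 (by omega)
        rw [htM'] at hl2 hl3
        exact ⟨hl1, by rwa [htM], by rw [htM]; exact h _ (hlt l hl1 hl2) hl3⟩
      have hu' : ∀ l, t'.Tab T D l → u.Tab T D l := fun l hl => hRtab _ _ h1 _ (htt l hl)
      have hu2 : ∀ l, (body.exec u).Tab T D l → t'.Tab T D l := hRtab _ _ h4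
      have heq : t'.Tab T D = u.Tab T D := funext fun l => propext ⟨hu' l, fun hl =>
        hu2 l ((hstep u ρ hu h2 hρ l).2 (.inl hl))⟩
      rw [heq] at hφρ
      exact hu2 _ ((hstep u ρ hu h2 hρ _).2 (.inr ⟨hφρ, rfl⟩))
    · right
      push Not at h
      obtain ⟨i, hi, hi1, hi2⟩ := h
      refine Finset.card_lt_card ⟨fun j hj => ?_, fun hsub => ?_⟩
      · simp only [Finset.mem_filter] at hj ⊢
        exact ⟨hj.1, hR.2 j hj.2⟩
      · have := hsub (Finset.mem_filter.2 ⟨Finset.mem_range.2 hi, hi1⟩)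
        simp only [Finset.mem_filter] at this
        exact this.2 hi2
  set p₁ : Cmd := .forVars 20 m (.store T (Expr.code (vars D)) (.const 0)) with hp₁
  set s₁ := p₁.exec s₀ with hs₁
  have hfr₁ : s₀.Frame T s₁ := Cmd.frame
    (fun r hr => by simp only [hp₁, Cmd.forVars_writes, Cmd.Writes, or_false]; omega)
    (fun a ha => by simpa [hp₁, Cmd.forVars_stores, Cmd.Stores] using ha) s₀
  have hend : (Cmd.saturate T D m cond).exec s₀ =
    (Cmd.forVars (20 + m) D (.saturateRound T D m cond)).exec s₁ := rfl
  rw [hend]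
  constructor
  · have := Cmd.forVars_progress (base := 20 + m) (d := D) (M := M)
      (p := Cmd.saturateRound T D m cond) (s₀.Frame T) Q c (fun t h => h.1 1 (by omega))
      (fun t r _ h _ h' => h'.setReg (by omega))
      (fun t r _ h _ h' => by simp only [Q]; rwa [State.tab_setReg (by omega)])
      (fun t r _ h _ => rfl) hround hQround hprog (s := s₁) hfr₁
    obtain ⟨h1, -, h3⟩ := this
    rcases h3 with h3 | h3
    · exact h3
    -- In the other case the table has `M ^ D` nonzero cells, so it contains every tuple and is
    -- closed trivially.
    intro ρ hρ _
    set t := (Cmd.forVars (20 + m) D (.saturateRound T D m cond)).exec s₁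
    have hfull : (Finset.range (M ^ D)).filter (fun i => t.arr T i ≠ 0) = Finset.range (M ^ D) := by
      refine Finset.eq_of_subset_of_card_le (Finset.filter_subset _ _) ?_
      rw [Finset.card_range]
      exact le_trans (Nat.le_add_left _ _) h3
    have hval : ∀ x ∈ (List.range D).map ρ, x < M := by
      simp only [List.mem_map, List.mem_range, forall_exists_index, and_imp]
      rintro _ j hj rfl
      exact hρ j (by omega)
    have htM : t.reg 1 = M := h1.1 1 (by omega)
    refine ⟨by simp, by rwa [htM], ?_⟩
    rw [htM]
    have := hlt ((List.range D).map ρ) (by simp) hval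
    rw [← Finset.mem_range, ← hfull, Finset.mem_filter] at this
    exact this.2
  · intro S hS
    -- The clearing loops meet every valid tuple, and a cell that has become zero stays zero until
    -- they end.
    have hempty : ∀ l, ¬ s₁.Tab T D l := by
      let R' : State → State → Prop :=
        fun t t' => t.Frame T t' ∧ ∀ i, t.arr T i = 0 → t'.arr T i = 0
      have := (Cmd.forVars_reach (base := 20) (d := m)
        (p := .store T (Expr.code (vars D)) (.const 0)) R' (by omega) id (fun _ _ _ => id)
        (fun t => ⟨.refl _ _, fun _ => id⟩)
        (fun t t' t'' h h' => ⟨h.1.trans h'.1, fun i hi => h'.2 i (h.2 i hi)⟩)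
        (fun t r m h _ => ⟨(State.Frame.refl _ _).setReg h, fun _ => id⟩)
        (fun t => by
          refine ⟨Cmd.frame
            (p := .store T (Expr.code (vars D)) (.const 0)) (fun r _ => id) (fun a ha => ha) t, fun i hi => ?_⟩
          simp only [Cmd.exec]
          rw [State.setCell_arr]
          split_ifs <;> simp [Expr.eval, hi]) s₀).2
      rintro l ⟨h1, h2, h3⟩
      rw [hfr₁.1 1 (by omega)] at h2 h3
      obtain ⟨t, ht1, ht2, -, ht4⟩ := this (fun j => l.getD j 0) (fun j _ => by
        by_cases hj : j < l.length
        · rw [List.getD_eq_getElem _ _ hj]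
          exact h2 _ (List.getElem_mem hj)
        · rw [List.getD_eq_default _ _ (not_lt.1 hj)]
          omega)
      refine h3 (ht4.2 _ ?_)
      have htM : t.reg 1 = M := ht1.1.1 1 (by omega)
      have hlist : ((List.range D).map fun j => t.reg (20 + j)) = l := by
        refine List.ext_getElem (by simp [h1]) fun i hi hi' => ?_
        simp only [List.getElem_map, List.getElem_range]
        rw [ht2 i (by omega), List.getD_eq_getElem _ _ hi']
      simp only [Cmd.exec]
      rw [eval_code_vars (m := D) (ht1.1.powers hT hs₀) le_rfl, hlist, State.setCell_arr, htM]
      · simp [Expr.eval, hMdef]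
      · intro j hj
        rw [ht2 j (by omega), List.getD_eq_getElem _ _ (by omega), htM]
        exact h2 _ (List.getElem_mem _)
    have := Cmd.forVars_induction (base := 20 + m) (d := D) (M := M)
      (p := Cmd.saturateRound T D m cond)
      (fun t' => s₀.Frame T t' ∧ ∀ l, t'.Tab T D l → S l)
      (fun t' h => h.1.1 1 (by omega))
      (fun t' r _ h _ h' => ⟨h'.1.setReg (by omega), by
        rw [State.tab_setReg (by omega)]; exact h'.2⟩)
      (fun r h h' => by rw [Cmd.saturateRound_writes]; omega)
      (by
        intro t ht _
        exact Cmd.forVars_induction (base := 20) (d := m) (M := M) (p := body)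
          (fun t' => s₀.Frame T t' ∧ ∀ l, t'.Tab T D l → S l)
          (fun t' h => h.1.1 1 (by omega))
          (fun t' r _ h _ h' => ⟨h'.1.setReg h, by rw [State.tab_setReg h]; exact h'.2⟩)
          (fun r _ _ => hbw r)
          (by
            intro t' ht' hj
            refine ⟨ht'.1.trans (Cmd.frame (fun r _ => hbw r) (by simp [hbody, Cmd.Stores]) t'), ?_⟩
            intro l
            rw [hstep t' _ ht'.1 (fun j _ => rfl) hj]
            rintro (h | ⟨h, rfl⟩)
            · exact ht'.2 l h
            · exact hS _ _ ht'.2 hj h)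
          ht)
      (s := s₁) ⟨hfr₁, fun l hl => absurd hl (hempty l)⟩
    exact this.2

/-! ## The derivation rules of the dynamic program

A fact `T X r Y col j vec` says that the part of the zone `Zone X r` that is separated by the bag
`Y` and has been processed up to the vertex `j` has a colouring compatible with the colours `col` of
the bag, with total weights `vec`. -/

/-- What the dynamic program works on: a graph on `{0, …, n - 1}`, `k` colours, and `K` weights of
coloured vertices; `ok v c` says that `v` may have colour `c`. -/
structure Net where
  n : ℕ
  adj : ℕ → ℕ → Prop
  k : ℕ
  K : ℕ
  wt : ℕ → ℕ → ℕ → ℕ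
  ok : ℕ → ℕ → Prop
  symm : ∀ u v, adj u v → adj v u
  lt : ∀ u v, adj u v → u < n

namespace Net

variable (N : Net)

/-- The vertices are equal or connected outside `X`. -/
def Link (X : List ℕ) : ℕ → ℕ → Prop :=
  Relation.ReflTransGen fun u v => u ∉ X ∧ v ∉ X ∧ N.adj u v

/-- The component of `r` outside `X`, or everything if `r` is not a vertex. -/
def Zone (X : List ℕ) (r v : ℕ) : Prop := N.n ≤ r ∨ N.Link X r v

/-- An earlier vertex is in the same component outside `Y`. -/
def Old (Y : List ℕ) (j : ℕ) : Prop := ∃ u < j, N.Link Y u j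

/-- The bag `Y` contains all neighbours of the zone. -/
def Sep (X : List ℕ) (r : ℕ) (Y : List ℕ) : Prop :=
  ∀ u z, N.Zone X r u → N.adj u z → ¬ N.Zone X r z → z ∈ Y

/-- The colours of the bag are consistent and permitted. -/
def ColOK (Y col : List ℕ) : Prop :=
  (∀ p ∈ Y.zip col, p.2 < N.k ∧ (p.1 < N.n → N.ok p.1 p.2)) ∧
  ∀ p ∈ Y.zip col, ∀ q ∈ Y.zip col,
    (p.1 = q.1 → p.1 < N.n → p.2 = q.2) ∧ (N.adj p.1 q.1 → p.2 ≠ q.2)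

/-- The colours of the two bags agree on common vertices. -/
def Compat (Y col Z col' : List ℕ) : Prop :=
  ∀ p ∈ Y.zip col, ∀ q ∈ Z.zip col', p.1 = q.1 → p.1 < N.n → p.2 = q.2

/-- Tables of the dynamic program. -/
abbrev Table := List ℕ → ℕ → List ℕ → List ℕ → ℕ → List ℕ → Prop

/-- Processing vertex `j` turns the weights `v₁` into `vec`. -/
def Step (T : Table) (X : List ℕ) (r : ℕ) (Y col : List ℕ) (j : ℕ) (v₁ vec : List ℕ) : Prop :=
  -- Nothing is added for a vertex outside the zone, or in a component that was handled at its least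
  -- vertex. A vertex of `Y` is linked only to itself and so is never `Old`.
  ((¬ N.Zone X r j ∨ N.Old Y j) ∧ ∀ i < N.K, vec.getD i 0 = v₁.getD i 0) ∨
  (N.Zone X r j ∧ ∃ p ∈ Y.zip col, p.1 = j ∧
    ∀ i < N.K, vec.getD i 0 = v₁.getD i 0 + N.wt i j p.2) ∨
  -- Here `j` is the least vertex of a component outside `Y`, which is the zone `Zone Y j` of a
  -- subproblem with a bag `Z` of its own.
  (N.Zone X r j ∧ j ∉ Y ∧ ¬ N.Old Y j ∧ ∃ Z col' v₂, T Y j Z col' N.n v₂ ∧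
    N.Compat Y col Z col' ∧ ∀ i < N.K, vec.getD i 0 = v₁.getD i 0 + v₂.getD i 0)

/-- The derivation rules. -/
def Rule (T : Table) (X : List ℕ) (r : ℕ) (Y col : List ℕ) (j : ℕ) (vec : List ℕ) : Prop :=
  (j = 0 ∧ (∀ i < N.K, vec.getD i 0 = 0) ∧ N.Sep X r Y ∧ N.ColOK Y col) ∨
  ∃ j' v₁, j = j' + 1 ∧ j' < N.n ∧ T X r Y col j' v₁ ∧ N.Step T X r Y col j' v₁ vec

open Classical in
/-- The processed part of the zone. -/
noncomputable def done (X : List ℕ) (r : ℕ) (Y : List ℕ) (j : ℕ) : Finset ℕ :=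
  (Finset.range N.n).filter fun v => N.Zone X r v ∧ ∃ u < j, N.Link Y u v

/-- The meaning of facts. -/
def Sem (X : List ℕ) (r : ℕ) (Y col : List ℕ) (j : ℕ) (vec : List ℕ) : Prop :=
  Y.length = col.length ∧ N.Sep X r Y ∧ N.ColOK Y col ∧ ∃ a : ℕ → ℕ,
    (∀ p ∈ Y.zip col, p.1 < N.n → a p.1 = p.2) ∧
    (∀ v ∈ N.done X r Y j, a v < N.k ∧ N.ok v (a v)) ∧
    (∀ u v, u ∈ N.done X r Y j ∨ u ∈ Y → v ∈ N.done X r Y j ∨ v ∈ Y → N.adj u v → a u ≠ a v) ∧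
    ∀ i < N.K, vec.getD i 0 = ∑ v ∈ N.done X r Y j, N.wt i v (a v)

variable {N} {X Y Z col col' vec v₁ : List ℕ} {r j u v : ℕ} {T : Table}

/-! ### Components outside a bag, and the processed part of a zone -/

theorem Link.symm (h : N.Link X u v) : N.Link X v u := by
  induction h with
  | refl => exact .refl
  | tail _ h ih => exact .head ⟨h.2.1, h.1, N.symm _ _ h.2.2⟩ ih

/-- No step of a link enters `X`, so a vertex of `X` is linked only to itself. -/
theorem Link.eq_of_mem (h : N.Link X u v) (hv : v ∈ X) : u = v := by
  rcases Relation.ReflTransGen.cases_tail h with h | ⟨w, -, hw⟩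
  · exact h.symm
  · exact absurd hv hw.2.1

theorem Link.lt (h : N.Link X u v) (hu : u < N.n) : v < N.n := by
  rcases Relation.ReflTransGen.cases_tail h with h | ⟨w, -, hw⟩
  · exact h ▸ hu
  · exact N.lt _ _ (N.symm _ _ hw.2.2)

theorem Link.not_mem (h : N.Link X u v) (hu : u ∉ X) : v ∉ X := fun hv => hu (h.eq_of_mem hv ▸ hv)

/-- An edge that leaves the zone ends in `Y`, which links outside `Y` avoid. So each component
outside `Y` lies inside the zone or is disjoint from it. -/
theorem Zone.of_link (hs : N.Sep X r Y) (hu : N.Zone X r u) (h : N.Link Y u v) : N.Zone X r v := by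
  induction h with
  | refl => exact hu
  | tail _ h ih =>
    by_contra hz
    exact h.2.1 (hs _ _ ih h.2.2 hz)

theorem mem_done : v ∈ N.done X r Y j ↔ v < N.n ∧ N.Zone X r v ∧ ∃ u < j, N.Link Y u v := by
  simp [done]

theorem done_zero : N.done X r Y 0 = ∅ := by
  ext v
  simp [mem_done]

theorem mem_done_top : v ∈ N.done X r Y N.n ↔ v < N.n ∧ N.Zone X r v := by
  rw [mem_done]
  exact and_congr_right fun h => and_iff_left ⟨v, h, .refl⟩

theorem mem_done_succ :
    v ∈ N.done X r Y (j + 1) ↔ v ∈ N.done X r Y j ∨ v < N.n ∧ N.Zone X r v ∧ N.Link Y j v := by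
  simp only [mem_done, Nat.lt_succ_iff_lt_or_eq, or_and_right, exists_or, exists_eq_left, and_or_left]

theorem done_succ_of_skip (hs : N.Sep X r Y) (h : ¬ N.Zone X r j ∨ N.Old Y j) :
    N.done X r Y (j + 1) = N.done X r Y j := by
  ext v
  rw [mem_done_succ, or_iff_left_of_imp]
  rintro ⟨hv, hz, hl⟩
  rcases h with h | ⟨u, hu, hul⟩
  · exact absurd (Zone.of_link hs hz hl.symm) h
  · exact mem_done.2 ⟨hv, hz, u, hu, hul.trans hl⟩

theorem done_succ_of_mem (hj : j < N.n) (hz : N.Zone X r j) (hY : j ∈ Y) :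
    N.done X r Y (j + 1) = insert j (N.done X r Y j) ∧ j ∉ N.done X r Y j := by
  constructor
  · ext v
    rw [mem_done_succ, Finset.mem_insert, or_comm]
    refine or_congr_left ⟨fun h => h.2.2.symm.eq_of_mem hY, ?_⟩
    rintro rfl
    exact ⟨hj, hz, .refl⟩
  · rw [mem_done]
    rintro ⟨-, -, u, hu, h⟩
    exact hu.ne (h.eq_of_mem hY)

/-- The component of `j` outside `Y` lies in the zone, and none of it is processed because `j` is
not `Old`. The bag `Z` is arbitrary, as a zone processed up to `N.n` is the whole zone. -/
theorem done_succ_of_sub (hs : N.Sep X r Y) (hj : j < N.n) (hz : N.Zone X r j)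
    (ho : ¬ N.Old Y j) (Z : List ℕ) :
    N.done X r Y (j + 1) = N.done X r Y j ∪ N.done Y j Z N.n ∧
      Disjoint (N.done X r Y j) (N.done Y j Z N.n) := by
  have hzone : ∀ v, N.Zone Y j v ↔ N.Link Y j v := fun v => or_iff_right (by omega)
  constructor
  · ext v
    rw [mem_done_succ, Finset.mem_union, mem_done_top, hzone]
    exact or_congr_right (and_congr_right fun _ => and_iff_right_of_imp (Zone.of_link hs hz))
  · rw [Finset.disjoint_left]
    intro v hv hv'
    rw [mem_done_top, hzone] at hv'
    obtain ⟨-, -, u, hu, hl⟩ := mem_done.1 hv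
    exact ho ⟨u, hu, hl.trans hv'.2.symm⟩

theorem exists_mem_zip {l l' : List ℕ} (h : l.length = l'.length) {x : ℕ} (hx : x ∈ l) :
    ∃ p ∈ l.zip l', p.1 = x := by
  have : x ∈ (l.zip l').map Prod.fst := by rwa [List.map_fst_zip h.le]
  simpa using this

theorem fst_mem_of_mem_zip {l l' : List ℕ} {p : ℕ × ℕ} (hp : p ∈ l.zip l') : p.1 ∈ l :=
  (List.of_mem_zip hp).1

/-! ### Soundness of the derivation rules -/

/-- The rules are sound. -/
theorem Sem.of_rule (hlen : Y.length = col.length)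
    (hT : ∀ X r Y col j vec, T X r Y col j vec → N.Sem X r Y col j vec)
    (h : N.Rule T X r Y col j vec) : N.Sem X r Y col j vec := by
  classical
  rcases h with ⟨rfl, hvec, hsep, hcol⟩ | ⟨j, v₁, rfl, hj, hT₁, hstep⟩
  -- Only the bag needs colours at this point. They are well defined by consistency of `col`, and
  -- the default `0` elsewhere is irrelevant.
  · refine ⟨hlen, hsep, hcol, fun v => if h : ∃ p ∈ Y.zip col, p.1 = v then h.choose.2 else 0,
      ?_, by simp [done_zero], ?_, ?_⟩
    · intro p hp hpn
      have h : ∃ q ∈ Y.zip col, q.1 = p.1 := ⟨p, hp, rfl⟩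
      simp only [dif_pos h]
      exact (hcol.2 _ h.choose_spec.1 _ hp).1 h.choose_spec.2 (h.choose_spec.2.symm ▸ hpn)
    · intro u v hu hv huv
      simp only [done_zero, Finset.notMem_empty, false_or] at hu hv
      have hu' := exists_mem_zip hlen hu
      have hv' := exists_mem_zip hlen hv
      simp only [dif_pos hu', dif_pos hv']
      refine (hcol.2 _ hu'.choose_spec.1 _ hv'.choose_spec.1).2 ?_
      rwa [hu'.choose_spec.2, hv'.choose_spec.2]
    · simpa [done_zero] using hvec
  obtain ⟨-, hsep, hcol, a, ha1, ha2, ha3, ha4⟩ := hT _ _ _ _ _ _ hT₁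
  refine ⟨hlen, hsep, hcol, ?_⟩
  rcases hstep with ⟨hskip, hvec⟩ | ⟨hz, p, hp, rfl, hvec⟩ | ⟨hz, hjY, ho, Z, col', v₂, hT₂, hc, hvec⟩
  · rw [done_succ_of_skip hsep hskip]
    exact ⟨a, ha1, ha2, ha3, fun i hi => (hvec i hi).trans (ha4 i hi)⟩
  · have hpY := fst_mem_of_mem_zip hp
    obtain ⟨h1, h2⟩ := done_succ_of_mem hj hz hpY
    rw [h1]
    have hap := ha1 p hp hj
    refine ⟨a, ha1, ?_, ?_, ?_⟩
    · intro v hv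
      rcases Finset.mem_insert.1 hv with rfl | hv
      · rw [hap]
        exact ⟨(hcol.1 p hp).1, (hcol.1 p hp).2 hj⟩
      · exact ha2 v hv
    · have : ∀ u, u ∈ insert p.1 (N.done X r Y p.1) ∨ u ∈ Y → u ∈ N.done X r Y p.1 ∨ u ∈ Y := by
        rintro u (hu | hu)
        · rcases Finset.mem_insert.1 hu with rfl | hu
          · exact .inr hpY
          · exact .inl hu
        · exact .inr hu
      exact fun u v hu hv => ha3 u v (this u hu) (this v hv)
    · intro i hi
      rw [hvec i hi, Finset.sum_insert h2, hap, ha4 i hi, add_comm]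
  · obtain ⟨hlen', hsep', hcol', b, hb1, hb2, hb3, hb4⟩ := hT _ _ _ _ _ _ hT₂
    obtain ⟨h1, h2⟩ := done_succ_of_sub hsep hj hz ho Z
    set E := N.done Y j Z N.n with hE
    have hmemE : ∀ v, v ∈ E ↔ v < N.n ∧ N.Link Y j v := by
      intro v
      rw [hE, mem_done_top]
      exact and_congr_right fun _ => or_iff_right (by omega)
    have hEY : ∀ v ∈ E, v ∉ Y := fun v hv => ((hmemE v).1 hv).2.not_mem hjY
    -- a neighbour of the component is in both bags
    have hnb : ∀ u v, u ∈ E → v ∉ E → N.adj u v → v ∈ Y ∧ v ∈ Z ∧ a v = b v := by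
      intro u v hu hv huv
      have hvn := N.lt _ _ (N.symm _ _ huv)
      have hvz : ¬ N.Link Y j v := fun h => hv ((hmemE v).2 ⟨hvn, h⟩)
      have hvY : v ∈ Y := by
        by_contra hvY
        exact hvz (((hmemE u).1 hu).2.tail ⟨hEY u hu, hvY, huv⟩)
      have hvZ : v ∈ Z := hsep' u v (.inr ((hmemE u).1 hu).2) huv
        (fun h => h.elim (by omega) hvz)
      obtain ⟨p, hp, rfl⟩ := exists_mem_zip hlen hvY
      obtain ⟨q, hq, hqp⟩ := exists_mem_zip hlen' hvZ
      refine ⟨hvY, hvZ, ?_⟩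
      rw [ha1 p hp hvn, ← hqp, hb1 q hq (by omega)]
      exact hc p hp q hq hqp.symm hvn
    -- The colouring of the subproblem is used on its component and the old one elsewhere. By `hnb`,
    -- edges between the two parts end at vertices on which both colourings agree.
    refine ⟨fun v => if v ∈ E then b v else a v, ?_, ?_, ?_, ?_⟩
    · intro p hp hpn
      simp only [if_neg (fun h => hEY _ h (fst_mem_of_mem_zip hp))]
      exact ha1 p hp hpn
    · intro v hv
      by_cases hvE : v ∈ E
      · simp only [if_pos hvE]
        exact hb2 v hvE
      · simp only [if_neg hvE]
        rw [h1, Finset.mem_union, or_iff_left hvE] at hv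
        exact ha2 v hv
    · intro u v hu hv huv
      have hold : ∀ u, u ∉ E → u ∈ N.done X r Y (j + 1) ∨ u ∈ Y → u ∈ N.done X r Y j ∨ u ∈ Y := by
        intro u hu h
        rwa [h1, Finset.mem_union, or_iff_left hu] at h
      by_cases huE : u ∈ E <;> by_cases hvE : v ∈ E
      · simp only [if_pos huE, if_pos hvE]
        exact hb3 u v (.inl huE) (.inl hvE) huv
      · obtain ⟨-, hvZ, hab⟩ := hnb u v huE hvE huv
        simp only [if_pos huE, if_neg hvE, hab]
        exact hb3 u v (.inl huE) (.inr hvZ) huv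
      · obtain ⟨-, huZ, hab⟩ := hnb v u hvE huE (N.symm _ _ huv)
        simp only [if_neg huE, if_pos hvE, hab]
        exact hb3 u v (.inr huZ) (.inl hvE) huv
      · simp only [if_neg huE, if_neg hvE]
        exact ha3 u v (hold u huE hu) (hold v hvE hv) huv
    · intro i hi
      rw [hvec i hi, h1, Finset.sum_union h2, ha4 i hi, hb4 i hi]
      refine congr_arg₂ _ (Finset.sum_congr rfl fun v hv => ?_) (Finset.sum_congr rfl fun v hv => ?_)
      · simp only [if_neg (Finset.disjoint_left.1 h2 hv)]
      · simp only [if_pos hv]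

/-- A colouring of the whole graph. -/
def IsColouring (N : Net) (a : ℕ → ℕ) : Prop :=
  (∀ v < N.n, a v < N.k ∧ N.ok v (a v)) ∧ ∀ u v, N.adj u v → a u ≠ a v

theorem Sem.exists_colouring (h : N.Sem X N.n Y col N.n vec) :
    ∃ a, N.IsColouring a ∧ ∀ i < N.K, vec.getD i 0 = ∑ v ∈ Finset.range N.n, N.wt i v (a v) := by
  obtain ⟨-, -, -, a, -, h2, h3, h4⟩ := h
  have hd : N.done X N.n Y N.n = Finset.range N.n := by
    ext v
    simp [mem_done_top, Zone]
  rw [hd] at h2 h3 h4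
  refine ⟨a, ⟨fun v hv => h2 v (Finset.mem_range.2 hv), fun u v huv => ?_⟩, h4⟩
  exact h3 u v (.inl (Finset.mem_range.2 (N.lt _ _ huv)))
    (.inl (Finset.mem_range.2 (N.lt _ _ (N.symm _ _ huv)))) huv

/-- The bags of a tree decomposition, as far as the dynamic program is concerned. -/
structure BagFamily (N : Net) (W : ℕ) (F : Set (List ℕ)) : Prop where
  length : ∀ Y ∈ F, Y.length = W
  -- The value `N.n` is no vertex. It pads bags to the common length `W`.
  le : ∀ Y ∈ F, ∀ x ∈ Y, x ≤ N.n
  nonempty : F.Nonempty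
  -- The vertex `c` of the component in the new bag is what makes the recursion over components
  -- terminate.
  next : ∀ Y ∈ F, ∀ j < N.n, j ∉ Y → ∃ Z ∈ F, N.Sep Y j Z ∧ ∃ c ∈ Z, N.Link Y j c

/-- The table contains all valid tuples that the rules derive. -/
def Closed (N : Net) (W M : ℕ) (T : Table) : Prop :=
  ∀ X r Y col j vec, X.length = W → Y.length = W → col.length = W → vec.length = N.K →
    (∀ x ∈ X, x < M) → r < M → (∀ x ∈ Y, x < M) → (∀ x ∈ col, x < M) → j < M →
    (∀ x ∈ vec, x < M) → N.Rule T X r Y col j vec → T X r Y col j vec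

/-- The total weights of the coloured set. -/
def total (N : Net) (a : ℕ → ℕ) (U : Finset ℕ) : List ℕ :=
  (List.range N.K).map fun i => ∑ v ∈ U, N.wt i v (a v)

theorem getD_total {a : ℕ → ℕ} {U : Finset ℕ} {i : ℕ} (hi : i < N.K) :
    (N.total a U).getD i 0 = ∑ v ∈ U, N.wt i v (a v) := by
  rw [List.getD_eq_getElem _ _ (by simpa [total] using hi)]
  simp [total]

theorem mem_zip_map {Y : List ℕ} {f : ℕ → ℕ} {p : ℕ × ℕ} (hp : p ∈ Y.zip (Y.map f)) :
    p.1 ∈ Y ∧ p.2 = f p.1 := by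
  induction Y with
  | nil => simp at hp
  | cons y Y ih =>
    rw [List.map_cons, List.zip_cons_cons, List.mem_cons] at hp
    rcases hp with rfl | hp
    · simp
    · exact ⟨List.mem_cons_of_mem _ (ih hp).1, (ih hp).2⟩

/-! ### Completeness of the derivation rules -/

section Completeness

variable {W M : ℕ} {F : Set (List ℕ)} {a : ℕ → ℕ}

/-- The colours of a bag. -/
def colours (N : Net) (a : ℕ → ℕ) (Y : List ℕ) : List ℕ := Y.map fun v => if v < N.n then a v else 0

theorem mem_zip_colours {p : ℕ × ℕ} (hp : p ∈ Y.zip (N.colours a Y)) :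
    p.1 ∈ Y ∧ p.2 = if p.1 < N.n then a p.1 else 0 := mem_zip_map hp

/-- For a given colouring, the facts that record its true partial sums are derived by induction on
`j`, with the components outside `Y` supplied by `hsub`. Partial sums are at most the total sums,
hence below `M`, so the tables can hold them. -/
theorem derive_all (hF : N.BagFamily W F) (hT : N.Closed W M T) (hnM : N.n < M) (hkM : N.k ≤ M)
    (hk : 0 < N.k) (ha : N.IsColouring a)
    (hsum : ∀ i < N.K, ∑ v ∈ Finset.range N.n, N.wt i v (a v) < M)
    (hX : X.length = W) (hXn : ∀ x ∈ X, x ≤ N.n) (hr : r ≤ N.n) (hY : Y ∈ F) (hsep : N.Sep X r Y)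
    (hsub : ∀ j < N.n, N.Zone X r j → j ∉ Y →
      ∃ Z ∈ F, T Y j Z (N.colours a Z) N.n (N.total a (N.done Y j Z N.n))) :
    ∀ j ≤ N.n, T X r Y (N.colours a Y) j (N.total a (N.done X r Y j)) := by
  have hsum' : ∀ j, ∀ x ∈ N.total a (N.done X r Y j), x < M := by
    intro j x hx
    simp only [total, List.mem_map, List.mem_range] at hx
    obtain ⟨i, hi, rfl⟩ := hx
    exact (Finset.sum_le_sum_of_subset fun v hv =>
      Finset.mem_range.2 (mem_done.1 hv).1).trans_lt (hsum i hi)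
  have hcolM : ∀ x ∈ N.colours a Y, x < M := by
    intro x hx
    simp only [colours, List.mem_map] at hx
    obtain ⟨v, -, rfl⟩ := hx
    split_ifs with h
    · exact ((ha.1 v h).1).trans_le hkM
    · omega
  have happ : ∀ j ≤ N.n, N.Rule T X r Y (N.colours a Y) j (N.total a (N.done X r Y j)) →
      T X r Y (N.colours a Y) j (N.total a (N.done X r Y j)) := fun j hj h =>
    hT _ _ _ _ _ _ hX (hF.length Y hY) (by simpa [colours] using hF.length Y hY)
      (by simp [total]) (fun x hx => (hXn x hx).trans_lt hnM) (by omega)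
      (fun x hx => (hF.le Y hY x hx).trans_lt hnM) hcolM (by omega) (hsum' j) h
  intro j
  induction j with
  | zero =>
    refine fun _ => happ 0 (by omega) (.inl ⟨rfl, fun i hi => ?_, hsep, ?_, ?_⟩)
    · rw [getD_total hi, done_zero, Finset.sum_empty]
    · intro p hp
      obtain ⟨-, h⟩ := mem_zip_colours hp
      rw [h]
      split_ifs with hn
      · exact ⟨(ha.1 _ hn).1, fun _ => (ha.1 _ hn).2⟩
      · exact ⟨hk, fun h => absurd h hn⟩
    · intro p hp q hq
      obtain ⟨-, h⟩ := mem_zip_colours hp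
      obtain ⟨-, h'⟩ := mem_zip_colours hq
      refine ⟨fun he _ => by rw [h, h', he], fun hadj => ?_⟩
      rw [h, h', if_pos (N.lt _ _ hadj), if_pos (N.lt _ _ (N.symm _ _ hadj))]
      exact ha.2 _ _ hadj
  | succ j ih =>
    intro hj
    refine happ (j + 1) hj (.inr ⟨j, _, rfl, hj, ih (by omega), ?_⟩)
    by_cases hskip : ¬ N.Zone X r j ∨ N.Old Y j
    · exact .inl ⟨hskip, fun i _ => by rw [done_succ_of_skip hsep hskip]⟩
    right
    push Not at hskip
    obtain ⟨hz, ho⟩ := hskip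
    by_cases hjY : j ∈ Y
    · left
      obtain ⟨p, hp, rfl⟩ := exists_mem_zip (l' := N.colours a Y) (by simp [colours]) hjY
      refine ⟨hz, p, hp, rfl, fun i hi => ?_⟩
      obtain ⟨h1, h2⟩ := done_succ_of_mem hj hz hjY
      rw [getD_total hi, getD_total hi, h1, Finset.sum_insert h2, (mem_zip_colours hp).2,
        if_pos (show p.1 < N.n from hj), add_comm]
    · right
      obtain ⟨Z, hZ, hTZ⟩ := hsub j hj hz hjY
      refine ⟨hz, hjY, ho, Z, _, _, hTZ, ?_, fun i hi => ?_⟩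
      · intro p hp q hq he _
        rw [(mem_zip_colours hp).2, (mem_zip_colours hq).2, he]
      · obtain ⟨h1, h2⟩ := done_succ_of_sub hsep hj hz ho Z
        rw [getD_total hi, getD_total hi, getD_total hi, h1, Finset.sum_union h2]

/-- The rules are complete if there are enough bags. -/
theorem exists_derivation (hF : N.BagFamily W F) (hT : N.Closed W M T) (hnM : N.n < M)
    (hkM : N.k ≤ M) (hk : 0 < N.k) (ha : N.IsColouring a)
    (hsum : ∀ i < N.K, ∑ v ∈ Finset.range N.n, N.wt i v (a v) < M) :
    ∃ X Y col vec, T X N.n Y col N.n vec ∧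
      ∀ i < N.K, vec.getD i 0 = ∑ v ∈ Finset.range N.n, N.wt i v (a v) := by
  -- Induction on the size of the component of `j` outside `Y`. The next bag `Z` contains one of its
  -- vertices, so each component outside `Z` within it is smaller. The second `Y` in `done Y j Y` is
  -- a dummy, as the size does not depend on it.
  have key : ∀ c : ℕ, ∀ Y ∈ F, ∀ j < N.n, j ∉ Y → (N.done Y j Y N.n).card = c →
      ∃ Z ∈ F, T Y j Z (N.colours a Z) N.n (N.total a (N.done Y j Z N.n)) := by
    intro c
    induction c using Nat.strong_induction_on with
    | _ c ih =>
      intro Y hY j hj hjY hc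
      obtain ⟨Z, hZ, hsep, x, hxZ, hx⟩ := hF.next Y hY j hj hjY
      refine ⟨Z, hZ, derive_all hF hT hnM hkM hk ha hsum (hF.length Y hY) (hF.le Y hY) hj.le hZ hsep
        (fun j' hj' hz hj'Z => ?_) N.n le_rfl⟩
      refine ih _ ?_ Z hZ j' hj' hj'Z rfl
      rw [← hc]
      refine Finset.card_lt_card ⟨fun v hv => ?_, fun hsub => ?_⟩
      · rw [mem_done_top] at hv ⊢
        exact ⟨hv.1, Zone.of_link hsep hz (hv.2.resolve_left (by omega))⟩
      · have := hsub (mem_done_top.2 ⟨hx.lt hj, .inr hx⟩)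
        rw [mem_done_top] at this
        exact (this.2.resolve_left (by omega)).not_mem hj'Z hxZ
  obtain ⟨Y, hY⟩ := hF.nonempty
  -- With `r = N.n` the zone is the whole vertex set, so separation holds vacuously and `X` plays no
  -- role.
  refine ⟨Y, Y, _, _, derive_all hF hT hnM hkM hk ha hsum (hF.length Y hY) (hF.le Y hY) le_rfl hY
    (fun _ _ _ _ h => absurd (.inl le_rfl) h) (fun j hj _ hjY => key _ Y hY j hj hjY rfl) N.n le_rfl,
    fun i hi => ?_⟩
  rw [getD_total hi]
  congr 1
  ext v
  simp [mem_done_top, Zone]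

end Completeness

end Net

/-! ## Bags of a tree decomposition -/

theorem exists_walk_of_induce_preconnected {V : Type*} {G : SimpleGraph V} {A : Set V}
    (h : (G.induce A).Preconnected) {a b : V} (ha : a ∈ A) (hb : b ∈ A) :
    ∃ p : G.Walk a b, ∀ x ∈ p.support, x ∈ A := by
  obtain ⟨p⟩ := h ⟨a, ha⟩ ⟨b, hb⟩
  have : ∀ (u v : A), (G.induce A).Walk u v → ∃ q : G.Walk u v, ∀ x ∈ q.support, x ∈ A := by
    intro u v p
    induction p with
    | nil => exact ⟨.nil, by simp⟩
    | @cons u v _ h _ ih =>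
      obtain ⟨q, hq⟩ := ih
      have h' : G.Adj u v := h
      refine ⟨.cons h' q, fun x hx => ?_⟩
      rw [SimpleGraph.Walk.support_cons, List.mem_cons] at hx
      rcases hx with rfl | hx
      · exact u.2
      · exact hq x hx
  exact this _ _ p

/-- A nonempty connected set of nodes of a tree has a gate towards every node `t`: it lies on every
walk from `t` to the set. -/
theorem exists_gate {N : Type*} {T : SimpleGraph N} (hT : T.IsTree) {S : Set N}
    (hS : S.Nonempty) (hconn : ∀ a ∈ S, ∀ b ∈ S, ∃ p : T.Walk a b, ∀ x ∈ p.support, x ∈ S)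
    (t : N) : ∃ g ∈ S, ∀ s ∈ S, ∀ p : T.Walk t s, g ∈ p.support := by
  classical
  -- The gate is a node of `S` nearest to `t`, so that a shortest path from `t` meets `S` only in
  -- its end `g`.
  obtain ⟨g, hg, hmin⟩ : ∃ g ∈ S, ∀ s ∈ S, T.dist t g ≤ T.dist t s := by
    obtain ⟨_, ⟨g, hg, rfl⟩, hmin⟩ := WellFounded.has_min Nat.lt_wfRel.wf (T.dist t '' S) (hS.image _)
    exact ⟨g, hg, fun s hs => not_lt.1 (hmin _ ⟨s, hs, rfl⟩)⟩
  refine ⟨g, hg, fun s hs r => ?_⟩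
  obtain ⟨p, hp, hpl⟩ := hT.connected.exists_path_of_dist t g
  obtain ⟨q₀, hq₀⟩ := hconn g hg s hs
  have hq : q₀.bypass.IsPath := q₀.bypass_isPath
  have hqS : ∀ x ∈ q₀.bypass.support, x ∈ S := fun x hx =>
    hq₀ x (q₀.support_bypass_subset_support hx)
  generalize q₀.bypass = q at hq hqS
  have hpS : ∀ x ∈ p.support, x ∈ S → x = g := by
    intro x hx hxS
    have h1 := congrArg SimpleGraph.Walk.length (p.take_spec hx)
    rw [SimpleGraph.Walk.length_append] at h1
    have h2 := SimpleGraph.dist_le (p.takeUntil x hx)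
    have h3 := hmin x hxS
    exact SimpleGraph.Walk.eq_of_length_eq_zero (p := p.dropUntil x hx) (by omega)
  -- Continued by a path inside `S`, it is the unique path of the tree from `t` to `s`, hence part
  -- of every walk between them.
  have hpath : (p.append q).IsPath := by
    rw [SimpleGraph.Walk.isPath_def, SimpleGraph.Walk.support_append, List.nodup_append]
    have hq' := hq.support_nodup
    rw [← SimpleGraph.Walk.cons_tail_support, List.nodup_cons] at hq'
    refine ⟨hp.support_nodup, hq'.2, fun x hx y hy hxy => ?_⟩
    subst hxy
    have := hpS x hx (hqS x (List.mem_of_mem_tail hy))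
    exact hq'.1 (this ▸ hy)
  have huniq := (hT.isAcyclic.subsingleton_path _ _).elim ⟨p.append q, hpath⟩
    ⟨r.bypass, r.bypass_isPath⟩
  have heq : p.append q = r.bypass := congrArg Subtype.val huniq
  refine r.support_bypass_subset_support ?_
  rw [← heq, SimpleGraph.Walk.mem_support_append_iff]
  exact .inl p.end_mem_support

/-- The nodes whose bags meet `C` are connected, since the two ends of an edge share a bag. Let `g`
be their gate towards `t`. If `y` in the bag of `t` has a neighbour `c` in `C`, then `y` and `c`
share the bag of some node `s`. The nodes whose bags contain `y` connect `t` to `s`, so they include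
`g`. -/
theorem TreeDecomposition.exists_bag_of_connected {V : Type*} {G : SimpleGraph V}
    (D : TreeDecomposition G) {C : Set V} (hC : C.Nonempty)
    (hconn : ∀ a ∈ C, ∀ b ∈ C, Relation.ReflTransGen (fun u v => v ∈ C ∧ G.Adj u v) a b)
    (t : D.Node) : ∃ g : D.Node, (∃ c ∈ C, c ∈ D.bag g) ∧
      ∀ y ∈ D.bag t, ∀ c ∈ C, G.Adj c y → y ∈ D.bag g := by
  let S : Set D.Node := {s | ∃ c ∈ C, c ∈ D.bag s}
  have hone : ∀ c ∈ C, ∀ a b, c ∈ D.bag a → c ∈ D.bag b →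
      ∃ p : D.tree.Walk a b, ∀ x ∈ p.support, x ∈ S := by
    intro c hc a b ha hb
    obtain ⟨p, hp⟩ := exists_walk_of_induce_preconnected (D.connected c).preconnected ha hb
    exact ⟨p, fun x hx => ⟨c, hc, hp x hx⟩⟩
  obtain ⟨c₀, hc₀⟩ := hC
  obtain ⟨s₀, hs₀⟩ := D.exists_mem_bag c₀
  obtain ⟨g, hg, hgate⟩ := exists_gate D.isTree (S := S) ⟨s₀, c₀, hc₀, hs₀⟩ (by
    rintro a ⟨c, hc, hca⟩ b ⟨d, hd, hdb⟩
    have := hconn c hc d hd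
    induction this generalizing b with
    | refl => exact hone c hc a b hca hdb
    | @tail d d' hcd hdd' ih =>
      have hdC : d ∈ C := by
        rcases Relation.ReflTransGen.cases_tail hcd with h | ⟨_, -, h⟩
        · exact h ▸ hc
        · exact h.1
      obtain ⟨m, hm, hm'⟩ := D.exists_edge_bag d d' hdd'.2
      obtain ⟨p, hp⟩ := ih m hdC hm
      obtain ⟨q, hq⟩ := hone d' hdd'.1 m b hm' hdb
      refine ⟨p.append q, fun x hx => ?_⟩
      rw [SimpleGraph.Walk.mem_support_append_iff] at hx
      exact hx.elim (hp x) (hq x)) t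
  refine ⟨g, hg, fun y hy c hc hcy => ?_⟩
  obtain ⟨s, hs, hs'⟩ := D.exists_edge_bag c y hcy
  obtain ⟨p, hp⟩ := exists_walk_of_induce_preconnected (D.connected y).preconnected hy hs'
  exact hp g (hgate s ⟨c, hc, hs⟩ p)

/-- The infimum in `treewidth` is attained: the set of widths is nonempty, because one bag can hold
all vertices. -/
theorem exists_treeDecomposition {V : Type*} [Finite V] {G : SimpleGraph V} {w : ℕ}
    (h : treewidth G ≤ w) : ∃ D : TreeDecomposition G, ∀ t, (D.bag t).card ≤ w + 1 := by
  have := Fintype.ofFinite V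
  have hne : {w : ℕ | ∃ D : TreeDecomposition G, ∀ t : D.Node, (D.bag t).card ≤ w + 1}.Nonempty := by
    refine ⟨Fintype.card V, ⟨Unit, inferInstance, ⊥, .of_subsingleton, fun _ => Finset.univ,
      by simp, by simp, fun v => ?_⟩, fun t => ?_⟩
    · have : Nonempty {t : Unit | v ∈ (Finset.univ : Finset V)} := ⟨⟨(), by simp⟩⟩
      exact (SimpleGraph.IsTree.of_subsingleton).connected
    · exact (Finset.card_le_univ _).trans (Nat.le_succ _)
  obtain ⟨D, hD⟩ := Nat.sInf_mem hne
  exact ⟨D, fun t => (hD t).trans (Nat.succ_le_succ h)⟩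

/-- The adjacency relation of a graph on `Fin n`, on natural numbers. -/
def natAdj {n : ℕ} (G : SimpleGraph (Fin n)) (u v : ℕ) : Prop :=
  ∃ (hu : u < n) (hv : v < n), G.Adj ⟨u, hu⟩ ⟨v, hv⟩

/-- A bag as a list of fixed length, padded with `n`. -/
noncomputable def bagList {n : ℕ} (W : ℕ) (b : Finset (Fin n)) : List ℕ :=
  b.toList.map Fin.val ++ List.replicate (W - b.card) n

theorem mem_bagList {n W : ℕ} {b : Finset (Fin n)} {v : ℕ} (hv : v < n) :
    v ∈ bagList W b ↔ ⟨v, hv⟩ ∈ b := by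
  simp only [bagList, List.mem_append, List.mem_map, Finset.mem_toList, List.mem_replicate,
    hv.ne, and_false, or_false]
  constructor
  · rintro ⟨x, hx, rfl⟩
    exact hx
  · exact fun h => ⟨_, h, rfl⟩

/-- The family consists of the padded bags of a tree decomposition of small width. The next bag for
a component comes from `exists_bag_of_connected`, applied to that component. -/
theorem exists_bagFamily {w : ℕ} {N : Net} {G : SimpleGraph (Fin N.n)} (hN : N.adj = natAdj G)
    (h : treewidth G ≤ w) : ∃ F, N.BagFamily (w + 1) F := by
  obtain ⟨D, hD⟩ := exists_treeDecomposition h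
  refine ⟨Set.range fun t => bagList (w + 1) (D.bag t), ?_, ?_, ?_, ?_⟩
  · rintro _ ⟨t, rfl⟩
    have := hD t
    simp [bagList]
    omega
  · rintro _ ⟨t, rfl⟩ x hx
    simp only [bagList, List.mem_append, List.mem_map, List.mem_replicate] at hx
    rcases hx with ⟨y, -, rfl⟩ | ⟨-, rfl⟩
    · exact y.2.le
    · exact le_rfl
  · obtain ⟨t⟩ := D.isTree.connected.nonempty
    exact ⟨_, t, rfl⟩
  · rintro _ ⟨t, rfl⟩ j hj hjt
    set Y := bagList (w + 1) (D.bag t)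
    let C : Set (Fin N.n) := {v | N.Link Y j v}
    have hlink : ∀ a ∈ C, ∀ b : ℕ, N.Link Y a b → ∃ hb : b < N.n, (⟨b, hb⟩ : Fin N.n) ∈ C ∧
        Relation.ReflTransGen (fun u v => v ∈ C ∧ G.Adj u v) a ⟨b, hb⟩ := by
      intro a ha b hb
      induction hb with
      | refl => exact ⟨a.2, ha, .refl⟩
      | tail _ hbc ih =>
        obtain ⟨hb, hbC, hab⟩ := ih
        have hadj := hbc.2.2
        rw [hN] at hadj
        obtain ⟨hu, hv, hadj⟩ := hadj
        have hvC : (⟨_, hv⟩ : Fin N.n) ∈ C := Relation.ReflTransGen.tail hbC hbc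
        exact ⟨hv, hvC, hab.tail ⟨hvC, hadj⟩⟩
    obtain ⟨g, ⟨c, hc, hcg⟩, hg⟩ := D.exists_bag_of_connected (C := C) ⟨⟨j, hj⟩, .refl⟩ (by
      intro a ha b hb
      exact (hlink a ha b (Net.Link.symm ha |>.trans hb)).2.2) t
    refine ⟨_, ⟨g, rfl⟩, ?_, c, (mem_bagList c.2).2 hcg, hc⟩
    intro u z hu huz hz
    have hu' : N.Link Y j u := hu.resolve_left (by omega)
    have huz' := huz
    rw [hN] at huz'
    obtain ⟨hun, hzn, hadj⟩ := huz'
    refine (mem_bagList hzn).2 (hg _ ?_ ⟨u, hun⟩ hu' hadj)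
    -- A neighbour of the component that is not in the present bag would belong to the component
    -- itself.
    by_contra hzt
    exact hz (.inr (hu'.tail ⟨hu'.not_mem hjt, fun h => hzt ((mem_bagList hzn).1 h), huz⟩))

/-! ## The program of the dynamic program -/

/-- The list of the values `ρ o, …, ρ (o + len - 1)`. -/
def seg (ρ : ℕ → ℕ) (o len : ℕ) : List ℕ := (List.range len).map fun i => ρ (o + i)

@[simp] theorem length_seg (ρ : ℕ → ℕ) (o len : ℕ) : (seg ρ o len).length = len := by simp [seg]

theorem getD_seg {ρ : ℕ → ℕ} {o len i : ℕ} (hi : i < len) : (seg ρ o len).getD i 0 = ρ (o + i) := by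
  rw [List.getD_eq_getElem _ _ (by simpa using hi)]
  simp [seg]

theorem seg_add (ρ : ℕ → ℕ) (o a b : ℕ) : seg ρ o (a + b) = seg ρ o a ++ seg ρ (o + a) b := by
  simp [seg, List.range_add, Function.comp_def, add_assoc]

theorem seg_one (ρ : ℕ → ℕ) (o : ℕ) : seg ρ o 1 = [ρ o] := by simp [seg]

theorem map_range_eq_seg (ρ : ℕ → ℕ) (d : ℕ) : (List.range d).map ρ = seg ρ 0 d := by simp [seg]

/-- The entry of a list at a position, as a valuation of the variables. -/
def entry (l : List ℕ) (j : ℕ) : ℕ := l.getD j 0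

theorem entry_lt {l : List ℕ} {M : ℕ} (hM : 0 < M) (hl : ∀ x ∈ l, x < M) (j : ℕ) :
    entry l j < M := by
  rw [entry]
  by_cases hj : j < l.length
  · rw [List.getD_eq_getElem _ _ hj]
    exact hl _ (List.getElem_mem hj)
  · rwa [List.getD_eq_default _ _ (not_lt.1 hj)]

theorem seg_entry_append_left {A B : List ℕ} {len : ℕ} (h : A.length = len) :
    seg (entry (A ++ B)) 0 len = A := by
  refine List.ext_getElem (by simp [h]) fun i hi hi' => ?_
  simp [seg, entry, List.getElem?_append_left hi', hi']

theorem entry_append_right {A B : List ℕ} {j : ℕ} (h : A.length ≤ j) :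
    entry (A ++ B) j = entry B (j - A.length) := by
  rw [entry, entry, List.getD_append_right _ _ _ _ h]

theorem entry_singleton_append (x : ℕ) (B : List ℕ) : entry ([x] ++ B) 0 = x := rfl

theorem seg_entry_append_right {A B : List ℕ} {o len : ℕ} (h : A.length ≤ o) :
    seg (entry (A ++ B)) o len = seg (entry B) (o - A.length) len := by
  refine List.map_congr_left fun i _ => ?_
  rw [entry_append_right (by omega), Nat.sub_add_comm h]

/-- Variable number `o`. -/
def var (o : ℕ) : Expr := .reg (20 + o)

/-- The variables `o, …, o + len - 1`. -/
def blk (o len : ℕ) : List Expr := (List.range len).map fun i => var (o + i)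

@[simp] theorem length_blk (o len : ℕ) : (blk o len).length = len := by simp [blk]

theorem map_eval_blk {s : State} {ρ : ℕ → ℕ} {m o len : ℕ} (hρ : ∀ j < m, s.reg (20 + j) = ρ j)
    (h : o + len ≤ m) : (blk o len).map (Expr.eval s) = seg ρ o len := by
  simp only [blk, seg, List.map_map]
  refine List.map_congr_left fun i hi => ?_
  exact hρ _ (by have := List.mem_range.1 hi; omega)

/-- All values are below the loop bound. -/
def ValidE (s : State) (es : List Expr) : Prop := ∀ e ∈ es, e.eval s < s.reg 1

theorem validE_append {s : State} {es es' : List Expr} :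
    ValidE s (es ++ es') ↔ ValidE s es ∧ ValidE s es' := by
  simp [ValidE, or_imp, forall_and]

theorem validE_singleton {s : State} {e : Expr} : ValidE s [e] ↔ e.eval s < s.reg 1 := by
  simp [ValidE]

theorem validE_blk {s : State} {m o len : ℕ} (hρ : ∀ j < m, s.reg (20 + j) < s.reg 1)
    (h : o + len ≤ m) : ValidE s (blk o len) := by
  simp only [ValidE, blk, List.mem_map, List.mem_range, forall_exists_index, and_imp]
  rintro _ j hj rfl
  exact hρ _ (by omega)

theorem ValidE.map {s : State} {es : List Expr} (h : ValidE s es) :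
    ∀ x ∈ es.map (Expr.eval s), x < s.reg 1 := by
  simpa [ValidE] using h

def Expr.mem (e : Expr) (es : List Expr) : Expr := .any (es.map (Expr.eq e))

@[simp] theorem Expr.holds_mem {s : State} {e : Expr} {es : List Expr} :
    (Expr.mem e es).Holds s ↔ e.eval s ∈ es.map (Expr.eval s) := by
  simp [Expr.mem, eq_comm]

def adjE (a b : Expr) : Expr := .cell 2 (Expr.code [a, b])

/-- The allocation problem as a problem for the dynamic program. -/
def allocNet (k n : ℕ) (adj : ℕ → ℕ → Prop) (symm : ∀ u v, adj u v → adj v u)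
    (lt : ∀ u v, adj u v → u < n) (ut co fix : ℕ → ℕ) : Net where
  n := n
  adj := adj
  k := k
  K := k + k
  -- Weight `i < k` adds up the costs of bundle `i`, and weight `k + i` its utilities.
  wt i v c := if i < k then if c = i then co v else 0 else if c + k = i then ut v else 0
  -- Prescribed colours are shifted by one, so that `0`, the initial content of the array, means
  -- that the vertex is free.
  ok v c := fix v = 0 ∨ fix v = c + 1
  symm := symm
  lt := lt

/-- The state holds the data of the problem: register `2` the number of vertices, array `2` the
graph, arrays `3`, `4` and `5` the utilities, the costs and the prescribed colours. -/
structure State.Ready (s : State) (N : Net) (D : ℕ) : Prop where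
  two_le : 2 ≤ D
  n_lt : N.n < s.reg 1
  one_lt : 1 < s.reg 1
  powers : s.Powers D
  n : s.reg 2 = N.n
  adj : ∀ u v, u < s.reg 1 → v < s.reg 1 → (s.Tab 2 2 [u, v] ↔ N.adj u v)
  K : N.K = N.k + N.k
  wt : ∀ i v c, v < N.n → N.wt i v c =
    if i < N.k then if c = i then s.arr 4 v else 0 else if c + N.k = i then s.arr 3 v else 0
  ok : ∀ v c, v < N.n → (N.ok v c ↔ s.arr 5 v = 0 ∨ s.arr 5 v = c + 1)

theorem State.Powers.mono {s : State} {D D' : ℕ} (h : s.Powers D) (hD : D' ≤ D) : s.Powers D' :=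
  fun j hj => h j (by omega)

section

variable {N : Net} {D W T : ℕ} {s s' : State}

theorem State.Ready.frame (h : s.Ready N D) (hf : s.Frame T s') (hT : 6 ≤ T) (hT' : T < 11) :
    s'.Ready N D where
  two_le := h.two_le
  n_lt := by rw [hf.1 1 (by omega)]; exact h.n_lt
  one_lt := by rw [hf.1 1 (by omega)]; exact h.one_lt
  powers := hf.powers hT' h.powers
  n := by rw [hf.1 2 (by omega)]; exact h.n
  adj := by rw [hf.tab (by omega), hf.1 1 (by omega)]; exact h.adj
  K := h.K
  wt := by rw [hf.2 4 (by omega), hf.2 3 (by omega)]; exact h.wt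
  ok := by rw [hf.2 5 (by omega)]; exact h.ok

theorem holds_adjE (h : s.Ready N D) {a b : Expr} (ha : a.eval s < s.reg 1)
    (hb : b.eval s < s.reg 1) : (adjE a b).Holds s ↔ N.adj (a.eval s) (b.eval s) := by
  rw [adjE, Expr.holds_cell_code (D := 2) (h.powers.mono h.two_le) rfl (by simp [ha, hb])]
  exact h.adj _ _ ha hb

/-! ### Connectivity -/

/-- Table `7` holds connectivity outside a bag. -/
def State.HasLink (s : State) (N : Net) (W : ℕ) : Prop :=
  ∀ X u v, X.length = W → (∀ x ∈ X, x < s.reg 1) → u < s.reg 1 → v < s.reg 1 →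
    (s.Tab 7 (W + 2) (X ++ [u, v]) ↔ N.Link X u v)

theorem State.HasLink.frame (h : s.HasLink N W) (hf : s.Frame T s') (hT : 7 ≠ T) :
    s'.HasLink N W := by
  rw [State.HasLink, hf.tab hT, hf.1 1 (by omega)]
  exact h

def linkE (X : List Expr) (u v : Expr) : Expr := .cell 7 (Expr.code (X ++ [u, v]))

theorem holds_cell_append {X : List Expr} {u v : Expr} (hs : s.Powers (W + 2))
    (hX : X.length = W) (hXv : ValidE s X) (hu : u.eval s < s.reg 1) (hv : v.eval s < s.reg 1) :
    (linkE X u v).Holds s ↔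
      s.Tab 7 (W + 2) (X.map (Expr.eval s) ++ [u.eval s, v.eval s]) := by
  rw [linkE, Expr.holds_cell_code hs (by simp [hX])]
  · simp
  · rintro e he
    simp only [List.mem_append, List.mem_cons, List.not_mem_nil, or_false] at he
    rcases he with he | rfl | rfl
    exacts [hXv _ he, hu, hv]

theorem holds_linkE (h : s.HasLink N W) {X : List Expr} {u v : Expr} (hs : s.Powers (W + 2))
    (hX : X.length = W) (hXv : ValidE s X) (hu : u.eval s < s.reg 1) (hv : v.eval s < s.reg 1) :
    (linkE X u v).Holds s ↔ N.Link (X.map (Expr.eval s)) (u.eval s) (v.eval s) := by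
  rw [holds_cell_append hs hX hXv hu hv]
  exact h _ _ _ (by simpa using hX) hXv.map hu hv

/-- Saturation stores only the leading variables, and so quantifies existentially over the others.
Here variable `W + 2` is the last vertex before the end `W + 1` of a walk from `W`. -/
def linkCond (W : ℕ) : Expr :=
  .disj (.eq (var W) (var (W + 1))) (.all [linkE (blk 0 W) (var W) (var (W + 2)),
    .neg (.mem (var (W + 2)) (blk 0 W)), .neg (.mem (var (W + 1)) (blk 0 W)),
    adjE (var (W + 2)) (var (W + 1))])

def linkStage (W : ℕ) : Cmd := .saturate 7 (W + 2) (W + 3) (linkCond W)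

/-- Closedness of the table yields every link by induction along it. Leastness shows that nothing
else is in the table. -/
theorem linkStage_spec (h : s.Ready N D) (hD : W + 2 ≤ D) :
    ((linkStage W).exec s).HasLink N W := by
  have hfr : s.Frame 7 ((linkStage W).exec s) := Cmd.saturate_frame s
  have hM : ((linkStage W).exec s).reg 1 = s.reg 1 := hfr.1 1 (by omega)
  obtain ⟨hclosed, hleast⟩ := Cmd.saturate_spec (T := 7) (D := W + 2) (m := W + 3)
    (cond := linkCond W) (s₀ := s) h.one_lt (by omega) (by omega) (h.powers.mono hD)
    (fun A ρ => ρ W = ρ (W + 1) ∨ (A (seg ρ 0 W ++ [ρ W, ρ (W + 2)]) ∧ ρ (W + 2) ∉ seg ρ 0 W ∧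
      ρ (W + 1) ∉ seg ρ 0 W ∧ N.adj (ρ (W + 2)) (ρ (W + 1)))) (by
      intro t ρ ht hρ hρM
      have hr := h.frame ht (by omega) (by omega)
      have hv : ∀ o < W + 3, (var o).eval t = ρ o := hρ
      have hlt : ∀ o < W + 3, (var o).eval t < t.reg 1 := fun o ho => by
        rw [hv o ho, ht.1 1 (by omega)]; exact hρM o ho
      have hb := map_eval_blk (o := 0) (len := W) hρ (by omega)
      simp only [linkCond, Expr.holds_disj, Expr.holds_eq, Expr.holds_all, List.forall_mem_cons,
        List.not_mem_nil, false_imp_iff, implies_true, and_true, Expr.holds_neg, Expr.holds_mem,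
        holds_adjE hr (hlt (W + 2) (by omega)) (hlt (W + 1) (by omega)),
        holds_cell_append (hr.powers.mono hD) (length_blk 0 W)
          (validE_blk (m := W + 3) (fun j hj => hlt j hj) (by omega)) (hlt W (by omega))
          (hlt (W + 2) (by omega)), hb, hv W (by omega), hv (W + 1) (by omega),
        hv (W + 2) (by omega)])
  change ∀ ρ : ℕ → ℕ, _ at hclosed
  intro X u v hX hXM hu hv
  rw [hM] at hXM hu hv
  constructor
  · intro htab
    refine hleast (fun l => ∀ X u v, X.length = W → l = X ++ [u, v] → N.Link X u v) ?_ _ htab X u v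
      hX rfl
    intro A ρ hA _ hφ X u v hX hl
    rw [map_range_eq_seg, seg_add, seg_add ρ _ 1 1, seg_one, seg_one, zero_add] at hl
    obtain ⟨rfl, hl'⟩ := List.append_inj hl (by simp [hX])
    simp only [List.singleton_append, List.cons.injEq, and_true] at hl'
    obtain ⟨rfl, rfl⟩ := hl'
    rcases hφ with hφ | ⟨h1, h2, h3, h4⟩
    · rw [hφ]
      exact .refl
    · exact (hA _ h1 _ _ _ hX rfl).tail ⟨h2, h3, h4⟩
  · intro hl
    have key : ∀ v z, v < s.reg 1 → z < s.reg 1 → (u = v ∨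
        (((linkStage W).exec s).Tab 7 (W + 2) (X ++ [u, z]) ∧ z ∉ X ∧ v ∉ X ∧ N.adj z v)) →
        ((linkStage W).exec s).Tab 7 (W + 2) (X ++ [u, v]) := by
      intro v z hv hz hφ
      have h0 : seg (entry (X ++ [u, v, z])) 0 W = X := seg_entry_append_left hX
      have h1 : entry (X ++ [u, v, z]) W = u := by
        rw [entry_append_right hX.le, hX, Nat.sub_self]; rfl
      have h2 : entry (X ++ [u, v, z]) (W + 1) = v := by
        rw [entry_append_right (by omega), hX, Nat.add_sub_cancel_left]; rfl
      have h3 : entry (X ++ [u, v, z]) (W + 2) = z := by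
        rw [entry_append_right (by omega), hX, Nat.add_sub_cancel_left]; rfl
      have := hclosed (entry (X ++ [u, v, z])) (fun j _ => entry_lt (by omega) (by
        intro x hx
        simp only [List.mem_append, List.mem_cons, List.not_mem_nil, or_false] at hx
        rcases hx with hx | rfl | rfl | rfl
        exacts [hXM _ hx, hu, hv, hz]) j) (by rw [h0, h1, h2, h3]; exact hφ)
      rw [map_range_eq_seg, seg_add, seg_add _ _ 1 1, seg_one, seg_one, zero_add, h0, h1, h2] at this
      exact this
    clear hv
    induction hl with
    | refl => exact key u u hu hu (.inl rfl)
    | @tail b c hb hbc ih =>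
      have hbn := N.lt _ _ hbc.2.2
      have hcn := N.lt _ _ (N.symm _ _ hbc.2.2)
      have := h.n_lt
      exact key c b (by omega) (by omega) (.inr ⟨ih, hbc⟩)

/-! ### Earlier vertices of a component -/

/-- Table `8` tells whether there is an earlier vertex in the same component. -/
def State.HasOld (s : State) (N : Net) (W : ℕ) : Prop :=
  ∀ Y j, Y.length = W → (∀ x ∈ Y, x < s.reg 1) → j < s.reg 1 →
    (s.Tab 8 (W + 1) (Y ++ [j]) ↔ N.Old Y j)

theorem State.HasOld.frame (h : s.HasOld N W) (hf : s.Frame T s') (hT : 8 ≠ T) :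
    s'.HasOld N W := by
  rw [State.HasOld, hf.tab hT, hf.1 1 (by omega)]
  exact h

def oldE (Y : List Expr) (j : Expr) : Expr := .cell 8 (Expr.code (Y ++ [j]))

theorem holds_oldE (h : s.HasOld N W) {Y : List Expr} {j : Expr} (hs : s.Powers (W + 1))
    (hY : Y.length = W) (hYv : ValidE s Y) (hj : j.eval s < s.reg 1) :
    (oldE Y j).Holds s ↔ N.Old (Y.map (Expr.eval s)) (j.eval s) := by
  rw [oldE, Expr.holds_cell_code hs (by simp [hY]), List.map_append]
  · exact h _ _ (by simpa using hY) hYv.map hj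
  · exact validE_append.2 ⟨hYv, validE_singleton.2 hj⟩

def oldCond (W : ℕ) : Expr :=
  .conj (.lt (var (W + 1)) (var W)) (linkE (blk 0 W) (var (W + 1)) (var W))

def oldStage (W : ℕ) : Cmd := .saturate 8 (W + 1) (W + 2) (oldCond W)

theorem oldStage_spec (h : s.Ready N D) (hD : W + 2 ≤ D) (hl : s.HasLink N W) :
    ((oldStage W).exec s).HasOld N W := by
  have hfr : s.Frame 8 ((oldStage W).exec s) := Cmd.saturate_frame s
  have hM : ((oldStage W).exec s).reg 1 = s.reg 1 := hfr.1 1 (by omega)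
  obtain ⟨hclosed, hleast⟩ := Cmd.saturate_spec (T := 8) (D := W + 1) (m := W + 2)
    (cond := oldCond W) (s₀ := s) h.one_lt (by omega) (by omega) (h.powers.mono (by omega))
    (fun _ ρ => ρ (W + 1) < ρ W ∧ N.Link (seg ρ 0 W) (ρ (W + 1)) (ρ W)) (by
      intro t ρ ht hρ hρM
      have hr := h.frame ht (by omega) (by omega)
      have hv : ∀ o < W + 2, (var o).eval t = ρ o := hρ
      have hlt : ∀ o < W + 2, (var o).eval t < t.reg 1 := fun o ho => by
        rw [hv o ho, ht.1 1 (by omega)]; exact hρM o ho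
      rw [oldCond, Expr.holds_conj, Expr.holds_lt, holds_linkE (hl.frame ht (by omega))
        (hr.powers.mono hD) (length_blk 0 W)
        (validE_blk (m := W + 2) (fun j hj => hlt j hj) (by omega)) (hlt _ (by omega))
        (hlt _ (by omega)), map_eval_blk (o := 0) (len := W) hρ (by omega), hv W (by omega),
        hv (W + 1) (by omega)])
  intro Y j hY hYM hj
  rw [hM] at hYM hj
  constructor
  · intro htab
    refine hleast (fun l => ∀ Y j, Y.length = W → l = Y ++ [j] → N.Old Y j) ?_ _ htab Y j hY rfl
    rintro A ρ - - ⟨h1, h2⟩ Y j hY hl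
    rw [map_range_eq_seg, seg_add, seg_one, zero_add] at hl
    obtain ⟨rfl, hl'⟩ := List.append_inj hl (by simp [hY])
    obtain rfl : ρ W = j := by simpa using hl'
    exact ⟨_, h1, h2⟩
  · rintro ⟨u, huj, hl⟩
    have h0 : seg (entry (Y ++ [j, u])) 0 W = Y := seg_entry_append_left hY
    have h1 : entry (Y ++ [j, u]) W = j := by
      rw [entry_append_right hY.le, hY, Nat.sub_self]; rfl
    have h2 : entry (Y ++ [j, u]) (W + 1) = u := by
      rw [entry_append_right (by omega), hY, Nat.add_sub_cancel_left]; rfl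
    have := hclosed (entry (Y ++ [j, u])) (fun i _ => entry_lt (by omega) (by
      intro x hx
      simp only [List.mem_append, List.mem_cons, List.not_mem_nil, or_false] at hx
      rcases hx with hx | rfl | rfl
      exacts [hYM _ hx, hj, huj.trans hj]) i) (by rw [h0, h1, h2]; exact ⟨huj, hl⟩)
    rw [map_range_eq_seg, seg_add, seg_one, zero_add, h0, h1] at this
    exact this

/-! ### Separation -/

/-- Table `9` tells whether the bag does not contain all neighbours of the zone. -/
def State.HasSep (s : State) (N : Net) (W : ℕ) : Prop :=
  ∀ X r Y, X.length = W → Y.length = W → (∀ x ∈ X, x < s.reg 1) → r < s.reg 1 →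
    (∀ x ∈ Y, x < s.reg 1) → (s.Tab 9 (W + 1 + W) (X ++ [r] ++ Y) ↔ ¬ N.Sep X r Y)

theorem State.HasSep.frame (h : s.HasSep N W) (hf : s.Frame T s') (hT : 9 ≠ T) :
    s'.HasSep N W := by
  rw [State.HasSep, hf.tab hT, hf.1 1 (by omega)]
  exact h

def zoneE (X : List Expr) (r v : Expr) : Expr := .disj (.neg (.lt r (.reg 2))) (linkE X r v)

theorem holds_zoneE (hr : s.Ready N D) (h : s.HasLink N W) {X : List Expr} {r v : Expr}
    (hD : W + 2 ≤ D) (hX : X.length = W) (hXv : ValidE s X) (hu : r.eval s < s.reg 1)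
    (hv : v.eval s < s.reg 1) :
    (zoneE X r v).Holds s ↔ N.Zone (X.map (Expr.eval s)) (r.eval s) (v.eval s) := by
  rw [zoneE, Expr.holds_disj, holds_linkE h (hr.powers.mono hD) hX hXv hu hv, Expr.holds_neg,
    Expr.holds_lt, not_lt, Expr.eval, hr.n, Net.Zone]

def sepE (X : List Expr) (r : Expr) (Y : List Expr) : Expr :=
  .neg (.cell 9 (Expr.code (X ++ [r] ++ Y)))

theorem holds_sepE (h : s.HasSep N W) {X Y : List Expr} {r : Expr} (hs : s.Powers (W + 1 + W))
    (hX : X.length = W) (hXv : ValidE s X) (hr : r.eval s < s.reg 1) (hY : Y.length = W)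
    (hYv : ValidE s Y) :
    (sepE X r Y).Holds s ↔ N.Sep (X.map (Expr.eval s)) (r.eval s) (Y.map (Expr.eval s)) := by
  rw [sepE, Expr.holds_neg, Expr.holds_cell_code hs (by simp [hX, hY]; omega), List.map_append,
    List.map_append, not_iff_comm]
  · exact (h _ _ _ (by simpa using hX) (by simpa using hY) hXv.map hr hYv.map).symm
  · exact validE_append.2 ⟨validE_append.2 ⟨hXv, validE_singleton.2 hr⟩, hYv⟩

/-- A violation of separation is an existential statement: an edge from a vertex of the zone to one
outside both zone and bag. Saturation can tabulate this, which is why the table holds the negation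
of `Sep`. -/
def sepCond (W : ℕ) : Expr :=
  .all [zoneE (blk 0 W) (var W) (var (W + 1 + W)),
    adjE (var (W + 1 + W)) (var (W + 1 + W + 1)),
    .neg (zoneE (blk 0 W) (var W) (var (W + 1 + W + 1))),
    .neg (.mem (var (W + 1 + W + 1)) (blk (W + 1) W))]

def sepStage (W : ℕ) : Cmd := .saturate 9 (W + 1 + W) (W + 1 + W + 2) (sepCond W)

theorem sepStage_spec (h : s.Ready N D) (hD : W + 2 ≤ D) (hD' : W + 1 + W ≤ D)
    (hl : s.HasLink N W) : ((sepStage W).exec s).HasSep N W := by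
  have hfr : s.Frame 9 ((sepStage W).exec s) := Cmd.saturate_frame s
  have hM : ((sepStage W).exec s).reg 1 = s.reg 1 := hfr.1 1 (by omega)
  obtain ⟨hclosed, hleast⟩ := Cmd.saturate_spec (T := 9) (D := W + 1 + W) (m := W + 1 + W + 2)
    (cond := sepCond W) (s₀ := s) h.one_lt (by omega) (by omega) (h.powers.mono (by omega))
    (fun _ ρ => N.Zone (seg ρ 0 W) (ρ W) (ρ (W + 1 + W)) ∧
      N.adj (ρ (W + 1 + W)) (ρ (W + 1 + W + 1)) ∧
      ¬ N.Zone (seg ρ 0 W) (ρ W) (ρ (W + 1 + W + 1)) ∧ ρ (W + 1 + W + 1) ∉ seg ρ (W + 1) W) (by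
      intro t ρ ht hρ hρM
      have hr := h.frame ht (by omega) (by omega)
      have hv : ∀ o < W + 1 + W + 2, (var o).eval t = ρ o := hρ
      have hlt : ∀ o < W + 1 + W + 2, (var o).eval t < t.reg 1 := fun o ho => by
        rw [hv o ho, ht.1 1 (by omega)]; exact hρM o ho
      have hz : ∀ o < W + 1 + W + 2, ((zoneE (blk 0 W) (var W) (var o)).Holds t ↔
          N.Zone (seg ρ 0 W) (ρ W) (ρ o)) := by
        intro o ho
        rw [holds_zoneE hr (hl.frame ht (by omega)) hD (length_blk 0 W)
          (validE_blk (m := W + 1 + W + 2) (fun j hj => hlt j hj) (by omega)) (hlt _ (by omega))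
          (hlt _ ho), map_eval_blk (o := 0) (len := W) hρ (by omega), hv W (by omega), hv o ho]
      simp only [sepCond, Expr.holds_all, List.forall_mem_cons,
        List.not_mem_nil, false_imp_iff, implies_true, and_true, Expr.holds_neg, Expr.holds_mem,
        holds_adjE hr (hlt (W + 1 + W) (by omega)) (hlt (W + 1 + W + 1) (by omega)),
        hz (W + 1 + W) (by omega), hz (W + 1 + W + 1) (by omega),
        map_eval_blk (o := W + 1) (len := W) hρ (by omega), hv (W + 1 + W) (by omega),
        hv (W + 1 + W + 1) (by omega)])
  intro X r Y hX hY hXM hr hYM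
  rw [hM] at hXM hr hYM
  constructor
  · intro htab
    refine hleast (fun l => ∀ X r Y, X.length = W → l = X ++ [r] ++ Y → ¬ N.Sep X r Y) ?_ _ htab
      X r Y hX rfl
    rintro A ρ - - ⟨h1, h2, h3, h4⟩ X r Y hX hl
    rw [map_range_eq_seg, seg_add, seg_add, seg_one, zero_add, zero_add] at hl
    obtain ⟨hl', rfl⟩ := List.append_inj hl (by simp [hX])
    obtain ⟨rfl, hl''⟩ := List.append_inj hl' (by simp [hX])
    obtain rfl : ρ W = r := by simpa using hl''
    exact fun hs => h4 (hs _ _ h1 h2 h3)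
  · intro hns
    simp only [Net.Sep, not_forall, exists_prop] at hns
    obtain ⟨u, z, h1, h2, h3, h4⟩ := hns
    have hun := N.lt _ _ h2
    have hzn := N.lt _ _ (N.symm _ _ h2)
    have hnM := h.n_lt
    have e0 : seg (entry (X ++ ([r] ++ (Y ++ [u, z])))) 0 W = X := seg_entry_append_left hX
    have e1 : entry (X ++ ([r] ++ (Y ++ [u, z]))) W = r := by
      rw [entry_append_right hX.le, hX, Nat.sub_self, entry_singleton_append]
    have e2 : seg (entry (X ++ ([r] ++ (Y ++ [u, z])))) (W + 1) W = Y := by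
      rw [seg_entry_append_right (by omega), hX, seg_entry_append_right (by simp),
        show W + 1 - W - [r].length = 0 by simp, seg_entry_append_left hY]
    have e3 : ∀ i, entry (X ++ ([r] ++ (Y ++ [u, z]))) (W + 1 + W + i) = entry [u, z] i := by
      intro i
      rw [entry_append_right (by omega), entry_append_right (by simp; omega),
        entry_append_right (by simp; omega), List.length_singleton, hX, hY]
      congr 1
      omega
    have := hclosed (entry (X ++ ([r] ++ (Y ++ [u, z])))) (fun i _ => entry_lt (by omega) (by
      intro x hx
      simp only [List.mem_append, List.mem_cons, List.not_mem_nil, or_false] at hx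
      rcases hx with hx | rfl | hx | rfl | rfl
      exacts [hXM _ hx, hr, hYM _ hx, by omega, by omega]) i)
      (by rw [e0, e1, e2, show entry _ (W + 1 + W) = u from e3 0,
        show entry _ (W + 1 + W + 1) = z from e3 1]; exact ⟨h1, h2, h3, h4⟩)
    rw [map_range_eq_seg, seg_add, seg_add, seg_one, zero_add, zero_add, e0, e1, e2] at this
    exact this

end

/-! ### The table of facts -/

def Expr.imp (a b : Expr) : Expr := .disj (.neg a) b

@[simp] theorem Expr.holds_imp {s : State} {a b : Expr} :
    (a.imp b).Holds s ↔ (a.Holds s → b.Holds s) := by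
  simp [Expr.imp, imp_iff_not_or]

/-- The tuples of a set as facts. -/
def tableOf (A : List ℕ → Prop) (W K : ℕ) : Net.Table := fun X r Y col j vec =>
  X.length = W ∧ Y.length = W ∧ col.length = W ∧ vec.length = K ∧
    A (X ++ [r] ++ Y ++ col ++ [j] ++ vec)

/-- The rules, with explicit premises. -/
def Net.RuleAt (N : Net) (T : Net.Table) (X : List ℕ) (r : ℕ) (Y col : List ℕ) (j : ℕ)
    (vec : List ℕ) (j' : ℕ) (v₁ Z col' v₂ : List ℕ) : Prop :=
  (j = 0 ∧ (∀ i < N.K, vec.getD i 0 = 0) ∧ N.Sep X r Y ∧ N.ColOK Y col) ∨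
  (j = j' + 1 ∧ j' < N.n ∧ T X r Y col j' v₁ ∧
    (((¬ N.Zone X r j' ∨ N.Old Y j') ∧ ∀ i < N.K, vec.getD i 0 = v₁.getD i 0) ∨
    (N.Zone X r j' ∧ ∃ p ∈ Y.zip col, p.1 = j' ∧
      ∀ i < N.K, vec.getD i 0 = v₁.getD i 0 + N.wt i j' p.2) ∨
    (N.Zone X r j' ∧ j' ∉ Y ∧ ¬ N.Old Y j' ∧ T Y j' Z col' N.n v₂ ∧
      N.Compat Y col Z col' ∧ ∀ i < N.K, vec.getD i 0 = v₁.getD i 0 + v₂.getD i 0)))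

theorem Net.RuleAt.rule {N : Net} {T : Net.Table} {X Y col vec v₁ Z col' v₂ : List ℕ} {r j j' : ℕ}
    (h : N.RuleAt T X r Y col j vec j' v₁ Z col' v₂) : N.Rule T X r Y col j vec := by
  rcases h with h | ⟨h1, h2, h3, h4⟩
  · exact .inl h
  · refine .inr ⟨j', v₁, h1, h2, h3, ?_⟩
    rcases h4 with h | h | ⟨h5, h6, h7, h8⟩
    · exact .inl h
    · exact .inr (.inl h)
    · exact .inr (.inr ⟨h5, h6, h7, Z, col', v₂, h8⟩)

section

variable {N : Net} {D W T : ℕ} {s s' : State}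

def factE (X : List Expr) (r : Expr) (Y col : List Expr) (j : Expr) (vec : List Expr) : Expr :=
  .cell 10 (Expr.code (X ++ [r] ++ Y ++ col ++ [j] ++ vec))

theorem holds_factE {K : ℕ} (hs : s.Powers (W + 1 + W + W + 1 + K)) {X Y col vec : List Expr}
    {r j : Expr} (hX : X.length = W) (hY : Y.length = W) (hcol : col.length = W)
    (hvec : vec.length = K) (hXv : ValidE s X) (hrv : r.eval s < s.reg 1) (hYv : ValidE s Y)
    (hcolv : ValidE s col) (hjv : j.eval s < s.reg 1) (hvecv : ValidE s vec) :
    (factE X r Y col j vec).Holds s ↔ tableOf (s.Tab 10 (W + 1 + W + W + 1 + K)) W K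
      (X.map (Expr.eval s)) (r.eval s) (Y.map (Expr.eval s)) (col.map (Expr.eval s)) (j.eval s)
      (vec.map (Expr.eval s)) := by
  rw [factE, Expr.holds_cell_code hs (by simp [hX, hY, hcol, hvec]; omega)]
  · simp [tableOf, hX, hY, hcol, hvec]
  · simp only [← ValidE.eq_1, validE_append, validE_singleton]
    exact ⟨⟨⟨⟨⟨hXv, hrv⟩, hYv⟩, hcolv⟩, hjv⟩, hvecv⟩

def colOKE (k : ℕ) (Y col : List Expr) : Expr :=
  .conj
    (.all ((Y.zip col).map fun p => .conj (.lt p.2 (.const k)) (.imp (.lt p.1 (.reg 2))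
      (.disj (.eq (.cell 5 p.1) (.const 0)) (.eq (.cell 5 p.1) (.add p.2 (.const 1)))))))
    (.all ((Y.zip col).map fun p => .all ((Y.zip col).map fun q =>
      .conj (.imp (.eq p.1 q.1) (.imp (.lt p.1 (.reg 2)) (.eq p.2 q.2)))
        (.imp (adjE p.1 q.1) (.neg (.eq p.2 q.2))))))

theorem holds_colOKE (h : s.Ready N D) {Y col : List Expr} (hY : ValidE s Y) :
    (colOKE N.k Y col).Holds s ↔ N.ColOK (Y.map (Expr.eval s)) (col.map (Expr.eval s)) := by
  have hmem : ∀ p ∈ Y.zip col, p.1.eval s < s.reg 1 := fun p hp => hY _ (List.of_mem_zip hp).1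
  simp only [colOKE, Net.ColOK, List.zip_map, List.forall_mem_map, Expr.holds_conj, Expr.holds_all,
    Expr.holds_imp, Expr.holds_lt, Expr.holds_disj, Expr.holds_eq, Expr.holds_neg, Prod.map_fst,
    Prod.map_snd]
  refine and_congr (forall₂_congr fun p hp => and_congr Iff.rfl ?_) (forall₂_congr fun p hp =>
    forall₂_congr fun q hq => and_congr ?_ ?_)
  · rw [show (Expr.reg 2).eval s = N.n from h.n]
    exact forall_congr' fun hn => (h.ok _ _ hn).symm
  · rw [show (Expr.reg 2).eval s = N.n from h.n]
  · rw [holds_adjE h (hmem p hp) (hmem q hq)]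

def compatE (Y col Z col' : List Expr) : Expr :=
  .all ((Y.zip col).map fun p => .all ((Z.zip col').map fun q =>
    .imp (.eq p.1 q.1) (.imp (.lt p.1 (.reg 2)) (.eq p.2 q.2))))

theorem holds_compatE (h : s.Ready N D) {Y col Z col' : List Expr} :
    (compatE Y col Z col').Holds s ↔ N.Compat (Y.map (Expr.eval s)) (col.map (Expr.eval s))
      (Z.map (Expr.eval s)) (col'.map (Expr.eval s)) := by
  simp only [compatE, Net.Compat, List.zip_map, List.forall_mem_map, Expr.holds_all,
    Expr.holds_imp, Expr.holds_lt, Expr.holds_eq, Prod.map_fst, Prod.map_snd, Expr.eval, h.n]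

def wtE (k i : ℕ) (v v₁ j c : Expr) : Expr :=
  -- This distinction is made when the program is written, as `i` and `k` are constants. Only the
  -- colour is tested at run time.
  if i < k then
    .conj (.imp (.eq c (.const i)) (.eq v (.add v₁ (.cell 4 j))))
      (.disj (.eq c (.const i)) (.eq v v₁))
  else
    .conj (.imp (.eq (.add c (.const k)) (.const i)) (.eq v (.add v₁ (.cell 3 j))))
      (.disj (.eq (.add c (.const k)) (.const i)) (.eq v v₁))

theorem holds_wtE (h : s.Ready N D) {i : ℕ} {v v₁ j c : Expr} (hj : j.eval s < N.n) :
    (wtE N.k i v v₁ j c).Holds s ↔ v.eval s = v₁.eval s + N.wt i (j.eval s) (c.eval s) := by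
  rw [h.wt _ _ _ hj, wtE]
  split_ifs with h1 h2 h2 <;> simp [Expr.eval, h2]

/-- The condition of the rules: the variables are the entries of the derived fact, followed by those
of its premises. -/
def factCond (W k : ℕ) : Expr :=
  let K := k + k
  let D := W + 1 + W + W + 1 + K
  let X := blk 0 W
  let r := var W
  let Y := blk (W + 1) W
  let col := blk (W + 1 + W) W
  let j := var (W + 1 + W + W)
  let v := fun i => var (W + 1 + W + W + 1 + i)
  let j' := var D
  let v₁ := fun i => var (D + 1 + i)
  let v₂ := fun i => var (D + 1 + K + W + W + i)
  .disj
    (.all [.eq j (.const 0), .all ((List.range K).map fun i => .eq (v i) (.const 0)),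
      sepE X r Y, colOKE k Y col])
    (.all [.eq j (.add j' (.const 1)), .lt j' (.reg 2), factE X r Y col j' (blk (D + 1) K),
      .any [
        .conj (.disj (.neg (zoneE X r j')) (oldE Y j'))
          (.all ((List.range K).map fun i => .eq (v i) (v₁ i))),
        .conj (zoneE X r j') (.any ((Y.zip col).map fun p => .conj (.eq p.1 j')
          (.all ((List.range K).map fun i => wtE k i (v i) (v₁ i) j' p.2)))),
        .all [zoneE X r j', .neg (.mem j' Y), .neg (oldE Y j'),
          factE Y j' (blk (D + 1 + K) W) (blk (D + 1 + K + W) W) (.reg 2)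
            (blk (D + 1 + K + W + W) K),
          compatE Y col (blk (D + 1 + K) W) (blk (D + 1 + K + W) W),
          .all ((List.range K).map fun i => .eq (v i) (.add (v₁ i) (v₂ i)))]]])

/-- Each clause of the condition is matched with one of `RuleAt`. Only the clause on the weight of a
bag vertex needs a premise, `ρ FD < N.n`, because `Ready` describes weights and arrays only on
vertices. -/
theorem holds_factCond {K : ℕ} (hK : K = N.k + N.k) {FD m : ℕ} (hFD : FD = W + 1 + W + W + 1 + K)
    (hm : m = FD + 1 + K + W + W + K) (h : s.Ready N D) (hD : FD ≤ D) (hD' : W + 2 ≤ D)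
    (hl : s.HasLink N W) (ho : s.HasOld N W) (hsep : s.HasSep N W) {ρ : ℕ → ℕ}
    (hρ : ∀ j < m, s.reg (20 + j) = ρ j) (hρM : ∀ j < m, ρ j < s.reg 1) :
    (factCond W N.k).Holds s ↔ N.RuleAt (tableOf (s.Tab 10 FD) W K)
      (seg ρ 0 W) (ρ W) (seg ρ (W + 1) W) (seg ρ (W + 1 + W) W) (ρ (W + 1 + W + W))
      (seg ρ (W + 1 + W + W + 1) K) (ρ FD) (seg ρ (FD + 1) K) (seg ρ (FD + 1 + K) W)
      (seg ρ (FD + 1 + K + W) W) (seg ρ (FD + 1 + K + W + W) K) := by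
  have hv : ∀ o < m, (var o).eval s = ρ o := hρ
  have hlt : ∀ o < m, (var o).eval s < s.reg 1 := fun o ho => by rw [hv o ho]; exact hρM o ho
  have hb : ∀ o len, o + len ≤ m → (blk o len).map (Expr.eval s) = seg ρ o len :=
    fun o len ho => map_eval_blk hρ ho
  have hvalid : ∀ o len, o + len ≤ m → ValidE s (blk o len) :=
    fun o len ho => validE_blk (m := m) (fun j hj => hlt j hj) ho
  have hzone : (zoneE (blk 0 W) (var W) (var FD)).Holds s ↔ N.Zone (seg ρ 0 W) (ρ W) (ρ FD) := by
    rw [holds_zoneE h hl hD' (length_blk _ _) (hvalid _ _ (by omega)) (hlt _ (by omega))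
      (hlt _ (by omega)), hb _ _ (by omega), hv _ (by omega), hv _ (by omega)]
  have hold : (oldE (blk (W + 1) W) (var FD)).Holds s ↔ N.Old (seg ρ (W + 1) W) (ρ FD) := by
    rw [holds_oldE ho (h.powers.mono (by omega)) (length_blk _ _) (hvalid _ _ (by omega))
      (hlt _ (by omega)), hb _ _ (by omega), hv _ (by omega)]
  have hsp : (sepE (blk 0 W) (var W) (blk (W + 1) W)).Holds s ↔
      N.Sep (seg ρ 0 W) (ρ W) (seg ρ (W + 1) W) := by
    rw [holds_sepE hsep (h.powers.mono (by omega)) (length_blk _ _) (hvalid _ _ (by omega))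
      (hlt _ (by omega)) (length_blk _ _) (hvalid _ _ (by omega)), hb _ _ (by omega),
      hb _ _ (by omega), hv _ (by omega)]
  have hcol : (colOKE N.k (blk (W + 1) W) (blk (W + 1 + W) W)).Holds s ↔
      N.ColOK (seg ρ (W + 1) W) (seg ρ (W + 1 + W) W) := by
    rw [holds_colOKE h (hvalid _ _ (by omega)), hb _ _ (by omega), hb _ _ (by omega)]
  have hcomp : (compatE (blk (W + 1) W) (blk (W + 1 + W) W) (blk (FD + 1 + K) W)
      (blk (FD + 1 + K + W) W)).Holds s ↔ N.Compat (seg ρ (W + 1) W) (seg ρ (W + 1 + W) W)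
        (seg ρ (FD + 1 + K) W) (seg ρ (FD + 1 + K + W) W) := by
    rw [holds_compatE h, hb _ _ (by omega), hb _ _ (by omega), hb _ _ (by omega),
      hb _ _ (by omega)]
  have hf1 : (factE (blk 0 W) (var W) (blk (W + 1) W) (blk (W + 1 + W) W) (var FD)
      (blk (FD + 1) K)).Holds s ↔ tableOf (s.Tab 10 FD) W K (seg ρ 0 W) (ρ W) (seg ρ (W + 1) W)
        (seg ρ (W + 1 + W) W) (ρ FD) (seg ρ (FD + 1) K) := by
    rw [holds_factE (W := W) (K := K) (h.powers.mono (by omega)) (length_blk _ _) (length_blk _ _)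
      (length_blk _ _) (length_blk _ _) (hvalid _ _ (by omega)) (hlt _ (by omega))
      (hvalid _ _ (by omega)) (hvalid _ _ (by omega)) (hlt _ (by omega)) (hvalid _ _ (by omega)),
      ← hFD, hb _ _ (by omega), hb _ _ (by omega), hb _ _ (by omega), hb _ _ (by omega),
      hv _ (by omega), hv _ (by omega)]
  have hf2 : (factE (blk (W + 1) W) (var FD) (blk (FD + 1 + K) W) (blk (FD + 1 + K + W) W) (.reg 2)
      (blk (FD + 1 + K + W + W) K)).Holds s ↔ tableOf (s.Tab 10 FD) W K (seg ρ (W + 1) W) (ρ FD)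
        (seg ρ (FD + 1 + K) W) (seg ρ (FD + 1 + K + W) W) N.n (seg ρ (FD + 1 + K + W + W) K) := by
    rw [holds_factE (W := W) (K := K) (h.powers.mono (by omega)) (length_blk _ _) (length_blk _ _)
      (length_blk _ _) (length_blk _ _) (hvalid _ _ (by omega)) (hlt _ (by omega))
      (hvalid _ _ (by omega)) (hvalid _ _ (by omega)) (by rw [Expr.eval, h.n]; exact h.n_lt)
      (hvalid _ _ (by omega)),
      ← hFD, hb _ _ (by omega), hb _ _ (by omega), hb _ _ (by omega), hb _ _ (by omega),
      hv _ (by omega), Expr.eval, h.n]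
  have hvec : ∀ {p : ℕ → Expr} {q : ℕ → Prop}, (∀ i < K, (p i).Holds s ↔ q i) →
      ((∀ e ∈ (List.range K).map p, e.Holds s) ↔ ∀ i < K, q i) := by
    intro p q hpq
    simp only [List.forall_mem_map, List.mem_range]
    exact forall₂_congr hpq
  have hown : ρ FD < N.n → ((∃ e ∈ ((blk (W + 1) W).zip (blk (W + 1 + W) W)).map (fun p =>
      Expr.conj (.eq p.1 (var FD)) (.all ((List.range K).map fun i =>
        wtE N.k i (var (W + 1 + W + W + 1 + i)) (var (FD + 1 + i)) (var FD) p.2))), e.Holds s) ↔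
      ∃ p ∈ (seg ρ (W + 1) W).zip (seg ρ (W + 1 + W) W), p.1 = ρ FD ∧
        ∀ i < K, (seg ρ (W + 1 + W + W + 1) K).getD i 0 =
          (seg ρ (FD + 1) K).getD i 0 + N.wt i (ρ FD) p.2) := by
    intro hn
    rw [← hb (W + 1) W (by omega), ← hb (W + 1 + W) W (by omega), List.zip_map]
    simp only [List.mem_map, exists_exists_and_eq_and, Expr.holds_conj, Expr.holds_eq, Expr.holds_all, Prod.map_fst,
      Prod.map_snd]
    refine exists_congr fun p => and_congr_right fun _ => and_congr (by rw [hv _ (by omega)]) ?_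
    rw [← hvec (p := fun i => wtE N.k i (var (W + 1 + W + W + 1 + i)) (var (FD + 1 + i)) (var FD) p.2)
      fun i hi => ?_]
    · simp
    · rw [holds_wtE h (by rwa [hv _ (by omega)]), hv _ (by omega), hv _ (by omega), hv _ (by omega),
        getD_seg hi, getD_seg hi]
  have hbase : (∀ e ∈ (List.range K).map (fun i =>
      Expr.eq (var (W + 1 + W + W + 1 + i)) (.const 0)), e.Holds s) ↔
      ∀ i < K, (seg ρ (W + 1 + W + W + 1) K).getD i 0 = 0 := hvec fun i hi => by
    rw [Expr.holds_eq, hv _ (by omega), getD_seg hi, Expr.eval]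
  have hskip : (∀ e ∈ (List.range K).map (fun i =>
      Expr.eq (var (W + 1 + W + W + 1 + i)) (var (FD + 1 + i))), e.Holds s) ↔
      ∀ i < K, (seg ρ (W + 1 + W + W + 1) K).getD i 0 = (seg ρ (FD + 1) K).getD i 0 :=
    hvec fun i hi => by
      rw [Expr.holds_eq, hv _ (by omega), hv _ (by omega), getD_seg hi, getD_seg hi]
  have hsub : (∀ e ∈ (List.range K).map (fun i => Expr.eq (var (W + 1 + W + W + 1 + i))
      (.add (var (FD + 1 + i)) (var (FD + 1 + K + W + W + i)))), e.Holds s) ↔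
      ∀ i < K, (seg ρ (W + 1 + W + W + 1) K).getD i 0 =
        (seg ρ (FD + 1) K).getD i 0 + (seg ρ (FD + 1 + K + W + W) K).getD i 0 :=
    hvec fun i hi => by
      rw [Expr.holds_eq, Expr.eval, hv _ (by omega), hv _ (by omega), hv _ (by omega), getD_seg hi,
        getD_seg hi, getD_seg hi]
  have hKN : N.K = K := h.K.trans hK.symm
  simp only [factCond, Net.RuleAt, hKN]
  rw [← hK, ← hFD]
  rw [Expr.holds_disj]
  simp only [Expr.holds_all, List.forall_mem_cons, List.not_mem_nil, false_imp_iff, implies_true,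
    and_true, Expr.holds_any, List.exists_mem_cons_iff, false_and, exists_false, or_false,
    Expr.holds_conj, Expr.holds_disj, Expr.holds_neg, Expr.holds_eq, Expr.holds_lt, Expr.holds_mem,
    hzone, hold, hsp, hcol, hcomp, hf1, hf2, hbase, hskip, hsub]
  rw [hb _ _ (by omega)]
  simp only [Expr.eval, h.n, hv _ (show W + 1 + W + W < m by omega), hv _ (show FD < m by omega)]
  refine or_congr Iff.rfl (and_congr_right fun _ => and_congr_right fun hn => and_congr_right
    fun _ => or_congr Iff.rfl (or_congr (and_congr_right fun _ => ?_) Iff.rfl))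
  exact hown hn

/-- The stage that computes all facts. -/
def factStage (W k : ℕ) : Cmd :=
  .saturate 10 (W + 1 + W + W + 1 + (k + k))
    (W + 1 + W + W + 1 + (k + k) + 1 + (k + k) + W + W + (k + k)) (factCond W k)

theorem seg_entry_of_eq {L A B C : List ℕ} {o len : ℕ} (hL : L = A ++ (B ++ C))
    (hA : A.length = o) (hB : B.length = len) : seg (entry L) o len = B := by
  rw [hL, seg_entry_append_right hA.le, hA, Nat.sub_self, seg_entry_append_left hB]

theorem entry_of_eq {L A C : List ℕ} {x o : ℕ} (hL : L = A ++ ([x] ++ C)) (hA : A.length = o) :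
    entry L o = x := by
  have := seg_entry_of_eq (len := 1) hL hA rfl
  rw [seg_one] at this
  simpa using this

/-- In the program all premises are variables, which need values below `M` in every case of the
rule. Entries of facts in the table have them, and unused premises are filled with zeros. -/
theorem Net.Rule.exists_ruleAt {A : List ℕ → Prop} {M K : ℕ} (hM : 0 < M)
    (hA : ∀ l, A l → ∀ x ∈ l, x < M) {X Y col vec : List ℕ} {r j : ℕ}
    (h : N.Rule (tableOf A W K) X r Y col j vec) :
    ∃ j' v₁ Z col' v₂, j' < M ∧ v₁.length = K ∧ Z.length = W ∧ col'.length = W ∧ v₂.length = K ∧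
      (∀ x ∈ v₁ ++ Z ++ col' ++ v₂, x < M) ∧
      N.RuleAt (tableOf A W K) X r Y col j vec j' v₁ Z col' v₂ := by
  have hrep : ∀ n, ∀ x ∈ List.replicate n 0, x < M := fun n x hx => by
    rw [List.eq_of_mem_replicate hx]; exact hM
  rcases h with h | ⟨j', v₁, h1, h2, h3, h4⟩
  · refine ⟨0, .replicate K 0, .replicate W 0, .replicate W 0, .replicate K 0, hM, by simp, by simp,
      by simp, by simp, ?_, .inl h⟩
    simp only [List.mem_append]
    rintro x (((hx | hx) | hx) | hx) <;> exact hrep _ x hx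
  · have hj' : j' < M := hA _ h3.2.2.2.2 _ (by simp)
    have hv₁ : ∀ x ∈ v₁, x < M := fun x hx => hA _ h3.2.2.2.2 _ (by simp [hx])
    rcases h4 with h4 | h4 | ⟨h5, h6, h7, Z, col', v₂, h8, h9⟩
    · refine ⟨j', v₁, .replicate W 0, .replicate W 0, .replicate K 0, hj', h3.2.2.2.1, by simp,
        by simp, by simp, ?_, .inr ⟨h1, h2, h3, .inl h4⟩⟩
      simp only [List.mem_append]
      rintro x (((hx | hx) | hx) | hx)
      exacts [hv₁ x hx, hrep _ x hx, hrep _ x hx, hrep _ x hx]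
    · refine ⟨j', v₁, .replicate W 0, .replicate W 0, .replicate K 0, hj', h3.2.2.2.1, by simp,
        by simp, by simp, ?_, .inr ⟨h1, h2, h3, .inr (.inl h4)⟩⟩
      simp only [List.mem_append]
      rintro x (((hx | hx) | hx) | hx)
      exacts [hv₁ x hx, hrep _ x hx, hrep _ x hx, hrep _ x hx]
    · have h10 := hA _ h8.2.2.2.2
      refine ⟨j', v₁, Z, col', v₂, hj', h3.2.2.2.1, h8.2.1, h8.2.2.1, h8.2.2.2.1, ?_,
        .inr ⟨h1, h2, h3, .inr (.inr ⟨h5, h6, h7, h8, h9⟩)⟩⟩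
      simp only [List.mem_append]
      rintro x (((hx | hx) | hx) | hx)
      · exact hv₁ x hx
      all_goals exact h10 x (by simp [hx])

/-- Completeness of the table is closedness, read off for the valuation that lists a fact and its
premises. Soundness is leastness, applied to the facts that satisfy `Sem`, which `Net.Sem.of_rule`
shows to be closed. -/
theorem factStage_spec {K FD : ℕ} (hK : K = N.k + N.k) (hFD : FD = W + 1 + W + W + 1 + K)
    (h : s.Ready N D) (hD : FD ≤ D) (hD' : W + 2 ≤ D)
    (hl : s.HasLink N W) (ho : s.HasOld N W) (hsep : s.HasSep N W) :
    N.Closed W (s.reg 1) (tableOf (((factStage W N.k).exec s).Tab 10 FD) W K) ∧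
    ∀ X r Y col j vec, tableOf (((factStage W N.k).exec s).Tab 10 FD) W K X r Y col j vec →
      N.Sem X r Y col j vec := by
  have hKN : N.K = K := h.K.trans hK.symm
  obtain ⟨m, hm⟩ : ∃ m, m = FD + 1 + K + W + W + K := ⟨_, rfl⟩
  have hfr : s.Frame 10 ((factStage W N.k).exec s) := Cmd.saturate_frame s
  have hM : ((factStage W N.k).exec s).reg 1 = s.reg 1 := hfr.1 1 (by omega)
  have hstage : factStage W N.k = .saturate 10 FD m (factCond W N.k) := by
    rw [factStage, ← hK, ← hFD, ← hm]
  have hspec := Cmd.saturate_spec (T := 10) (D := FD) (m := m)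
    (cond := factCond W N.k) (s₀ := s) h.one_lt (by omega) (by omega) (h.powers.mono hD)
    (fun A ρ => N.RuleAt (tableOf A W K)
      (seg ρ 0 W) (ρ W) (seg ρ (W + 1) W) (seg ρ (W + 1 + W) W) (ρ (W + 1 + W + W))
      (seg ρ (W + 1 + W + W + 1) K) (ρ FD) (seg ρ (FD + 1) K) (seg ρ (FD + 1 + K) W)
      (seg ρ (FD + 1 + K + W) W) (seg ρ (FD + 1 + K + W + W) K))
    (fun t ρ ht hρ hρM => holds_factCond hK hFD hm (h.frame ht (by omega) (by omega)) hD hD'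
      (hl.frame ht (by omega)) (ho.frame ht (by omega)) (hsep.frame ht (by omega)) hρ
      (by rwa [ht.1 1 (by omega)]))
  rw [← hstage] at hspec
  obtain ⟨hclosed, hleast⟩ := hspec
  set s' := (factStage W N.k).exec s
  have hseg : ∀ ρ : ℕ → ℕ, (List.range FD).map ρ = seg ρ 0 W ++ [ρ W] ++ seg ρ (W + 1) W ++
      seg ρ (W + 1 + W) W ++ [ρ (W + 1 + W + W)] ++ seg ρ (W + 1 + W + W + 1) K := by
    intro ρ
    rw [map_range_eq_seg, hFD, seg_add, seg_add, seg_add, seg_add, seg_add, seg_one, seg_one]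
    simp only [zero_add]
  constructor
  · intro X r Y col j vec hX hY hcol hvec hXM hr hYM hcolM hj hvecM hrule
    rw [hKN] at hvec
    obtain ⟨j', v₁, Z, col', v₂, hj', hv₁, hZ, hcol', hv₂, hM', hat⟩ :=
      hrule.exists_ruleAt (M := s.reg 1) (by have := h.one_lt; omega)
        (fun l hl => by rw [← hM]; exact hl.2.1)
    -- The entries of `L` are the values of the variables, in the order that `factCond` uses.
    set L := X ++ [r] ++ Y ++ col ++ [j] ++ vec ++ [j'] ++ v₁ ++ Z ++ col' ++ v₂ with hL
    have hLM : ∀ x ∈ L, x < s.reg 1 := by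
      intro x hx
      simp only [hL, List.mem_append, List.mem_singleton] at hx hM'
      rcases hx with (((((((((hx | rfl) | hx) | hx) | rfl) | hx) | rfl) | hx) | hx) | hx) | hx
      exacts [hXM x hx, hr, hYM x hx, hcolM x hx, hj, hvecM x hx, hj',
        hM' x (.inl (.inl (.inl hx))), hM' x (.inl (.inl (.inr hx))), hM' x (.inl (.inr hx)),
        hM' x (.inr hx)]
    have := hclosed (entry L) (fun i _ => entry_lt (by have := h.one_lt; omega) hLM i)
    have e1 : seg (entry L) 0 W = X := seg_entry_of_eq (A := [])
      (C := [r] ++ Y ++ col ++ [j] ++ vec ++ [j'] ++ v₁ ++ Z ++ col' ++ v₂) (by simp [hL]) rfl hX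
    have e2 : entry L W = r := entry_of_eq (A := X)
      (C := Y ++ col ++ [j] ++ vec ++ [j'] ++ v₁ ++ Z ++ col' ++ v₂) (by simp [hL]) hX
    have e3 : seg (entry L) (W + 1) W = Y := seg_entry_of_eq (A := X ++ [r])
      (C := col ++ [j] ++ vec ++ [j'] ++ v₁ ++ Z ++ col' ++ v₂) (by simp [hL]) (by simp [hX]) hY
    have e4 : seg (entry L) (W + 1 + W) W = col := seg_entry_of_eq (A := X ++ [r] ++ Y)
      (C := [j] ++ vec ++ [j'] ++ v₁ ++ Z ++ col' ++ v₂) (by simp [hL])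
      (by simp [hX, hY]; omega) hcol
    have e5 : entry L (W + 1 + W + W) = j := entry_of_eq (A := X ++ [r] ++ Y ++ col)
      (C := vec ++ [j'] ++ v₁ ++ Z ++ col' ++ v₂) (by simp [hL]) (by simp [hX, hY, hcol]; omega)
    have e6 : seg (entry L) (W + 1 + W + W + 1) K = vec := seg_entry_of_eq
      (A := X ++ [r] ++ Y ++ col ++ [j]) (C := [j'] ++ v₁ ++ Z ++ col' ++ v₂) (by simp [hL])
      (by simp [hX, hY, hcol]; omega) hvec
    have e7 : entry L FD = j' := entry_of_eq (A := X ++ [r] ++ Y ++ col ++ [j] ++ vec)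
      (C := v₁ ++ Z ++ col' ++ v₂) (by simp [hL]) (by simp [hX, hY, hcol, hvec]; omega)
    have e8 : seg (entry L) (FD + 1) K = v₁ := seg_entry_of_eq
      (A := X ++ [r] ++ Y ++ col ++ [j] ++ vec ++ [j']) (C := Z ++ col' ++ v₂) (by simp [hL])
      (by simp [hX, hY, hcol, hvec]; omega) hv₁
    have e9 : seg (entry L) (FD + 1 + K) W = Z := seg_entry_of_eq
      (A := X ++ [r] ++ Y ++ col ++ [j] ++ vec ++ [j'] ++ v₁) (C := col' ++ v₂) (by simp [hL])
      (by simp [hX, hY, hcol, hvec, hv₁]; omega) hZ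
    have e10 : seg (entry L) (FD + 1 + K + W) W = col' := seg_entry_of_eq
      (A := X ++ [r] ++ Y ++ col ++ [j] ++ vec ++ [j'] ++ v₁ ++ Z) (C := v₂) (by simp [hL])
      (by simp [hX, hY, hcol, hvec, hv₁, hZ]; omega) hcol'
    have e11 : seg (entry L) (FD + 1 + K + W + W) K = v₂ := seg_entry_of_eq
      (A := X ++ [r] ++ Y ++ col ++ [j] ++ vec ++ [j'] ++ v₁ ++ Z ++ col') (C := []) (by simp [hL])
      (by simp [hX, hY, hcol, hvec, hv₁, hZ, hcol']; omega) hv₂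
    rw [hseg, e1, e2, e3, e4, e5, e6, e7, e8, e9, e10, e11] at this
    exact ⟨hX, hY, hcol, hvec, this hat⟩
  · rintro X r Y col j vec ⟨hX, hY, hcol, hvec, htab⟩
    refine hleast (fun l => ∀ X r Y col j vec, X.length = W → Y.length = W → col.length = W →
      vec.length = K → l = X ++ [r] ++ Y ++ col ++ [j] ++ vec → N.Sem X r Y col j vec) ?_ _ htab
      X r Y col j vec hX hY hcol hvec rfl
    intro A ρ hA _ hφ X r Y col j vec hX hY hcol hvec heq
    rw [hseg] at heq
    obtain ⟨heq1, rfl⟩ := List.append_inj heq (by simp [hX, hY, hcol])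
    obtain ⟨heq2, hj⟩ := List.append_inj heq1 (by simp [hX, hY, hcol])
    obtain ⟨heq3, rfl⟩ := List.append_inj heq2 (by simp [hX, hY])
    obtain ⟨heq4, rfl⟩ := List.append_inj heq3 (by simp [hX])
    obtain ⟨rfl, hr⟩ := List.append_inj heq4 (by simp [hX])
    obtain rfl : ρ W = r := by simpa using hr
    obtain rfl : ρ (W + 1 + W + W) = j := by simpa using hj
    exact Net.Sem.of_rule (by simp) (fun X r Y col j vec hT =>
      hA _ hT.2.2.2.2 X r Y col j vec hT.1 hT.2.1 hT.2.2.1 hT.2.2.2.1 rfl) hφ.rule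

/-! ### Acceptance -/

def acceptCond (W k : ℕ) : Expr :=
  .conj (factE (blk 0 W) (.reg 2) (blk W W) (blk (W + W) W) (.reg 2) (blk (W + W + W) (k + k)))
    (.all ((List.range k).map fun i => .conj (.neg (.lt (.reg 4) (var (W + W + W + i))))
      (.neg (.lt (var (W + W + W + (k + i))) (.reg 3)))))

/-- Saturation with tuples of length `0` is an existential test: cell `0`, the code of the empty
tuple, is set if some valuation satisfies the condition. -/
def acceptStage (W k : ℕ) : Cmd := .saturate 6 0 (W + W + W + (k + k)) (acceptCond W k)

theorem acceptStage_spec {K FD : ℕ} (hK : K = N.k + N.k) (hFD : FD = W + 1 + W + W + 1 + K)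
    (h : s.Ready N D) (hD : FD ≤ D) :
    ((acceptStage W N.k).exec s).arr 6 0 ≠ 0 ↔ ∃ X Y col vec,
      tableOf (s.Tab 10 FD) W K X N.n Y col N.n vec ∧
      ∀ i < N.k, vec.getD i 0 ≤ s.reg 4 ∧ s.reg 3 ≤ vec.getD (N.k + i) 0 := by
  have hspec := Cmd.saturate_spec (T := 6) (D := 0) (m := W + W + W + (N.k + N.k))
    (cond := acceptCond W N.k) (s₀ := s) h.one_lt (by omega) (by omega) (h.powers.mono (by omega))
    (fun _ ρ => tableOf (s.Tab 10 FD) W K (seg ρ 0 W) N.n (seg ρ W W) (seg ρ (W + W) W) N.n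
      (seg ρ (W + W + W) K) ∧ ∀ i < N.k, (seg ρ (W + W + W) K).getD i 0 ≤ s.reg 4 ∧
        s.reg 3 ≤ (seg ρ (W + W + W) K).getD (N.k + i) 0)
    (by
      rw [← hK]
      intro t ρ ht hρ hρM
      have hr := h.frame ht (by omega) (by omega)
      have hv : ∀ o < W + W + W + K, (var o).eval t = ρ o := hρ
      have hlt : ∀ o < W + W + W + K, (var o).eval t < t.reg 1 := fun o ho => by
        rw [hv o ho, ht.1 1 (by omega)]; exact hρM o ho
      have hb : ∀ o len, o + len ≤ W + W + W + K → (blk o len).map (Expr.eval t) = seg ρ o len :=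
        fun o len ho => map_eval_blk hρ ho
      have hvalid : ∀ o len, o + len ≤ W + W + W + K → ValidE t (blk o len) :=
        fun o len ho => validE_blk (m := W + W + W + K) (fun j hj => hlt j hj) ho
      have hn : (Expr.reg 2).eval t = N.n := hr.n
      have hnM : (Expr.reg 2).eval t < t.reg 1 := by rw [hn]; exact hr.n_lt
      rw [acceptCond, ← hK, Expr.holds_conj, holds_factE (W := W) (K := K) (hr.powers.mono (by omega))
        (length_blk _ _) (length_blk _ _) (length_blk _ _) (length_blk _ _)
        (hvalid _ _ (by omega)) hnM (hvalid _ _ (by omega)) (hvalid _ _ (by omega)) hnM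
        (hvalid _ _ (by omega)), ← hFD, hb _ _ (by omega), hb _ _ (by omega), hb _ _ (by omega),
        hb _ _ (by omega), hn, ht.tab (by omega)]
      refine and_congr_right fun _ => ?_
      simp only [Expr.holds_all, List.forall_mem_map, List.mem_range, Expr.holds_conj,
        Expr.holds_neg, Expr.holds_lt, not_lt]
      refine forall₂_congr fun i hi => ?_
      rw [hv _ (by omega), hv _ (by omega), getD_seg (by omega), getD_seg (by omega),
        show (Expr.reg 4).eval t = s.reg 4 from ht.1 4 (by omega),
        show (Expr.reg 3).eval t = s.reg 3 from ht.1 3 (by omega)])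
  rw [← hK] at hspec
  have hstage : acceptStage W N.k = .saturate 6 0 (W + W + W + K) (acceptCond W N.k) := by
    rw [acceptStage, ← hK]
  rw [← hstage] at hspec
  obtain ⟨hclosed, hleast⟩ := hspec
  have htab : ((acceptStage W N.k).exec s).Tab 6 0 [] ↔
      ((acceptStage W N.k).exec s).arr 6 0 ≠ 0 := by simp [State.Tab]
  rw [← htab]
  constructor
  · intro hacc
    refine hleast (fun _ => ∃ X Y col vec,
      tableOf (s.Tab 10 FD) W K X N.n Y col N.n vec ∧
      ∀ i < N.k, vec.getD i 0 ≤ s.reg 4 ∧ s.reg 3 ≤ vec.getD (N.k + i) 0) ?_ _ hacc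
    rintro A ρ - - ⟨h1, h2⟩
    exact ⟨_, _, _, _, h1, h2⟩
  · rintro ⟨X, Y, col, vec, hT, hthr⟩
    obtain ⟨hX, hY, hcol, hvec, -, hval, -⟩ := id hT
    set L := X ++ Y ++ col ++ vec with hL
    have := hclosed (entry L) (fun i _ => entry_lt (by have := h.one_lt; omega) (by
      intro x hx
      simp only [hL, List.mem_append] at hx
      refine hval x ?_
      simp only [List.mem_append]
      tauto) i)
    have e1 : seg (entry L) 0 W = X := seg_entry_of_eq (A := []) (C := Y ++ col ++ vec)
      (by simp [hL]) rfl hX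
    have e2 : seg (entry L) W W = Y := seg_entry_of_eq (A := X) (C := col ++ vec)
      (by simp [hL]) hX hY
    have e3 : seg (entry L) (W + W) W = col := seg_entry_of_eq (A := X ++ Y) (C := vec)
      (by simp [hL]) (by simp [hX, hY]) hcol
    have e4 : seg (entry L) (W + W + W) K = vec := seg_entry_of_eq (A := X ++ Y ++ col) (C := [])
      (by simp [hL]) (by simp [hX, hY, hcol]; omega) hvec
    rw [e1, e2, e3, e4] at this
    exact this ⟨hT, hthr⟩

/-! ### The decision procedure -/

/-- Decides the problem and writes the answer to cell `0` of array `6`. -/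
def decideCmd (W k : ℕ) : Cmd :=
  .seq (linkStage W) (.seq (oldStage W) (.seq (sepStage W) (.seq (factStage W k)
    (acceptStage W k))))

/-- The length of the facts. -/
def factLength (W k : ℕ) : ℕ := W + 1 + W + W + 1 + (k + k)

theorem decideCmd_wf {k : ℕ} : (decideCmd W k).WF :=
  ⟨Cmd.saturate_wf, Cmd.saturate_wf, Cmd.saturate_wf, Cmd.saturate_wf, Cmd.saturate_wf⟩

theorem decideCmd_writes {k r : ℕ} (h : (decideCmd W k).Writes r) : 20 ≤ r := by
  rcases h with h | h | h | h | h <;> exact Cmd.saturate_writes h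

theorem decideCmd_stores {k a : ℕ} (h : (decideCmd W k).Stores a) : 6 ≤ a ∧ a < 11 := by
  rcases h with h | h | h | h | h <;> · rw [Cmd.saturate_stores h]; omega

/-- The colourings that respect the thresholds in registers `3` and `4`. -/
def Net.Accepts (N : Net) (B P : ℕ) (a : ℕ → ℕ) : Prop :=
  N.IsColouring a ∧ ∀ i < N.k, ∑ v ∈ Finset.range N.n, N.wt i v (a v) ≤ B ∧
    P ≤ ∑ v ∈ Finset.range N.n, N.wt (N.k + i) v (a v)

/-- The two directions are asymmetric. Acceptance is always justified; bags and bounded sums are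
needed only to guarantee acceptance. -/
theorem decideCmd_spec (h : s.Ready N D) (hD : factLength W N.k ≤ D) (hW : 0 < W) :
    (((decideCmd W N.k).exec s).arr 6 0 ≠ 0 → ∃ a, N.Accepts (s.reg 4) (s.reg 3) a) ∧
    ∀ F, N.BagFamily W F → 0 < N.k → N.k ≤ s.reg 1 → ∀ a, N.Accepts (s.reg 4) (s.reg 3) a →
      (∀ i < N.K, ∑ v ∈ Finset.range N.n, N.wt i v (a v) < s.reg 1) →
      ((decideCmd W N.k).exec s).arr 6 0 ≠ 0 := by
  obtain ⟨K, hK⟩ : ∃ K, K = N.k + N.k := ⟨_, rfl⟩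
  obtain ⟨FD, hFD⟩ : ∃ FD, FD = W + 1 + W + W + 1 + K := ⟨_, rfl⟩
  rw [factLength, ← hK, ← hFD] at hD
  simp only [decideCmd, Cmd.exec]
  set s₁ := (linkStage W).exec s
  set s₂ := (oldStage W).exec s₁
  set s₃ := (sepStage W).exec s₂
  set s₄ := (factStage W N.k).exec s₃
  have f₁ : s.Frame 7 s₁ := Cmd.saturate_frame s
  have f₂ : s₁.Frame 8 s₂ := Cmd.saturate_frame s₁
  have f₃ : s₂.Frame 9 s₃ := Cmd.saturate_frame s₂
  have f₄ : s₃.Frame 10 s₄ := Cmd.saturate_frame s₃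
  have r₁ := h.frame f₁ (by omega) (by omega)
  have r₂ := r₁.frame f₂ (by omega) (by omega)
  have r₃ := r₂.frame f₃ (by omega) (by omega)
  have r₄ := r₃.frame f₄ (by omega) (by omega)
  have hl : s₁.HasLink N W := linkStage_spec h (by omega)
  have ho : s₂.HasOld N W := oldStage_spec r₁ (by omega) hl
  have hs : s₃.HasSep N W := sepStage_spec r₂ (by omega) (by omega) (hl.frame f₂ (by omega))
  obtain ⟨hclosed, hsem⟩ := factStage_spec hK hFD r₃ hD (by omega)
    ((hl.frame f₂ (by omega)).frame f₃ (by omega)) (ho.frame f₃ (by omega)) hs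
  have hreg : ∀ r < 20, s₃.reg r = s.reg r := fun r hr => by rw [f₃.1 r hr, f₂.1 r hr, f₁.1 r hr]
  rw [acceptStage_spec hK hFD r₄ hD, f₄.1 4 (by omega), f₄.1 3 (by omega), hreg 4 (by omega),
    hreg 3 (by omega)]
  rw [hreg 1 (by omega)] at hclosed
  have hNK := h.K
  constructor
  · rintro ⟨X, Y, col, vec, hT, hthr⟩
    obtain ⟨a, ha, hsum⟩ := (hsem _ _ _ _ _ _ hT).exists_colouring
    refine ⟨a, ha, fun i hi => ?_⟩
    rw [← hsum i (by omega), ← hsum (N.k + i) (by omega)]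
    exact hthr i hi
  · intro F hF hk hkM a ha hsum
    obtain ⟨X, Y, col, vec, hT, hvec⟩ := Net.exists_derivation hF hclosed h.n_lt hkM hk ha.1 hsum
    refine ⟨X, Y, col, vec, hT, fun i hi => ?_⟩
    rw [hvec i (by omega), hvec (N.k + i) (by omega)]
    exact ha.2 i hi

end

/-! ## Reading the input -/

/-- Tabulates the multiples of `q = M ^ j`, which is found in register `10`, and computes the next
power. -/
def powerStep (j : ℕ) : Cmd :=
  .seq (.assign 11 (.const 0)) (.seq
    (.iter 12 (.seq (.store (11 + j) (.reg 12) (.reg 11))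
      (.assign 11 (.add (.reg 11) (.reg 10)))))
    (.assign 10 (.reg 11)))

def powersCmd : ℕ → Cmd
  | 0 => .assign 10 (.const 1)
  | j + 1 => .seq (powersCmd j) (powerStep j)

theorem powersCmd_wf (D : ℕ) : (powersCmd D).WF := by
  induction D with
  | zero => simp [powersCmd, Cmd.WF]
  | succ D ih => simp [powersCmd, powerStep, Cmd.WF, Cmd.Writes, ih]

theorem powersCmd_writes {D r : ℕ} (h : (powersCmd D).Writes r) : r = 10 ∨ r = 11 ∨ r = 12 := by
  induction D with
  | zero => exact .inl h
  | succ D ih =>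
    rcases h with h | h
    · exact ih h
    · simp only [powerStep, Cmd.Writes] at h
      tauto

theorem powersCmd_stores {D a : ℕ} (h : (powersCmd D).Stores a) : 11 ≤ a := by
  induction D with
  | zero => exact h.elim
  | succ D ih =>
    rcases h with h | h
    · exact ih h
    · simp only [powerStep, Cmd.Stores, false_or, or_false] at h
      omega

/-- In place of a multiplication, register `11` runs through the multiples of `M ^ D` and ends at `M
* M ^ D`, the next power. -/
theorem powersCmd_spec (D : ℕ) (s : State) :
    ((powersCmd D).exec s).Powers D ∧ ((powersCmd D).exec s).reg 10 = s.reg 1 ^ D := by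
  induction D with
  | zero => exact ⟨fun j hj => absurd hj (Nat.not_lt_zero j), by simp [powersCmd, Cmd.exec, Expr.eval]⟩
  | succ D ih =>
    set t := (powersCmd D).exec s with ht
    have htM : t.reg 1 = s.reg 1 := Cmd.exec_reg (powersCmd_wf D).not_writes_one s
    set u := t.setReg 11 0 with hu
    have key := Cmd.iter_induction (x := 12) (p := .seq (.store (11 + D) (.reg 12) (.reg 11))
      (.assign 11 (.add (.reg 11) (.reg 10)))) (s := u)
      (fun i v => v.reg 1 = s.reg 1 ∧ v.reg 10 = s.reg 1 ^ D ∧ v.reg 11 = i * s.reg 1 ^ D ∧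
        (∀ i' < i, v.arr (11 + D) i' = i' * s.reg 1 ^ D) ∧ ∀ a, a ≠ 11 + D → v.arr a = t.arr a)
      ⟨by simp [hu, htM], by simp [hu, ih.2], by simp [hu], by simp, fun a _ => rfl⟩
      (fun i m v h => by simpa using h)
      (by
        rintro i v - ⟨h1, h2, h3, h4, h5⟩ hi
        simp only [Cmd.exec, Expr.eval, State.setReg_reg, State.setCell_reg, State.setReg_arr]
        refine ⟨by simpa using h1, by simpa using h2, by simp [h2, h3]; ring, ?_, fun a ha => ?_⟩
        · intro i' hi'
          rw [State.setCell_arr, hi, h3]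
          split_ifs with h
          · rw [h.2]
          · exact h4 i' (by have : i' ≠ i := fun e => h ⟨rfl, e⟩; omega)
        · rw [State.setCell_arr_of_ne _ _ _ _ ha, h5 a ha])
    have huM : u.reg 1 = s.reg 1 := by simp [hu, htM]
    rw [huM] at key
    obtain ⟨h1, h2, h3, h4, h5⟩ := key
    have hexec : (powersCmd (D + 1)).exec s = (((Cmd.iter 12 (.seq (.store (11 + D) (.reg 12)
      (.reg 11)) (.assign 11 (.add (.reg 11) (.reg 10))))).exec u).setReg 10
        (((Cmd.iter 12 (.seq (.store (11 + D) (.reg 12)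
      (.reg 11)) (.assign 11 (.add (.reg 11) (.reg 10))))).exec u).reg 11)) := rfl
    rw [hexec]
    refine ⟨?_, by simp [h3, pow_succ, mul_comm]⟩
    intro j hj i hi
    simp only [State.setReg_reg, State.setReg_arr, show (1 : ℕ) ≠ 10 by omega, if_false, h1] at hi ⊢
    by_cases hjD : j = D
    · rw [hjD, h4 i hi]
    · rw [h5 _ (by omega), ih.1 j (by omega) i (by rwa [htM]), htM]

/-! ### Parsing of the input word -/

/-- Array `0` holds the word `x`, and `rest` remains to be read from position `reg 5`. -/
def State.Reading (s : State) (x rest : List Bool) : Prop :=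
  (∀ i, s.arr 0 i = (x.getD i false).toNat) ∧ x.drop (s.reg 5) = rest

theorem State.Reading.of_eq {s s' : State} {x rest : List Bool} (h : s.Reading x rest)
    (h0 : s'.arr 0 = s.arr 0) (h5 : s'.reg 5 = s.reg 5) : s'.Reading x rest := by
  rw [State.Reading, h0, h5]
  exact h

theorem State.Reading.arr {s : State} {x rest : List Bool} (h : s.Reading x rest) (i : ℕ) :
    s.arr 0 (s.reg 5 + i) = (rest.getD i false).toNat := by
  rw [h.1, ← h.2]
  simp [List.getElem?_drop]

theorem State.Reading.advance {s s' : State} {x l rest : List Bool} (h : s.Reading x (l ++ rest))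
    (h0 : s'.arr 0 = s.arr 0) (h5 : s'.reg 5 = s.reg 5 + l.length) : s'.Reading x rest := by
  refine ⟨by rw [h0]; exact h.1, ?_⟩
  rw [h5, ← List.drop_drop, h.2, List.drop_left]

theorem State.Reading.length_le {s : State} {x l rest : List Bool} (h : s.Reading x (l ++ rest)) :
    l.length ≤ x.length := by
  have := congrArg List.length h.2
  simp only [List.length_drop, List.length_append] at this
  omega

/-- Reads a number in unary into register `6`. -/
def unaryCmd : Cmd :=
  .seq (.assign 6 (.const 0)) (.seq
    (.iter 7 (.branch (.cell 0 (.add (.reg 5) (.reg 6))) (.assign 6 (.add (.reg 6) (.const 1)))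
      .skip))
    (.assign 5 (.add (.reg 5) (.add (.reg 6) (.const 1)))))

theorem unaryCmd_wf : unaryCmd.WF := by simp [unaryCmd, Cmd.WF, Cmd.Writes]

theorem unaryCmd_reg {r : ℕ} (h5 : r ≠ 5) (h6 : r ≠ 6) (h7 : r ≠ 7) (s : State) :
    (unaryCmd.exec s).reg r = s.reg r :=
  Cmd.exec_reg (by simp [unaryCmd, Cmd.Writes, h5, h6, h7]) s

theorem unaryCmd_arr (a : ℕ) (s : State) : (unaryCmd.exec s).arr a = s.arr a :=
  Cmd.exec_arr (by simp [unaryCmd, Cmd.Stores]) s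

theorem length_unary (m : ℕ) : (unary m).length = m + 1 := by simp [unary]

theorem unaryCmd_spec {s : State} {x rest : List Bool} {m : ℕ} (hx : x.length < s.reg 1)
    (h : s.Reading x (unary m ++ rest)) :
    (unaryCmd.exec s).Reading x rest ∧ (unaryCmd.exec s).reg 6 = m := by
  have hm : m < s.reg 1 := by
    have := h.length_le
    rw [length_unary] at this
    omega
  have hget : ∀ c ≤ m, (unary m ++ rest).getD c false = decide (c < m) := by
    intro c hc
    rcases hc.lt_or_eq with hc | rfl
    · simp [unary, List.getElem?_append, hc]
    · simp [unary]
  set u := s.setReg 6 0 with hu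
  have key := Cmd.iter_induction (x := 7) (p := .branch (.cell 0 (.add (.reg 5) (.reg 6)))
    (.assign 6 (.add (.reg 6) (.const 1))) .skip) (s := u)
    -- The counter stays put once it points at the terminating zero, hence the minimum.
    (fun i v => v.arr 0 = s.arr 0 ∧ v.reg 5 = s.reg 5 ∧ v.reg 6 = min i m)
    ⟨rfl, by simp [hu], by simp [hu]⟩ (fun i m v h => by simpa using h)
    (by
      rintro i v - ⟨h1, h2, h3⟩ -
      have hv := (h.of_eq h1 h2).arr (min i m)
      rw [hget _ (min_le_right _ _)] at hv
      simp only [Cmd.exec, Expr.eval, h3, hv]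
      by_cases him : i < m
      · rw [min_eq_left him.le]
        simp [him, h1, h2]
      · rw [min_eq_right (by omega)]
        simp [h1, h2, h3]
        omega)
  rw [show u.reg 1 = s.reg 1 by simp [hu], min_eq_right hm.le] at key
  obtain ⟨h1, h2, h3⟩ := key
  set v := (Cmd.iter 7 (.branch (.cell 0 (.add (.reg 5) (.reg 6)))
    (.assign 6 (.add (.reg 6) (.const 1))) .skip)).exec u
  have hexec : unaryCmd.exec s = v.setReg 5 (v.reg 5 + (v.reg 6 + 1)) := rfl
  rw [hexec]
  refine ⟨h.advance h1 ?_, ?_⟩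
  · rw [length_unary, State.setReg_reg, if_pos rfl, h2, h3]
  · rw [State.setReg_reg, if_neg (by omega), h3]

theorem drop_finRange {n i : ℕ} (hi : i < n) :
    (List.finRange n).drop i = ⟨i, hi⟩ :: (List.finRange n).drop (i + 1) := by
  rw [List.drop_eq_getElem_cons (by simpa using hi)]
  simp

theorem drop_finRange_self (n : ℕ) : (List.finRange n).drop n = [] := by
  simp

/-- Reads numbers in unary, one for each item, into array `a`. -/
def numbersCmd (a : ℕ) : Cmd :=
  .forBelow 8 (.reg 2) (.seq unaryCmd (.store a (.reg 8) (.reg 6)))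

theorem numbersCmd_wf (a : ℕ) : (numbersCmd a).WF := by
  simp [numbersCmd, Cmd.forBelow, unaryCmd, Cmd.WF, Cmd.Writes]

theorem numbersCmd_reg {a r : ℕ} (h5 : r ≠ 5) (h6 : r ≠ 6) (h7 : r ≠ 7) (h8 : r ≠ 8) (s : State) :
    ((numbersCmd a).exec s).reg r = s.reg r :=
  Cmd.exec_reg (by simp [numbersCmd, Cmd.forBelow, unaryCmd, Cmd.Writes, h5, h6, h7, h8]) s

theorem numbersCmd_arr {a b : ℕ} (h : b ≠ a) (s : State) :
    ((numbersCmd a).exec s).arr b = s.arr b :=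
  Cmd.exec_arr (by simp [numbersCmd, Cmd.forBelow, unaryCmd, Cmd.Stores, h]) s

theorem numbersCmd_spec {s : State} {x rest : List Bool} {n a : ℕ} {f : Fin n → ℕ} (ha : a ≠ 0)
    (hx : x.length < s.reg 1) (hn : s.reg 2 = n) (hnM : n ≤ s.reg 1)
    (h : s.Reading x ((List.finRange n).flatMap (fun v => unary (f v)) ++ rest)) :
    ((numbersCmd a).exec s).Reading x rest ∧
      ∀ v : Fin n, ((numbersCmd a).exec s).arr a v = f v := by
  have key := Cmd.forBelow_induction (x := 8) (e := .reg 2)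
    (p := .seq unaryCmd (.store a (.reg 8) (.reg 6))) (s := s) n
    (fun i t => t.reg 1 = s.reg 1 ∧ t.reg 2 = n ∧
      t.Reading x (((List.finRange n).drop i).flatMap (fun v => unary (f v)) ++ rest) ∧
      ∀ v : Fin n, (v : ℕ) < i → t.arr a v = f v) hnM ⟨rfl, hn, by simpa using h, by simp⟩
    (by
      rintro i m t ⟨h1, h2, h3, h4⟩
      exact ⟨by simpa using h1, by simpa using h2, h3.of_eq rfl (by simp), h4⟩)
    (fun i t h => h.2.1)
    (by
      rintro i t hi ⟨h1, h2, h3, h4⟩ hti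
      rw [drop_finRange hi, List.flatMap_cons, List.append_assoc] at h3
      obtain ⟨h5, h6⟩ := unaryCmd_spec (by rwa [h1]) h3
      simp only [Cmd.exec, Expr.eval]
      refine ⟨?_, ?_, h5.of_eq (State.setCell_arr_of_ne _ _ _ _ (Ne.symm ha)) rfl, fun v hv => ?_⟩
      · rw [State.setCell_reg, unaryCmd_reg (by omega) (by omega) (by omega), h1]
      · rw [State.setCell_reg, unaryCmd_reg (by omega) (by omega) (by omega), h2]
      · rw [State.setCell_arr, unaryCmd_reg (by omega) (by omega) (by omega), hti, h6]
        split_ifs with hvi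
        · congr 1
          exact Fin.ext hvi.2.symm
        · rw [unaryCmd_arr]
          exact h4 v (by have : (v : ℕ) ≠ i := fun e => hvi ⟨rfl, e⟩; omega))
  obtain ⟨-, -, h3, h4⟩ := key
  rw [drop_finRange_self] at h3
  exact ⟨h3, fun v => h4 v v.2⟩

/-- Reads the adjacency matrix into array `2`. -/
def graphCmd : Cmd :=
  .forBelow 8 (.reg 2) (.forBelow 9 (.reg 2)
    (.seq (.store 2 (Expr.code [.reg 8, .reg 9]) (.cell 0 (.reg 5)))
      (.assign 5 (.add (.reg 5) (.const 1)))))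

theorem graphCmd_wf : graphCmd.WF := by
  simp [graphCmd, Cmd.forBelow, Cmd.WF, Cmd.Writes]

theorem graphCmd_reg {r : ℕ} (h5 : r ≠ 5) (h8 : r ≠ 8) (h9 : r ≠ 9) (s : State) :
    (graphCmd.exec s).reg r = s.reg r :=
  Cmd.exec_reg (by simp [graphCmd, Cmd.forBelow, Cmd.Writes, h5, h8, h9]) s

theorem graphCmd_arr {b : ℕ} (h : b ≠ 2) (s : State) : (graphCmd.exec s).arr b = s.arr b :=
  Cmd.exec_arr (by simp [graphCmd, Cmd.forBelow, Cmd.Stores, h]) s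

-- Array `2` has to be zero at the start: pairs with an entry of at least `n` are never written and
-- must count as not adjacent.
open Classical in
theorem graphCmd_spec {s : State} {x rest : List Bool} {n D : ℕ} {G : SimpleGraph (Fin n)}
    (hM : 1 < s.reg 1) (hn : s.reg 2 = n) (hnM : n ≤ s.reg 1) (hp : s.Powers D) (hD : 2 ≤ D)
    (h0 : ∀ i, s.arr 2 i = 0)
    (h : s.Reading x ((List.finRange n).flatMap (fun u =>
        (List.finRange n).map (fun v => decide (G.Adj u v))) ++ rest)) :
    (graphCmd.exec s).Reading x rest ∧ ∀ u v, u < s.reg 1 → v < s.reg 1 →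
      ((graphCmd.exec s).Tab 2 2 [u, v] ↔ natAdj G u v) := by
  have key := Cmd.forBelow_induction (x := 8) (e := .reg 2)
    (p := .forBelow 9 (.reg 2) (.seq (.store 2 (Expr.code [.reg 8, .reg 9]) (.cell 0 (.reg 5)))
      (.assign 5 (.add (.reg 5) (.const 1))))) (s := s) n
    (fun i t => t.reg 1 = s.reg 1 ∧ t.reg 2 = n ∧ t.Powers D ∧
      t.Reading x (((List.finRange n).drop i).flatMap (fun u =>
        (List.finRange n).map (fun v => decide (G.Adj u v))) ++ rest) ∧
      ∀ u v, u < s.reg 1 → v < s.reg 1 → (t.Tab 2 2 [u, v] ↔ u < i ∧ natAdj G u v)) hnM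
    ⟨rfl, hn, hp, by simpa using h, fun u v _ _ => by simp [State.Tab, h0]⟩
    (by
      rintro i m t ⟨h1, h2, h3, h4, h5⟩
      exact ⟨by simpa using h1, by simpa using h2, by simpa [State.Powers] using h3,
        h4.of_eq rfl (by simp), by simpa [State.Tab] using h5⟩)
    (fun i t h => h.2.1)
    (by
      rintro i t hi ⟨h1, h2, h3, h4, h5⟩ hti
      rw [drop_finRange hi, List.flatMap_cons, List.append_assoc] at h4
      have inner := Cmd.forBelow_induction (x := 9) (e := .reg 2)
        (p := .seq (.store 2 (Expr.code [.reg 8, .reg 9]) (.cell 0 (.reg 5)))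
          (.assign 5 (.add (.reg 5) (.const 1)))) (s := t) n
        (fun j t => t.reg 1 = s.reg 1 ∧ t.reg 2 = n ∧ t.reg 8 = i ∧ t.Powers D ∧
          t.Reading x (((List.finRange n).drop j).map (fun v => decide (G.Adj ⟨i, hi⟩ v)) ++
            (((List.finRange n).drop (i + 1)).flatMap (fun u =>
              (List.finRange n).map (fun v => decide (G.Adj u v))) ++ rest)) ∧
          ∀ u v, u < s.reg 1 → v < s.reg 1 →
            (t.Tab 2 2 [u, v] ↔ (u < i ∨ u = i ∧ v < j) ∧ natAdj G u v)) (by omega)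
        ⟨h1, h2, hti, h3, by simpa using h4, by simpa using h5⟩
        (by
          rintro i m t ⟨h1, h2, h3, h4, h5, h6⟩
          exact ⟨by simpa using h1, by simpa using h2, by simpa using h3,
            by simpa [State.Powers] using h4, h5.of_eq rfl (by simp), by simpa [State.Tab] using h6⟩)
        (fun i t h => h.2.1)
        (by
          rintro j t hj ⟨h1, h2, h3, h4, h5, h6⟩ htj
          rw [drop_finRange hj, List.map_cons, List.cons_append] at h5
          have hlet := h5.arr 0
          simp only [add_zero, List.getD_cons_zero] at hlet
          have hcode : (Expr.code [.reg 8, .reg 9]).eval t = Nat.ofDigits (t.reg 1) [i, j] := by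
            rw [Expr.eval_code (h4.mono hD) (by simp) (by simp [Expr.eval, h1, h3, htj]; omega)]
            simp [Expr.eval, h3, htj]
          simp only [Cmd.exec, hcode, Expr.eval, hlet]
          refine ⟨by simpa using h1, by simpa using h2, by simpa using h3, ?_, ?_, ?_⟩
          · intro a ha b hb
            simp only [State.setReg_reg, State.setCell_reg, State.setReg_arr,
              show (1 : ℕ) ≠ 5 by omega, if_false] at hb ⊢
            rw [State.setCell_arr_of_ne _ _ _ _ (by omega)]
            exact h4 a ha b hb
          · exact State.Reading.advance (l := [decide (G.Adj ⟨i, hi⟩ ⟨j, hj⟩)]) h5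
              (by simp [State.setCell_arr_of_ne]) (by simp)
          · intro u v hu hv
            have htab : ∀ t' : State, (t'.setReg 5 (t.reg 5 + 1)).Tab 2 2 [u, v] ↔
                t'.Tab 2 2 [u, v] := fun t' => by simp [State.Tab]
            rw [State.setCell_reg, htab, tab_setCell (D := 2) (l₀ := [i, j]) (by omega) rfl (by simp; omega),
              h6 u v hu hv]
            simp only [List.cons.injEq, and_true]
            split_ifs with huv
            · obtain ⟨rfl, rfl⟩ := huv
              by_cases hadj : G.Adj ⟨u, hi⟩ ⟨v, hj⟩ <;> simp [hadj, natAdj, hi, hj]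
            · constructor
              · rintro ⟨h, h'⟩
                exact ⟨by omega, h'⟩
              · rintro ⟨h, h'⟩
                refine ⟨?_, h'⟩
                rcases h with h | ⟨h, hv'⟩
                · exact .inl h
                · exact .inr ⟨h, by have : v ≠ j := fun e => huv ⟨h, e⟩; omega⟩)
      obtain ⟨g1, g2, -, g4, g5, g6⟩ := inner
      rw [drop_finRange_self] at g5
      refine ⟨g1, g2, g4, g5, fun u v hu hv => ?_⟩
      rw [g6 u v hu hv]
      refine and_congr_left fun hadj => ?_
      have := hadj.2.1
      omega)
  obtain ⟨-, -, -, h4, h5⟩ := key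
  rw [drop_finRange_self] at h4
  refine ⟨h4, fun u v hu hv => (h5 u v hu hv).trans ⟨fun h => h.2, fun h => ⟨h.1, h⟩⟩⟩

/-- The number with the given binary digits, least significant digit first. -/
def bitsValue : List Bool → ℕ
  | [] => 0
  | b :: l => b.toNat + 2 * bitsValue l

theorem bitsValue_bits (m : ℕ) : bitsValue m.bits = m := by
  induction m using Nat.binaryRec' with
  | zero => simp [bitsValue]
  | bit b m h ih =>
    rw [Nat.bits_append_bit _ _ h, bitsValue, ih, Nat.bit_val]
    omega

/-- Reads a number in binary into register `9`. -/
def binaryCmd : Cmd :=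
  .seq unaryCmd (.seq (.assign 8 (.reg 6)) (.seq (.assign 9 (.const 0)) (.seq
    (.assign 10 (.const 1)) (.forBelow 12 (.reg 8) (.seq
      (.branch (.cell 0 (.reg 5)) (.assign 9 (.add (.reg 9) (.reg 10))) .skip)
      (.seq (.assign 10 (.add (.reg 10) (.reg 10))) (.assign 5 (.add (.reg 5) (.const 1)))))))))

theorem binaryCmd_wf : binaryCmd.WF := by
  simp [binaryCmd, Cmd.forBelow, unaryCmd, Cmd.WF, Cmd.Writes]

theorem binaryCmd_reg {r : ℕ} (h : r < 5) (s : State) :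
    (binaryCmd.exec s).reg r = s.reg r :=
  Cmd.exec_reg (by simp [binaryCmd, Cmd.forBelow, unaryCmd, Cmd.Writes]; omega) s

theorem binaryCmd_arr (a : ℕ) (s : State) : (binaryCmd.exec s).arr a = s.arr a :=
  Cmd.exec_arr (by simp [binaryCmd, Cmd.forBelow, unaryCmd, Cmd.Stores]) s

theorem binaryCmd_spec {s : State} {x rest : List Bool} {m : ℕ} (hx : x.length < s.reg 1)
    (h : s.Reading x (binary m ++ rest)) :
    (binaryCmd.exec s).Reading x rest ∧ (binaryCmd.exec s).reg 9 = m := by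
  rw [binary, List.append_assoc] at h
  obtain ⟨h1, h2⟩ := unaryCmd_spec hx h
  set t := unaryCmd.exec s
  have htM : t.reg 1 = s.reg 1 := unaryCmd_reg (by omega) (by omega) (by omega) s
  have hlen : m.bits.length ≤ s.reg 1 := by
    have := h1.length_le
    omega
  have key := Cmd.forBelow_induction (x := 12) (e := .reg 8) (p := .seq
      (.branch (.cell 0 (.reg 5)) (.assign 9 (.add (.reg 9) (.reg 10))) .skip)
      (.seq (.assign 10 (.add (.reg 10) (.reg 10))) (.assign 5 (.add (.reg 5) (.const 1)))))
    (s := ((t.setReg 8 (t.reg 6)).setReg 9 0).setReg 10 1) m.bits.length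
    -- The value read so far plus `2 ^ i` times the value of the unread digits is always `m`.
    -- Register `10` holds `2 ^ i`, obtained by doubling.
    (fun i u => u.reg 8 = m.bits.length ∧ u.reg 10 = 2 ^ i ∧
      u.Reading x (m.bits.drop i ++ rest) ∧ u.reg 9 + 2 ^ i * bitsValue (m.bits.drop i) = m)
    (by simpa [htM] using hlen)
    ⟨by simp [h2], by simp, h1.of_eq rfl (by simp), by simp [bitsValue_bits]⟩
    (by
      rintro i m t ⟨h1, h2, h3, h4⟩
      exact ⟨by simpa using h1, by simpa using h2, h3.of_eq rfl (by simp), by simpa using h4⟩)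
    (fun i t h => h.1)
    (by
      rintro i u hi ⟨g1, g2, g3, g4⟩ -
      rw [List.drop_eq_getElem_cons hi] at g3 g4
      have hlet := g3.arr 0
      simp only [add_zero, List.cons_append, List.getD_cons_zero] at hlet
      rw [bitsValue] at g4
      simp only [Cmd.exec, Expr.eval, hlet]
      cases hb : m.bits[i]
      · rw [hb] at g4
        simp only [Bool.toNat_false, ne_eq, not_true_eq_false, if_false]
        refine ⟨by simpa using g1, by simp [g2, pow_succ]; omega, ?_, ?_⟩
        · exact State.Reading.advance (l := [m.bits[i]]) g3 (by simp) (by simp)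
        · simp only [State.setReg_reg]
          simp
          simp only [Bool.toNat_false, zero_add] at g4
          rw [pow_succ, mul_assoc]
          exact g4
      · rw [hb] at g4
        simp only [Bool.toNat_true, ne_eq, one_ne_zero, not_false_eq_true, if_true]
        refine ⟨by simpa using g1, by simp [g2, pow_succ]; omega, ?_, ?_⟩
        · exact State.Reading.advance (l := [m.bits[i]]) g3 (by simp) (by simp)
        · simp only [State.setReg_reg]
          simp
          simp only [Bool.toNat_true, mul_add, mul_one] at g4
          rw [pow_succ, mul_assoc, g2]
          omega)
  obtain ⟨-, -, g3, g4⟩ := key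
  rw [List.drop_length] at g3 g4
  have hexec : binaryCmd.exec s = (Cmd.forBelow 12 (.reg 8) (.seq
      (.branch (.cell 0 (.reg 5)) (.assign 9 (.add (.reg 9) (.reg 10))) .skip)
      (.seq (.assign 10 (.add (.reg 10) (.reg 10))) (.assign 5 (.add (.reg 5) (.const 1)))))).exec
    (((t.setReg 8 (t.reg 6)).setReg 9 0).setReg 10 1) := rfl
  rw [hexec]
  exact ⟨g3, by simpa [bitsValue] using g4⟩

/-- Reads the whole input. -/
def readCmd (D : ℕ) : Cmd :=
  .seq (powersCmd D) (.seq unaryCmd (.seq (.assign 2 (.reg 6)) (.seq graphCmd (.seq (numbersCmd 3)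
    (.seq (numbersCmd 4) (.seq binaryCmd (.seq (.assign 3 (.reg 9)) (.seq binaryCmd
      (.assign 4 (.reg 9))))))))))

theorem readCmd_wf (D : ℕ) : (readCmd D).WF :=
  ⟨powersCmd_wf D, unaryCmd_wf, by simp [Cmd.WF], graphCmd_wf, numbersCmd_wf 3, numbersCmd_wf 4,
    binaryCmd_wf, by simp [Cmd.WF], binaryCmd_wf, by simp [Cmd.WF]⟩

/-- The memory holds the instance. -/
structure State.Loaded {n : ℕ} (s : State) (I : Instance (Fin n)) (M D : ℕ) : Prop where
  bound : s.reg 1 = M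
  items : s.reg 2 = n
  reg_P : s.reg 3 = I.P
  reg_B : s.reg 4 = I.B
  powers : s.Powers D
  adj : ∀ u v, u < M → v < M → (s.Tab 2 2 [u, v] ↔ natAdj I.graph u v)
  utility : ∀ v : Fin n, s.arr 3 v = I.utility v
  cost : ∀ v : Fin n, s.arr 4 v = I.cost v

theorem State.Powers.of_eq {s s' : State} {D : ℕ} (h : s.Powers D) (h1 : s'.reg 1 = s.reg 1)
    (ha : ∀ a, 11 ≤ a → s'.arr a = s.arr a) : s'.Powers D := by
  intro j hj i hi
  rw [h1] at hi ⊢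
  rw [ha _ (by omega), h j hj i hi]

theorem State.tab_of_eq {s s' : State} {T D : ℕ} (h1 : s'.reg 1 = s.reg 1)
    (hT : s'.arr T = s.arr T) : s'.Tab T D = s.Tab T D := by
  funext l
  simp [State.Tab, h1, hT]

theorem State.Loaded.of_eq {n M D : ℕ} {s s' : State} {I : Instance (Fin n)}
    (h : s.Loaded I M D) (hr : ∀ r, 1 ≤ r → r ≤ 4 → s'.reg r = s.reg r)
    (ha : ∀ a, 2 ≤ a → a ≤ 4 ∨ 11 ≤ a → s'.arr a = s.arr a) : s'.Loaded I M D where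
  bound := by rw [hr 1 (by omega) (by omega), h.bound]
  items := by rw [hr 2 (by omega) (by omega), h.items]
  reg_P := by rw [hr 3 (by omega) (by omega), h.reg_P]
  reg_B := by rw [hr 4 (by omega) (by omega), h.reg_B]
  powers := h.powers.of_eq (hr 1 (by omega) (by omega)) fun a h => ha a (by omega) (by omega)
  adj := by
    rw [State.tab_of_eq (hr 1 (by omega) (by omega)) (ha 2 (by omega) (by omega))]
    exact h.adj
  utility := by rw [ha 3 (by omega) (by omega)]; exact h.utility
  cost := by rw [ha 4 (by omega) (by omega)]; exact h.cost

theorem readCmd_spec {n D : ℕ} (I : Instance (Fin n)) {s : State} (hD : 2 ≤ D)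
    (hx : I.encode.length < s.reg 1) (h0 : ∀ i, s.arr 0 i = (I.encode.getD i false).toNat)
    (h5 : s.reg 5 = 0) (hz : ∀ a, a ≠ 0 → ∀ i, s.arr a i = 0) :
    ((readCmd D).exec s).Loaded I (s.reg 1) D ∧
      (∀ i, ((readCmd D).exec s).arr 5 i = 0) := by
  obtain ⟨x, hxe⟩ : ∃ x, x = I.encode := ⟨_, rfl⟩
  rw [← hxe] at hx h0
  obtain ⟨hp₁, -⟩ := powersCmd_spec D s
  set s₁ := (powersCmd D).exec s with hs₁
  have a₁ : ∀ a < 11, s₁.arr a = s.arr a := fun a ha =>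
    Cmd.exec_arr (fun h => by have := powersCmd_stores h; omega) s
  have g₁ : ∀ r < 10, s₁.reg r = s.reg r := fun r hr =>
    Cmd.exec_reg (fun h => by have := powersCmd_writes h; omega) s
  have R₁ : s₁.Reading x x :=
    State.Reading.of_eq (s := s) ⟨h0, by rw [h5, List.drop_zero]⟩ (a₁ 0 (by omega))
      (g₁ 5 (by omega))
  -- Only the unread rest is unfolded into the parts of the encoding, while the word itself stays
  -- opaque.
  nth_rewrite 2 [hxe] at R₁
  simp only [Instance.encode, List.append_assoc] at R₁
  -- the number of items
  have M₁ : s₁.reg 1 = s.reg 1 := g₁ 1 (by omega)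
  obtain ⟨R₂, n₂⟩ := unaryCmd_spec (by rwa [M₁]) R₁
  set s₂ := unaryCmd.exec s₁
  set s₃ := s₂.setReg 2 (s₂.reg 6) with hs₃
  have M₃ : s₃.reg 1 = s.reg 1 := by
    rw [hs₃, State.setReg_reg, if_neg (by omega), ← M₁]
    exact unaryCmd_reg (by omega) (by omega) (by omega) _
  have n₃ : s₃.reg 2 = n := by rw [hs₃, State.setReg_reg, if_pos rfl, n₂]
  have a₃ : ∀ a, s₃.arr a = s₁.arr a := fun a => unaryCmd_arr a s₁
  have R₃ := R₂.of_eq (s' := s₃) rfl (by rw [hs₃, State.setReg_reg, if_neg (by omega)])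
  have hnM : n ≤ s.reg 1 := by
    have := R₁.length_le
    rw [length_unary] at this
    omega
  -- the graph
  obtain ⟨R₄, t₄⟩ := graphCmd_spec (s := s₃) (D := D) (n := n) (G := I.graph)
    (by
      have := R₁.length_le
      rw [length_unary] at this
      omega) n₃ (by omega)
    (hp₁.of_eq (M₃.trans M₁.symm) fun a _ => a₃ a) hD
    (fun i => by rw [a₃, a₁ 2 (by omega), hz 2 (by omega)]) R₃
  set s₄ := graphCmd.exec s₃
  have g₄ : ∀ r < 5, s₄.reg r = s₃.reg r := fun r hr =>
    graphCmd_reg (by omega) (by omega) (by omega) s₃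
  have a₄ : ∀ a, a ≠ 2 → s₄.arr a = s₃.arr a := fun a ha => graphCmd_arr ha s₃
  -- the numbers
  obtain ⟨R₅, f₅⟩ := numbersCmd_spec (a := 3) (n := n) (by omega)
    (by rw [g₄ 1 (by omega)]; omega) (by rw [g₄ 2 (by omega), n₃])
    (by rw [g₄ 1 (by omega)]; omega) R₄
  set s₅ := (numbersCmd 3).exec s₄
  have g₅ : ∀ r < 5, s₅.reg r = s₄.reg r := fun r hr =>
    numbersCmd_reg (by omega) (by omega) (by omega) (by omega) s₄
  have a₅ : ∀ a, a ≠ 3 → s₅.arr a = s₄.arr a := fun a ha => numbersCmd_arr ha s₄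
  obtain ⟨R₆, f₆⟩ := numbersCmd_spec (a := 4) (n := n) (by omega)
    (by rw [g₅ 1 (by omega), g₄ 1 (by omega)]; omega)
    (by rw [g₅ 2 (by omega), g₄ 2 (by omega), n₃])
    (by rw [g₅ 1 (by omega), g₄ 1 (by omega)]; omega) R₅
  set s₆ := (numbersCmd 4).exec s₅
  have g₆ : ∀ r < 5, s₆.reg r = s₅.reg r := fun r hr =>
    numbersCmd_reg (by omega) (by omega) (by omega) (by omega) s₅
  have a₆ : ∀ a, a ≠ 4 → s₆.arr a = s₅.arr a := fun a ha => numbersCmd_arr ha s₅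
  have g₆' : ∀ r < 5, s₆.reg r = s₃.reg r := fun r hr => by rw [g₆ r hr, g₅ r hr, g₄ r hr]
  -- the thresholds
  obtain ⟨R₇, p₇⟩ := binaryCmd_spec (by rw [g₆' 1 (by omega)]; omega) R₆
  set s₇ := binaryCmd.exec s₆
  have g₇ : ∀ r < 5, s₇.reg r = s₆.reg r := fun r hr => binaryCmd_reg hr s₆
  have a₇ : ∀ a, s₇.arr a = s₆.arr a := fun a => binaryCmd_arr a s₆
  set s₈ := s₇.setReg 3 (s₇.reg 9) with hs₈
  have g₈ : ∀ r < 5, r ≠ 3 → s₈.reg r = s₆.reg r := fun r hr hr3 => by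
    rw [hs₈, State.setReg_reg, if_neg hr3, g₇ r hr]
  have p₈ : s₈.reg 3 = I.P := by rw [hs₈, State.setReg_reg, if_pos rfl, p₇]
  have R₈ := R₇.of_eq (s' := s₈) rfl (by rw [hs₈, State.setReg_reg, if_neg (by omega)])
  rw [← List.append_nil (binary I.B)] at R₈
  obtain ⟨-, b₉⟩ := binaryCmd_spec (by rw [g₈ 1 (by omega) (by omega), g₆' 1 (by omega)]; omega) R₈
  set s₉ := binaryCmd.exec s₈
  have g₉ : ∀ r < 5, s₉.reg r = s₈.reg r := fun r hr => binaryCmd_reg hr s₈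
  have a₉ : ∀ a, s₉.arr a = s₈.arr a := fun a => binaryCmd_arr a s₈
  have hexec : (readCmd D).exec s = s₉.setReg 4 (s₉.reg 9) := rfl
  rw [hexec]
  have aEnd : ∀ a, (s₉.setReg 4 (s₉.reg 9)).arr a = s₆.arr a := fun a => by
    rw [State.setReg_arr, a₉, hs₈, State.setReg_arr, a₇]
  have gEnd : ∀ r < 4, (s₉.setReg 4 (s₉.reg 9)).reg r = s₈.reg r := fun r hr => by
    rw [State.setReg_reg, if_neg (by omega), g₉ r (by omega)]
  have mEnd : (s₉.setReg 4 (s₉.reg 9)).reg 1 = s.reg 1 := by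
    rw [gEnd 1 (by omega), g₈ 1 (by omega) (by omega), g₆' 1 (by omega), M₃]
  refine ⟨⟨mEnd, ?_, ?_, ?_, ?_, ?_, ?_, ?_⟩, ?_⟩
  · rw [gEnd 2 (by omega), g₈ 2 (by omega) (by omega), g₆' 2 (by omega), n₃]
  · rw [gEnd 3 (by omega), p₈]
  · rw [State.setReg_reg, if_pos rfl, b₉]
  · refine hp₁.of_eq (mEnd.trans M₁.symm) fun a ha => ?_
    rw [aEnd, a₆ a (by omega), a₅ a (by omega), a₄ a (by omega), a₃]
  · have h1 : (s₉.setReg 4 (s₉.reg 9)).reg 1 = s₄.reg 1 := by rw [mEnd, g₄ 1 (by omega), M₃]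
    rw [State.tab_of_eq h1 (by rw [aEnd, a₆ 2 (by omega), a₅ 2 (by omega)]), ← M₃]
    exact t₄
  · rw [aEnd, a₆ 3 (by omega)]
    exact f₅
  · rw [aEnd]
    exact f₆
  · intro i
    rw [aEnd, a₆ 5 (by omega), a₅ 5 (by omega), a₄ 5 (by omega), a₃, a₁ 5 (by omega),
      hz 5 (by omega)]

/-! ## The algorithm -/

section

variable {n k : ℕ}

/-- There is a solution that gives item `v` to agent `fix v - 1`, for all `v` with `fix v ≠ 0`. -/
def Instance.Feasible (I : Instance (Fin n)) (k : ℕ) (fix : ℕ → ℕ) : Prop :=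
  ∃ a : Fin n → Fin k, I.IsSolution a ∧ ∀ v : Fin n, fix v = 0 ∨ fix v = a v + 1

/-- The problem that the dynamic program decides. -/
def Instance.net (I : Instance (Fin n)) (k : ℕ) (fix : ℕ → ℕ) : Net :=
  allocNet k n (natAdj I.graph) (fun _ _ ⟨hu, hv, h⟩ => ⟨hv, hu, h.symm⟩) (fun _ _ ⟨hu, _⟩ => hu)
    (fun v => if hv : v < n then I.utility ⟨v, hv⟩ else 0)
    (fun v => if hv : v < n then I.cost ⟨v, hv⟩ else 0) fix

theorem State.Loaded.ready {M D : ℕ} {s : State} {I : Instance (Fin n)} (h : s.Loaded I M D)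
    (hD : 2 ≤ D) (hn : n < M) (hM : 1 < M) : s.Ready (I.net k (s.arr 5)) D where
  two_le := hD
  n_lt := by rw [h.bound]; exact hn
  one_lt := by rw [h.bound]; exact hM
  powers := h.powers
  n := h.items
  adj := by rw [h.bound]; exact h.adj
  K := rfl
  wt := by
    intro i v c hv
    have hv' : v < n := hv
    have h3 := h.utility ⟨v, hv'⟩
    have h4 := h.cost ⟨v, hv'⟩
    simp only at h3 h4
    simp [Instance.net, allocNet, hv', h3, h4]
  ok := fun v c _ => Iff.rfl

variable {I : Instance (Fin n)} {fix : ℕ → ℕ}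

theorem Instance.sum_cost (a : Fin n → Fin k) {b : ℕ → ℕ} (hb : ∀ v : Fin n, b v = a v)
    (i : Fin k) : ∑ v ∈ Finset.range (I.net k fix).n, (I.net k fix).wt i v (b v) =
      ∑ v with a v = i, I.cost v := by
  change ∑ v ∈ Finset.range n, _ = _
  rw [Finset.sum_range, Finset.sum_filter]
  simp [Instance.net, allocNet, hb, Fin.ext_iff]

theorem Instance.sum_utility (a : Fin n → Fin k) {b : ℕ → ℕ} (hb : ∀ v : Fin n, b v = a v)
    (i : Fin k) : ∑ v ∈ Finset.range (I.net k fix).n, (I.net k fix).wt (k + i) v (b v) =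
      ∑ v with a v = i, I.utility v := by
  change ∑ v ∈ Finset.range n, _ = _
  rw [Finset.sum_range, Finset.sum_filter]
  simp [Instance.net, allocNet, hb, Fin.ext_iff, add_comm]

theorem Instance.accepts_iff (a : Fin n → Fin k) {b : ℕ → ℕ} (hb : ∀ v : Fin n, b v = a v) :
    (I.net k fix).Accepts I.B I.P b ↔
      I.IsSolution a ∧ ∀ v : Fin n, fix v = 0 ∨ fix v = a v + 1 := by
  have hcol : (I.net k fix).IsColouring b ↔
      (∀ i : Fin k, I.graph.IsIndepSet {v | a v = i}) ∧
        ∀ v : Fin n, fix v = 0 ∨ fix v = a v + 1 := by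
    constructor
    · rintro ⟨h1, h2⟩
      refine ⟨fun i u hu v hv _ huv => ?_, fun v => ?_⟩
      · refine h2 u v ⟨u.2, v.2, huv⟩ ?_
        rw [hb, hb, Set.mem_ofPred.1 hu, Set.mem_ofPred.1 hv]
      · rw [← hb]
        exact (h1 v v.2).2
    · rintro ⟨h1, h2⟩
      refine ⟨fun v hv => ?_, ?_⟩
      · have := hb ⟨v, hv⟩
        simp only at this
        rw [this]
        exact ⟨(a _).2, h2 ⟨v, hv⟩⟩
      · rintro u v ⟨hu, hv, huv⟩ he
        have hu' := hb ⟨u, hu⟩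
        have hv' := hb ⟨v, hv⟩
        simp only at hu' hv'
        rw [hu', hv'] at he
        exact h1 (a ⟨v, hv⟩) (Set.mem_ofPred.2 (Fin.ext he)) (Set.mem_ofPred.2 rfl) huv.ne huv
  have hsum : (∀ i < (I.net k fix).k,
      ∑ v ∈ Finset.range (I.net k fix).n, (I.net k fix).wt i v (b v) ≤ I.B ∧
      I.P ≤ ∑ v ∈ Finset.range (I.net k fix).n, (I.net k fix).wt ((I.net k fix).k + i) v (b v)) ↔
      ∀ i : Fin k, ∑ v with a v = i, I.cost v ≤ I.B ∧ I.P ≤ ∑ v with a v = i, I.utility v := by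
    rw [Fin.forall_iff]
    refine forall₂_congr fun i hi => ?_
    rw [← I.sum_cost (fix := fix) a hb, ← I.sum_utility (fix := fix) a hb]
    rfl
  rw [Net.Accepts, hcol, hsum]
  simp only [Instance.IsSolution, forall_and]
  tauto

theorem Instance.exists_accepts :
    (∃ b, (I.net k fix).Accepts I.B I.P b) ↔ I.Feasible k fix := by
  constructor
  · rintro ⟨b, hb⟩
    let a : Fin n → Fin k := fun v => ⟨b v, (hb.1.1 v v.2).1⟩
    exact ⟨a, (I.accepts_iff a fun _ => rfl).1 hb⟩
  · rintro ⟨a, ha⟩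
    exact ⟨fun v => if hv : v < n then a ⟨v, hv⟩ else 0, (I.accepts_iff a (by simp)).2 ha⟩

/-- This is where unary encoding matters: the sums of all costs and of all utilities are bounded by
the input length, so bundle sums can serve as table indices. -/
theorem Instance.length_encode (I : Instance (Fin n)) :
    n ≤ I.encode.length ∧ ∑ v, I.cost v ≤ I.encode.length ∧
      ∑ v, I.utility v ≤ I.encode.length := by
  have h : ∀ f : Fin n → ℕ, ((List.finRange n).flatMap fun v => unary (f v)).length =
      ∑ v, f v + n := by
    intro f
    rw [List.length_flatMap, ← Fin.sum_univ_def]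
    simp [length_unary, Finset.sum_add_distrib]
  simp only [Instance.encode, List.length_append, h, length_unary]
  omega

/-- By the choice of `M`, vertices, colours and bundle sums are all valid entries. The bound on the
treewidth is needed only for acceptance of feasible instances. -/
theorem decideCmd_loaded {M D W : ℕ} {s : State} (h : s.Loaded I M D) (hk : 0 < k)
    (hD : factLength W k ≤ D) (hW : 0 < W) (hM : I.encode.length + k < M) :
    (((decideCmd W k).exec s).arr 6 0 ≠ 0 → I.Feasible k (s.arr 5)) ∧
    (treewidth I.graph < W → I.Feasible k (s.arr 5) →
      ((decideCmd W k).exec s).arr 6 0 ≠ 0) := by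
  obtain ⟨hn, hc, hu⟩ := I.length_encode
  have hspec := decideCmd_spec
    (h.ready (k := k) (by rw [factLength] at hD; omega) (by omega) (by omega)) hD hW
  rw [h.reg_B, h.reg_P, h.bound] at hspec
  refine ⟨fun hacc => Instance.exists_accepts.1 (hspec.1 hacc), fun htw hfeas => ?_⟩
  obtain ⟨w, rfl⟩ : ∃ w, W = w + 1 := ⟨W - 1, by omega⟩
  obtain ⟨F, hF⟩ := exists_bagFamily (N := I.net k (s.arr 5)) (G := I.graph) rfl
    (Nat.lt_succ_iff.1 htw)
  obtain ⟨a, ha⟩ := hfeas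
  let b : ℕ → ℕ := fun v => if hv : v < n then a ⟨v, hv⟩ else 0
  have hb : ∀ v : Fin n, b v = a v := by simp [b]
  refine hspec.2 F hF hk (by change k ≤ M; omega) b ((I.accepts_iff a hb).2 ha) fun i hi => ?_
  change i < k + k at hi
  by_cases hik : i < k
  · rw [I.sum_cost a hb ⟨i, hik⟩]
    exact (Finset.sum_le_univ_sum_of_nonneg fun _ => Nat.zero_le _).trans_lt (by omega)
  · obtain ⟨j, rfl⟩ : ∃ j, i = k + j := ⟨i - k, by omega⟩
    rw [I.sum_utility a hb ⟨j, by omega⟩]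
    exact (Finset.sum_le_univ_sum_of_nonneg fun _ => Nat.zero_le _).trans_lt (by omega)

/-- Tries the agents for item number `reg 13`. -/
def tryCmd (W k : ℕ) : Cmd :=
  .seq (.forBelow 14 (.const k) (.seq (.store 5 (.reg 13) (.add (.reg 14) (.const 1)))
    (.seq (decideCmd W k) (.branch (.cell 6 (.const 0)) (.store 1 (.reg 13) (.reg 14)) .skip))))
    -- If no agent was accepted, an arbitrary one is fixed. This is harmless, because the final
    -- decision is sound.
    (.store 5 (.reg 13) (.add (.cell 1 (.reg 13)) (.const 1)))

/-- Finds a solution by fixing the agents of the items one after the other. -/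
def solveCmd (W k : ℕ) : Cmd :=
  .seq (.forBelow 13 (.reg 2) (tryCmd W k)) (.seq (decideCmd W k)
    -- The double subtraction turns every nonzero value into `1`.
    (.assign 0 (.sub (.const 1) (.sub (.const 1) (.cell 6 (.const 0))))))

theorem not_writes_decideCmd {W r : ℕ} (hr : r < 20) : ¬ (decideCmd W k).Writes r := fun h => by
  have := decideCmd_writes h
  omega

theorem solveCmd_wf {W : ℕ} : (solveCmd W k).WF := by
  have h13 := not_writes_decideCmd (k := k) (W := W) (r := 13) (by omega)
  have h14 := not_writes_decideCmd (k := k) (W := W) (r := 14) (by omega)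
  simp [solveCmd, tryCmd, Cmd.forBelow, Cmd.WF, Cmd.Writes, decideCmd_wf, h13, h14]

/-- The state of the search: the agents of the items before `v` are fixed. -/
structure State.Search (s : State) (I : Instance (Fin n)) (M D k W v : ℕ) : Prop where
  loaded : s.Loaded I M D
  fixed : ∀ u < v, s.arr 5 u = s.arr 1 u + 1
  free : ∀ u, v ≤ u → u < n → s.arr 5 u = 0
  feasible : treewidth I.graph < W → I.IsYes k → I.Feasible k (s.arr 5)

theorem decideCmd_exec_loaded {M D W : ℕ} {s : State} (h : s.Loaded I M D) :
    ((decideCmd W k).exec s).Loaded I M D :=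
  h.of_eq (fun _ _ hr => Cmd.exec_reg (not_writes_decideCmd (by omega)) s)
    fun _ _ ha => Cmd.exec_arr (fun h => by have := decideCmd_stores h; omega) s

theorem decideCmd_exec_arr {W a : ℕ} (ha : a < 6) (s : State) :
    ((decideCmd W k).exec s).arr a = s.arr a :=
  Cmd.exec_arr (fun h => by have := decideCmd_stores h; omega) s

/-- Feasibility survives the fixing of one more item: if some solution extends the fixed part, then
the agent it gives to `v` passes the test, and every agent that passes is sound, including the last
one, which is kept. -/
theorem tryCmd_spec {M D W v : ℕ} {s : State} (hk : 0 < k) (hD : factLength W k ≤ D) (hW : 0 < W)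
    (hM : I.encode.length + k < M) (h : s.Search I M D k W v) (hv : v < n) (h13 : s.reg 13 = v) :
    ((tryCmd W k).exec s).Search I M D k W (v + 1) := by
  set f := s.arr 5 with hf
  -- a solution that agrees with the fixed part
  let P : (Fin n → Fin k) → Prop := fun a =>
    I.IsSolution a ∧ ∀ u : Fin n, (u : ℕ) < v → f u = a u + 1
  have hP : ∀ (a : Fin n → Fin k) (g : ℕ → ℕ), (∀ u, u ≠ v → g u = f u) →
      ((I.IsSolution a ∧ ∀ u : Fin n, g u = 0 ∨ g u = a u + 1) ↔
        P a ∧ (g v = 0 ∨ g v = a ⟨v, hv⟩ + 1)) := by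
    intro a g hg
    rw [and_assoc]
    refine and_congr_right fun _ => ⟨fun h' => ⟨fun u hu => ?_, h' ⟨v, hv⟩⟩, fun h' u => ?_⟩
    · have h1 := h' u
      rw [hg u hu.ne, hf, h.fixed u hu] at h1
      rw [hf, h.fixed u hu]
      omega
    · rcases lt_trichotomy (u : ℕ) v with hu | hu | hu
      · rw [hg u hu.ne]
        exact .inr (h'.1 u hu)
      · have : u = ⟨v, hv⟩ := Fin.ext hu
        rw [this]
        exact h'.2
      · rw [hg u hu.ne', hf, h.free u hu.le u.2]
        exact .inl rfl
  have key := Cmd.forBelow_induction (x := 14) (e := .const k) (p := .seq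
    (.store 5 (.reg 13) (.add (.reg 14) (.const 1))) (.seq (decideCmd W k)
      (.branch (.cell 6 (.const 0)) (.store 1 (.reg 13) (.reg 14)) .skip))) (s := s) k
    (fun i t => t.Loaded I M D ∧ t.reg 13 = v ∧ (∀ u, u ≠ v → t.arr 5 u = f u) ∧
      (∀ u, u ≠ v → t.arr 1 u = s.arr 1 u) ∧
      -- If a solution with a tested agent at `v` exists, then array `1` holds the agent of some
      -- solution, not necessarily the same one.
      (treewidth I.graph < W → ∀ a, P a → (a ⟨v, hv⟩ : ℕ) < i →
        ∃ b, P b ∧ (b ⟨v, hv⟩ : ℕ) = t.arr 1 v))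
    (by rw [h.loaded.bound]; omega) ⟨h.loaded, h13, fun _ _ => rfl, fun _ _ => rfl, by simp⟩
    (by
      rintro i m t ⟨h1, h2, h3⟩
      exact ⟨h1.of_eq (fun r hr hr' => by simp; omega) fun _ _ _ => rfl, by simpa using h2, h3⟩)
    (fun _ _ _ => rfl)
    (by
      rintro i t hi ⟨h1, h2, h3, h4, h5⟩ hti
      simp only [Cmd.exec, Expr.eval, h2, hti]
      set t₁ := t.setCell 5 v (i + 1)
      set t₂ := (decideCmd W k).exec t₁ with ht₂
      have l₁ : t₁.Loaded I M D := h1.of_eq (fun _ _ _ => rfl) fun a _ ha =>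
        State.setCell_arr_of_ne _ _ _ _ (by omega)
      have l₂ : t₂.Loaded I M D := decideCmd_exec_loaded l₁
      have r₂ : ∀ r < 20, t₂.reg r = t.reg r := fun r hr =>
        Cmd.exec_reg (not_writes_decideCmd hr) t₁
      have hv5 : t₁.arr 5 v = i + 1 := by simp [t₁, State.setCell_arr]
      have hu5 : ∀ u, u ≠ v → t₁.arr 5 u = f u := fun u hu => by
        rw [← h3 u hu]
        simp [t₁, State.setCell_arr, hu]
      have a5 : t₂.arr 5 = t₁.arr 5 := decideCmd_exec_arr (by omega) t₁
      have a1 : t₂.arr 1 = t.arr 1 :=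
        (decideCmd_exec_arr (by omega) t₁).trans (State.setCell_arr_of_ne _ _ _ _ (by omega))
      obtain ⟨sound, complete⟩ := decideCmd_loaded l₁ hk hD hW hM
      rw [← ht₂] at sound complete
      by_cases hacc : t₂.arr 6 0 = 0
      · rw [if_neg (not_not.2 hacc)]
        refine ⟨l₂, by rw [r₂ 13 (by omega), h2], by rw [a5]; exact hu5, by rw [a1]; exact h4, ?_⟩
        intro htw a ha hai
        rw [a1]
        -- A solution with agent `i` at `v` would have been accepted, so the agent of `a` was
        -- already tested earlier.
        refine h5 htw a ha (lt_of_le_of_ne (Nat.lt_succ_iff.1 hai) fun he => ?_)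
        exact complete htw ⟨a, (hP a _ hu5).2 ⟨ha, .inr (by rw [hv5, he])⟩⟩ hacc
      · rw [if_pos hacc, r₂ 13 (by omega), r₂ 14 (by omega), h2, hti]
        refine ⟨l₂.of_eq (fun _ _ _ => rfl) fun a _ ha => State.setCell_arr_of_ne _ _ _ _ (by omega),
          by rw [State.setCell_reg, r₂ 13 (by omega), h2], ?_, ?_, fun _ _ _ _ => ?_⟩
        · rw [State.setCell_arr_of_ne _ _ _ _ (by omega), a5]
          exact hu5
        · intro u hu
          rw [← h4 u hu, ← a1]
          simp [State.setCell_arr, hu]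
        · obtain ⟨b, hb⟩ := sound hacc
          obtain ⟨hb1, hb2⟩ := (hP b _ hu5).1 hb
          refine ⟨b, hb1, ?_⟩
          rw [hv5] at hb2
          simp [State.setCell_arr]
          omega)
  set t := (Cmd.forBelow 14 (.const k) (.seq
    (.store 5 (.reg 13) (.add (.reg 14) (.const 1))) (.seq (decideCmd W k)
      (.branch (.cell 6 (.const 0)) (.store 1 (.reg 13) (.reg 14)) .skip)))).exec s with ht
  obtain ⟨h1, h2, h3, h4, h5⟩ := key
  have hexec : (tryCmd W k).exec s = t.setCell 5 v (t.arr 1 v + 1) := by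
    rw [← h2]
    rfl
  rw [hexec]
  have e5 : ∀ u, (t.setCell 5 v (t.arr 1 v + 1)).arr 5 u =
      if u = v then t.arr 1 v + 1 else f u := by
    intro u
    split_ifs with hu
    · simp [State.setCell_arr, hu]
    · rw [← h3 u hu]
      simp [State.setCell_arr, hu]
  have e1 : (t.setCell 5 v (t.arr 1 v + 1)).arr 1 = t.arr 1 :=
    State.setCell_arr_of_ne _ _ _ _ (by omega)
  refine ⟨h1.of_eq (fun _ _ _ => rfl) fun a _ ha => State.setCell_arr_of_ne _ _ _ _ (by omega),
    fun u hu => ?_, fun u hu hun => ?_, fun htw hyes => ?_⟩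
  · rw [e5, e1]
    split_ifs with huv
    · rw [huv]
    · rw [h4 u huv, hf, h.fixed u (by omega)]
  · rw [e5, if_neg (by omega), hf, h.free u (by omega) hun]
  · obtain ⟨a, ha⟩ := h.feasible htw hyes
    obtain ⟨b, hb, hbv⟩ := h5 htw a ((hP a f fun _ _ => rfl).1 ha).1 (a _).2
    exact ⟨b, (hP b _ fun u hu => by rw [e5, if_neg hu]).2 ⟨hb, .inr (by rw [e5, if_pos rfl, hbv])⟩⟩

/-- The last decision is made with all items fixed. If it accepts, the solution it certifies can
only be the one in array `1`, so the output is right whatever the treewidth. -/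
theorem solveCmd_spec {M D W : ℕ} {s : State} (hk : 0 < k) (hD : factLength W k ≤ D) (hW : 0 < W)
    (hM : I.encode.length + k < M) (h : s.Loaded I M D) (h5 : ∀ i, s.arr 5 i = 0) :
    (((solveCmd W k).exec s).reg 0 = 1 ∧
      ∃ a : Fin n → Fin k, I.IsSolution a ∧ ∀ v : Fin n, ((solveCmd W k).exec s).arr 1 v = a v) ∨
    (((solveCmd W k).exec s).reg 0 = 0 ∧ (treewidth I.graph < W → ¬ I.IsYes k)) := by
  have key := Cmd.forBelow_induction (x := 13) (e := .reg 2) (p := tryCmd W k) (s := s) n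
    (fun v t => t.Search I M D k W v) (by have := I.length_encode.1; rw [h.bound]; omega)
    ⟨h, by simp, fun u _ _ => h5 u, fun _ ⟨a, ha⟩ => ⟨a, ha, fun v => .inl (h5 v)⟩⟩
    (fun i m t h => ⟨h.loaded.of_eq (fun r _ hr' => by simp; omega) fun _ _ _ => rfl, h.fixed, h.free,
      h.feasible⟩)
    (fun i t h => h.loaded.items)
    (fun v t hv h h13 => tryCmd_spec hk hD hW hM h hv h13)
  set t := (Cmd.forBelow 13 (.reg 2) (tryCmd W k)).exec s with ht
  set t' := (decideCmd W k).exec t with ht'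
  have hexec : (solveCmd W k).exec s = t'.setReg 0 (1 - (1 - t'.arr 6 0)) := rfl
  obtain ⟨sound, complete⟩ := decideCmd_loaded key.loaded hk hD hW hM
  rw [← ht'] at sound complete
  rw [hexec]
  by_cases hacc : t'.arr 6 0 = 0
  · refine .inr ⟨by simp [hacc], fun htw hyes => ?_⟩
    exact complete htw (key.feasible htw hyes) hacc
  · obtain ⟨a, ha, hfix⟩ := sound hacc
    refine .inl ⟨by simp; omega, a, ha, fun v => ?_⟩
    have h1 := hfix v
    rw [key.fixed v v.2] at h1
    rw [State.setReg_arr, ht', decideCmd_exec_arr (by omega)]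
    omega

/-- For every `w` there is a polynomial-time algorithm that finds solutions, and that finds one
whenever the treewidth is at most `w` and there is one. -/
theorem exists_program (hk : 0 < k) (w : ℕ) :
    ∃ (p : Program) (f : Polynomial ℕ), ∀ (n : ℕ) (I : Instance (Fin n)),
      ∃ (t : ℕ) (s : State), Runs p (initial I.encode) t s ∧ t ≤ f.eval I.encode.length ∧
        ((s.reg 0 = 1 ∧ ∃ a : Fin n → Fin k, I.IsSolution a ∧ ∀ v : Fin n, s.arr 1 v = a v) ∨
          (s.reg 0 = 0 ∧ (treewidth I.graph ≤ w → ¬ I.IsYes k))) := by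
  let D := factLength (w + 1) k
  let c : Cmd := .seq (readCmd D) (solveCmd (w + 1) k)
  -- The loop bound is the input length plus `k + 1`. The assignment itself accounts for the 4
  -- steps.
  refine ⟨.seq (.assign 1 (.add (.reg 0) (.const (k + 1)))) c.compile,
    4 + c.cost.comp (.X + .C (k + 1)), fun n I => ?_⟩
  let s₀ := (initial I.encode).setReg 1 (I.encode.length + (k + 1))
  have h1 : s₀.reg 1 = I.encode.length + (k + 1) := by simp [s₀]
  obtain ⟨t, ht, htle⟩ := Cmd.runs_compile (p := c) ⟨readCmd_wf D, solveCmd_wf⟩ s₀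
  refine ⟨_, _, .seq (.assign _ _ _) ht, ?_, ?_⟩
  · rw [h1] at htle
    simp only [Expr.steps, Polynomial.eval_add, Polynomial.eval_comp, Polynomial.eval_X,
      Polynomial.eval_C, Polynomial.eval_ofNat]
    omega
  · have hD : 2 ≤ D := by simp only [D, factLength]; omega
    obtain ⟨hl, h5⟩ := readCmd_spec (D := D) I (s := s₀) hD (by rw [h1]; omega)
      (fun i => by simp [s₀, initial]) (by simp [s₀, initial]) (fun a ha i => by
        simp [s₀, initial, ha])
    have := solveCmd_spec (W := w + 1) hk le_rfl (by omega) (by rw [h1]; omega) hl h5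
    simp only [Nat.lt_succ_iff] at this
    exact this

theorem polyTimeSolvable_of_treewidth (hk : 0 < k) (w : ℕ) :
    PolyTimeSolvable k fun _ G => treewidth G ≤ w := by
  obtain ⟨p, f, h⟩ := exists_program hk w
  refine ⟨p, f, fun n I hI => ?_⟩
  obtain ⟨t, s, hr, ht, hs⟩ := h n I
  exact ⟨t, s, hr, ht, hs.imp_right fun h => ⟨h.1, h.2 hI⟩⟩

end

/-! ## Clique trees of chordal graphs -/

section

universe v

variable {V : Type v} {G : SimpleGraph V}

/-! ### Clique separators -/

/-- Shortest walks are induced. -/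
theorem mem_edges_of_shortest {a b : V} (p : G.Walk a b)
    (hp : ∀ q : G.Walk a b, p.length ≤ q.length) {x y : V} (hx : x ∈ p.support)
    (hy : y ∈ p.support) (hxy : G.Adj x y) : s(x, y) ∈ p.edges := by
  classical
  induction p with
  | nil =>
    simp only [SimpleGraph.Walk.support_nil, List.mem_singleton] at hx hy
    exact absurd (hx.trans hy.symm) hxy.ne
  | @cons a c b h p ih =>
    have start : ∀ z, z ∈ p.support → G.Adj a z → s(a, z) ∈ (SimpleGraph.Walk.cons h p).edges := by
      intro z hz haz
      have h1 := hp (.cons haz (p.dropUntil z hz))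
      have h2 := congrArg SimpleGraph.Walk.length (p.take_spec hz)
      simp only [SimpleGraph.Walk.length_append, SimpleGraph.Walk.length_cons] at h1 h2
      have := SimpleGraph.Walk.eq_of_length_eq_zero (p := p.takeUntil z hz) (by omega)
      subst this
      simp
    rw [SimpleGraph.Walk.support_cons, List.mem_cons] at hx hy
    rcases hx with rfl | hx
    · rcases hy with rfl | hy
      · exact absurd rfl hxy.ne
      · exact start y hy hxy
    · rcases hy with rfl | hy
      · rw [Sym2.eq_swap]
        exact start x hx hxy.symm
      · rw [SimpleGraph.Walk.edges_cons]
        refine List.mem_cons_of_mem _ (ih (fun q => ?_) hx hy)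
        have := hp (.cons h q)
        simpa using this

/-- The edges inside a set of vertices. -/
def within (G : SimpleGraph V) (Z : Set V) : SimpleGraph V where
  Adj x y := G.Adj x y ∧ x ∈ Z ∧ y ∈ Z
  symm := ⟨fun _ _ h => ⟨h.1.symm, h.2.2, h.2.1⟩⟩
  loopless := ⟨fun _ h => h.1.ne rfl⟩

theorem within_le (Z : Set V) : within G Z ≤ G := fun _ _ h => h.1

theorem mem_of_mem_support_within {Z : Set V} {a b : V} (p : (within G Z).Walk a b) (ha : a ∈ Z)
    {x : V} (hx : x ∈ p.support) : x ∈ Z := by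
  induction p with
  | nil => rwa [List.mem_singleton.1 hx]
  | cons h p ih =>
    rw [SimpleGraph.Walk.support_cons, List.mem_cons] at hx
    rcases hx with rfl | hx
    · exact ha
    · exact ih h.2.2 hx

/-- In a chordal graph, the neighbours of a vertex `v` that are connected through vertices not
adjacent to `v` are adjacent. -/
theorem IsChordal.adj_of_reachable (hG : IsChordal G) {v s s' : V} {C : Set V} (hs : G.Adj v s)
    (hs' : G.Adj v s') (hss : s ≠ s') (hvC : v ∉ C) (hC : ∀ x ∈ C, ¬ G.Adj v x)
    (hr : (within G (insert s (insert s' C))).Reachable s s') : G.Adj s s' := by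
  by_contra hadj
  obtain ⟨p, hp, hlen⟩ := hr.exists_path_of_dist
  have hmin : ∀ q : (within G (insert s (insert s' C))).Walk s s', p.length ≤ q.length :=
    fun q => hlen ▸ SimpleGraph.dist_le q
  have hsupp : ∀ x ∈ p.support, x = s ∨ x = s' ∨ x ∈ C := fun x hx =>
    mem_of_mem_support_within p (by simp) hx
  -- With the two edges at `v`, the path closes to a cycle of length at least four.
  have h2 : 2 ≤ p.length := by
    by_contra hlt
    have h01 : p.length = 0 ∨ p.length = 1 := by omega
    rcases h01 with h0 | h1
    · exact hss (SimpleGraph.Walk.eq_of_length_eq_zero h0)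
    · exact hadj (SimpleGraph.Walk.adj_of_length_eq_one h1).1
  set q := p.mapLe (within_le _) with hq
  have hqs : q.support = p.support := by simp [hq]
  have hqe : q.edges = p.edges := by simp [hq]
  have hv : v ∉ q.support := by
    rw [hqs]
    intro hv
    rcases hsupp v hv with h | h | h
    · exact hs.ne h
    · exact hs'.ne h
    · exact hvC h
  have hqp : q.IsPath := (SimpleGraph.Walk.isPath_mapLe (within_le _)).2 hp
  have hcyc : (SimpleGraph.Walk.cons hs (q.concat hs'.symm)).IsCycle := by
    rw [SimpleGraph.Walk.cons_isCycle_iff]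
    refine ⟨hqp.concat hv hs'.symm, ?_⟩
    rw [SimpleGraph.Walk.edges_concat]
    simp only [List.concat_eq_append, List.mem_append, List.mem_singleton, not_or]
    refine ⟨fun h => hv (q.fst_mem_support_of_mem_edges h), fun h => ?_⟩
    rw [Sym2.eq_swap, Sym2.congr_left] at h
    exact hss h
  -- No chord is possible. The only neighbours of `v` on the path are its ends, whose edges to `v`
  -- are on the cycle, and a shortest path is induced.
  obtain ⟨x, hx, y, hy, hxy, hne⟩ := hG v _ hcyc (by simp [hq]; omega)
  have hmem : ∀ z, z ∈ (SimpleGraph.Walk.cons hs (q.concat hs'.symm)).support →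
      z = v ∨ z ∈ p.support := by
    intro z hz
    rw [← hqs]
    simp [SimpleGraph.Walk.support_concat] at hz
    tauto
  have hedge : ∀ e, e ∈ p.edges ∨ e = s(v, s) ∨ e = s(v, s') →
      e ∈ (SimpleGraph.Walk.cons hs (q.concat hs'.symm)).edges := by
    intro e he
    rw [← hqe] at he
    simp only [SimpleGraph.Walk.edges_cons, SimpleGraph.Walk.edges_concat, List.concat_eq_append,
      List.mem_append, List.mem_cons, Sym2.eq_swap (a := s') (b := v)]
    tauto
  have hv' : ∀ z, z ∈ p.support → G.Adj v z → s(v, z) ∈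
      (SimpleGraph.Walk.cons hs (q.concat hs'.symm)).edges := by
    intro z hz hvz
    refine hedge _ (.inr ?_)
    rcases hsupp z hz with rfl | rfl | h
    · exact .inl rfl
    · exact .inr rfl
    · exact absurd hvz (hC z h)
  rcases hmem x hx with rfl | hxp
  · rcases hmem y hy with rfl | hyp
    · exact hxy.ne rfl
    · exact hne (hv' y hyp hxy)
  · rcases hmem y hy with rfl | hyp
    · exact hne (Sym2.eq_swap ▸ hv' x hxp hxy.symm)
    · exact hne (hedge _ (.inl (mem_edges_of_shortest p hmin hxp hyp
        ⟨hxy, mem_of_mem_support_within p (by simp) hxp,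
          mem_of_mem_support_within p (by simp) hyp⟩)))

/-- A set of vertices of a chordal graph that is not a clique has a clique separator. -/
theorem IsChordal.exists_separation [DecidableEq V] (hG : IsChordal G) {W : Finset V}
    (hW : ¬ G.IsClique W) :
    ∃ W₁ W₂ : Finset V, W₁ ⊂ W ∧ W₂ ⊂ W ∧ W₁ ∪ W₂ = W ∧ G.IsClique (W₁ ∩ W₂ : Finset V) ∧
      ∀ K : Finset V, K ⊆ W → G.IsClique K → K ⊆ W₁ ∨ K ⊆ W₂ := by
  classical
  simp only [SimpleGraph.IsClique, Set.Pairwise, not_forall] at hW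
  obtain ⟨v, hv, u, hu, hvu, hadj⟩ := hW
  rw [Finset.mem_coe] at hv hu
  -- For nonadjacent `u` and `v`, let `C` be the component of `u` in `W` without `v` and its
  -- neighbours. The separator is the set of vertices of `W` outside `C` with a neighbour in `C`. It
  -- consists of neighbours of `v` that are connected through `C`, hence it is a clique.
  let Z : Set V := {x | x ∈ W ∧ x ≠ v ∧ ¬ G.Adj v x}
  have huZ : u ∈ Z := ⟨hu, hvu.symm, hadj⟩
  let C : Set V := {x | (within G Z).Reachable u x}
  have hCZ : ∀ x ∈ C, x ∈ Z := by
    rintro x ⟨p⟩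
    exact mem_of_mem_support_within p huZ p.end_mem_support
  have huC : u ∈ C := SimpleGraph.Reachable.refl u
  -- the neighbourhood of the component
  have hnbr : ∀ x ∈ C, ∀ y ∈ W, y ∉ C → G.Adj x y → G.Adj v y := by
    intro x hx y hy hyC hxy
    by_contra hvy
    have hyv : y ≠ v := by
      rintro rfl
      exact (hCZ x hx).2.2 hxy.symm
    exact hyC (SimpleGraph.Reachable.trans hx
      (SimpleGraph.Adj.reachable ⟨hxy, hCZ x hx, hy, hyv, hvy⟩))
  have hreach : ∀ D : Set V, C ⊆ D → ∀ x ∈ C, (within G D).Reachable u x := by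
    intro D hD x hx
    induction (SimpleGraph.reachable_iff_reflTransGen u x).1 hx with
    | refl => exact SimpleGraph.Reachable.refl u
    | @tail y z h hyz ih =>
      have hy : y ∈ C := (SimpleGraph.reachable_iff_reflTransGen u y).2 h
      have hz : z ∈ C := SimpleGraph.Reachable.trans hy hyz.reachable
      exact (ih hy).trans (SimpleGraph.Adj.reachable ⟨hyz.1, hD hy, hD hz⟩)
  let W₁ := W.filter fun y => y ∈ C ∨ ∃ x ∈ C, G.Adj x y
  let W₂ := W.filter fun y => y ∉ C
  have hvC : v ∉ C := fun h => (hCZ v h).2.1 rfl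
  refine ⟨W₁, W₂, ?_, ?_, ?_, ?_, ?_⟩
  · refine Finset.filter_ssubset.2 ⟨v, hv, ?_⟩
    rintro (h | ⟨x, hx, hxv⟩)
    · exact hvC h
    · exact (hCZ x hx).2.2 hxv.symm
  · exact Finset.filter_ssubset.2 ⟨u, hu, not_not.2 huC⟩
  · ext y
    simp only [W₁, W₂, Finset.mem_union, Finset.mem_filter]
    tauto
  · intro s hs s' hs' hss
    simp only [W₁, W₂, Finset.coe_inter, Set.mem_inter_iff, Finset.mem_coe, Finset.mem_filter]
      at hs hs'
    obtain ⟨⟨hsW, h⟩, -, hsC⟩ := hs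
    obtain ⟨⟨hsW', h'⟩, -, hsC'⟩ := hs'
    obtain ⟨x, hx, hxs⟩ := h.resolve_left hsC
    obtain ⟨x', hx', hxs'⟩ := h'.resolve_left hsC'
    have hsub : C ⊆ insert s (insert s' C) := fun z hz => .inr (.inr hz)
    refine hG.adj_of_reachable (hnbr x hx s hsW hsC hxs) (hnbr x' hx' s' hsW' hsC' hxs') hss hvC
      (fun z hz => (hCZ z hz).2.2) ?_
    have h1 : (within G (insert s (insert s' C))).Adj x s := ⟨hxs, hsub hx, by simp⟩
    have h2 : (within G (insert s (insert s' C))).Adj x' s' := ⟨hxs', hsub hx', by simp⟩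
    exact h1.reachable.symm.trans ((hreach _ hsub x hx).symm.trans
      ((hreach _ hsub x' hx').trans h2.reachable))
  -- A clique that meets `C` consists of vertices of `C` and their neighbours.
  · intro K hK hKc
    by_cases h : ∃ x ∈ K, x ∈ C
    · obtain ⟨x, hx, hxC⟩ := h
      refine .inl fun y hy => Finset.mem_filter.2 ⟨hK hy, ?_⟩
      by_cases hxy : x = y
      · exact .inl (hxy ▸ hxC)
      · exact .inr ⟨x, hxC, hKc hx hy hxy⟩
    · push Not at h
      exact .inr fun y hy => Finset.mem_filter.2 ⟨hK hy, h y hy⟩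

/-! ### Gluing of clique trees -/

/-- A tree of cliques inside `W` that covers all cliques inside `W`. -/
structure CliqueTree (G : SimpleGraph V) (W : Finset V) where
  Node : Type
  finite_node : Finite Node
  tree : SimpleGraph Node
  isTree : tree.IsTree
  bag : Node → Finset V
  bag_subset : ∀ t, bag t ⊆ W
  isClique_bag : ∀ t, G.IsClique (bag t)
  exists_subset_bag : ∀ K : Finset V, K ⊆ W → G.IsClique K → ∃ t, K ⊆ bag t
  connected : ∀ v ∈ W, (tree.induce {t | v ∈ bag t}).Connected

/-- A finite graph is a tree if it is connected with one vertex more than edges. The new edge makes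
up for the second surplus vertex. -/
theorem isTree_sum_sup_edge {A B : Type} [Finite A] [Finite B] {S : SimpleGraph A}
    {T : SimpleGraph B} (hS : S.IsTree) (hT : T.IsTree) (a : A) (b : B) :
    (S.sum T ⊔ SimpleGraph.edge (.inl a) (.inr b)).IsTree := by
  rw [SimpleGraph.isTree_iff_connected_and_card] at hS hT ⊢
  refine ⟨hS.1.sum_sup_edge hT.1, ?_⟩
  rw [SimpleGraph.edgeSet_sup, SimpleGraph.edgeSet_edge_of_ne (by simp), Set.union_singleton,
    Nat.card_coe_set_eq, Set.ncard_insert_of_notMem (by simp) (Set.toFinite _),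
    ← Nat.card_coe_set_eq, Nat.card_congr SimpleGraph.edgeSetSumEquiv, Nat.card_sum, Nat.card_sum]
  omega

theorem connected_induce_image {A B : Type} {S : SimpleGraph A} {T : SimpleGraph B} (f : A → B)
    (hf : ∀ x y, S.Adj x y → T.Adj (f x) (f y)) {X : Set A} (hX : (S.induce X).Connected) :
    (T.induce (f '' X)).Connected := by
  let g : S.induce X →g T.induce (f '' X) :=
    ⟨fun x => ⟨f x, Set.mem_image_of_mem f x.2⟩, fun {x y} h => hf x y h⟩
  refine hX.map g ?_
  rintro ⟨_, x, hx, rfl⟩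
  exact ⟨⟨x, hx⟩, rfl⟩

/-- Two clique trees whose vertex sets meet in a clique can be joined. -/
theorem CliqueTree.join [DecidableEq V] {W W₁ W₂ : Finset V} (T₁ : CliqueTree G W₁)
    (T₂ : CliqueTree G W₂) (hW : W₁ ∪ W₂ = W) (hS : G.IsClique (W₁ ∩ W₂ : Finset V))
    (hK : ∀ K : Finset V, K ⊆ W → G.IsClique K → K ⊆ W₁ ∨ K ⊆ W₂) :
    Nonempty (CliqueTree G W) := by
  have := T₁.finite_node
  have := T₂.finite_node
  -- The separator is a clique, so it lies in a bag of either tree, and an edge joins these two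
  -- nodes.
  obtain ⟨a, ha⟩ := T₁.exists_subset_bag _ Finset.inter_subset_left hS
  obtain ⟨b, hb⟩ := T₂.exists_subset_bag _ Finset.inter_subset_right hS
  set T := T₁.tree.sum T₂.tree ⊔ SimpleGraph.edge (.inl a) (.inr b)
  refine ⟨⟨T₁.Node ⊕ T₂.Node, inferInstance, T, isTree_sum_sup_edge T₁.isTree T₂.isTree a b,
    Sum.elim T₁.bag T₂.bag, ?_, ?_, ?_, ?_⟩⟩
  · rintro (t | t)
    · exact (T₁.bag_subset t).trans (hW ▸ Finset.subset_union_left)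
    · exact (T₂.bag_subset t).trans (hW ▸ Finset.subset_union_right)
  · rintro (t | t)
    · exact T₁.isClique_bag t
    · exact T₂.isClique_bag t
  · intro K hKW hKc
    rcases hK K hKW hKc with h | h
    · obtain ⟨t, ht⟩ := T₁.exists_subset_bag K h hKc
      exact ⟨.inl t, ht⟩
    · obtain ⟨t, ht⟩ := T₂.exists_subset_bag K h hKc
      exact ⟨.inr t, ht⟩
  · intro v hv
    have hset : {t | v ∈ Sum.elim T₁.bag T₂.bag t} =
        Sum.inl '' {t | v ∈ T₁.bag t} ∪ Sum.inr '' {t | v ∈ T₂.bag t} := by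
      ext (t | t) <;> simp
    have h1 := fun h => connected_induce_image (T := T) Sum.inl
      (fun x y h => .inl h) (T₁.connected v h)
    have h2 := fun h => connected_induce_image (T := T) Sum.inr
      (fun x y h => .inl h) (T₂.connected v h)
    have e1 : v ∉ W₁ → {t | v ∈ T₁.bag t} = ∅ := fun h => by
      ext t
      simpa using fun ht => h (T₁.bag_subset t ht)
    have e2 : v ∉ W₂ → {t | v ∈ T₂.bag t} = ∅ := fun h => by
      ext t
      simpa using fun ht => h (T₂.bag_subset t ht)
    rw [hset]
    by_cases hv1 : v ∈ W₁
    · by_cases hv2 : v ∈ W₂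
      · have hvS := Finset.mem_inter.2 ⟨hv1, hv2⟩
        -- A vertex of both parts lies in the separator, so its two subtrees contain the ends of the
        -- new edge.
        refine SimpleGraph.connected_induce_union (h1 hv1).preconnected (h2 hv2).preconnected
          (Set.mem_image_of_mem _ (ha hvS)) (Set.mem_image_of_mem _ (hb hvS)) (.inr ?_)
        simp [SimpleGraph.edge]
      · rw [e2 hv2, Set.image_empty, Set.union_empty]
        exact h1 hv1
    · rw [e1 hv1, Set.image_empty, Set.empty_union]
      exact h2 (by rw [← hW, Finset.mem_union] at hv; tauto)

/-- Induction on `W`: a clique is a single bag, and any other set splits along a clique separator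
into two proper subsets. -/
theorem IsChordal.nonempty_cliqueTree (hG : IsChordal G) (W : Finset V) :
    Nonempty (CliqueTree G W) := by
  classical
  induction W using Finset.strongInduction with
  | H W ih =>
    by_cases hW : G.IsClique W
    · refine ⟨⟨Unit, inferInstance, ⊥, .of_subsingleton, fun _ => W, fun _ => subset_rfl,
        fun _ => hW, fun K hK _ => ⟨(), hK⟩, fun v hv => ?_⟩⟩
      have : Nonempty {t : Unit | v ∈ W} := ⟨⟨(), hv⟩⟩
      exact (SimpleGraph.IsTree.of_subsingleton).connected
    · obtain ⟨W₁, W₂, h1, h2, hu, hS, hK⟩ := hG.exists_separation hW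
      obtain ⟨T₁⟩ := ih W₁ h1
      obtain ⟨T₂⟩ := ih W₂ h2
      exact T₁.join T₂ hu hS hK

/-! ### Treewidth of chordal graphs and chordal instances -/

theorem IsChordal.treewidth_le [Fintype V] (hG : IsChordal G) {w : ℕ}
    (hw : ∀ K : Finset V, G.IsClique K → K.card ≤ w + 1) : treewidth G ≤ w := by
  classical
  obtain ⟨T⟩ := hG.nonempty_cliqueTree Finset.univ
  refine Nat.sInf_le ⟨⟨T.Node, T.finite_node, T.tree, T.isTree, T.bag, fun v => ?_, fun u v h => ?_,
    fun v => T.connected v (Finset.mem_univ v)⟩, fun t => hw _ (T.isClique_bag t)⟩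
  · obtain ⟨t, ht⟩ := T.exists_subset_bag {v} (Finset.subset_univ _) (by simp)
    exact ⟨t, ht (by simp)⟩
  · obtain ⟨t, ht⟩ := T.exists_subset_bag {u, v} (Finset.subset_univ _)
      (by simpa using fun _ => h)
    exact ⟨t, ht (by simp), ht (by simp)⟩

/-- Bundles are independent, so an allocation is injective on a clique. -/
theorem Instance.IsYes.card_le_of_isClique [Fintype V] {I : Instance V} {k : ℕ} (h : I.IsYes k)
    {K : Finset V} (hK : I.graph.IsClique K) : K.card ≤ k := by
  obtain ⟨a, ha⟩ := h
  refine (Finset.card_le_card_of_injOn a (fun _ _ => Finset.mem_univ _) fun u hu v hv huv => ?_).trans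
    (Finset.card_fin k).le
  by_contra hne
  exact (ha (a v)).1 huv rfl hne (hK hu hv hne)

theorem IsChordal.treewidth_lt [Fintype V] {I : Instance V} {k : ℕ} (hk : 0 < k)
    (hI : IsChordal I.graph) (h : I.IsYes k) : treewidth I.graph < k := by
  have := hI.treewidth_le (w := k - 1) fun K hK => by
    have := h.card_le_of_isClique hK
    omega
  omega

/-- The program for treewidth `k - 1` needs no promise on its input. Its solutions are always
correct, and its answer "no" could be wrong only for treewidth at least `k`, where a chordal
instance is a no-instance anyway. -/
theorem polyTimeSolvable_of_isChordal {k : ℕ} (hk : 0 < k) :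
    PolyTimeSolvable k fun _ G => IsChordal G := by
  obtain ⟨p, f, h⟩ := exists_program hk (k - 1)
  refine ⟨p, f, fun n I hI => ?_⟩
  obtain ⟨t, s, hr, ht, hs⟩ := h n I
  refine ⟨t, s, hr, ht, hs.imp_right fun h => ⟨h.1, fun hyes => h.2 ?_ hyes⟩⟩
  have := hI.treewidth_lt hk hyes
  omega

end

end BCFEA

theorem mainTheorem8 (k : ℕ) (hk : 0 < k) :
    (∀ w : ℕ, BCFEA.PolyTimeSolvable k (fun _ G => BCFEA.treewidth G ≤ w)) ∧
    BCFEA.PolyTimeSolvable k (fun _ G => BCFEA.IsChordal G) ∧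
    (∀ (V : Type*) [Fintype V] (I : BCFEA.Instance V),
      BCFEA.IsChordal I.graph → I.IsYes k →
        I.graph.cliqueNum ≤ k ∧ BCFEA.treewidth I.graph < k) :=
  ⟨BCFEA.polyTimeSolvable_of_treewidth hk, BCFEA.polyTimeSolvable_of_isChordal hk,
    fun _ _ I hI h => ⟨by
      obtain ⟨K, hK⟩ := I.graph.exists_isNClique_cliqueNum
      rw [← hK.card_eq]
      exact h.card_le_of_isClique hK.isClique, hI.treewidth_lt hk h⟩⟩
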